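/- Let $(\mathcal V,\otimes,\mathbf 1,[-,-])$ be a complete and cocomplete symmetric monoidal closed category and let $X$ be a set. Let $S(X)$ be the groupoid whose objects are the finite sequences $\overline x=(x_1,\dots,x_n)$ of elements of $X$ (with $n\ge 0$) and whose morphisms $(x_1,\dots,x_n)\to(y_1,\dots,y_n)$ are the permutations $\sigma\in S_n$ with $x_i=y_{\sigma(i)}$ (there are none between sequences of different lengths). Concatenation of sequences is written as juxtaposition. Let $P$ be a symmetric $X$-colored operad in $\mathcal V$: objects $P(\overline u;y)$, contravariantly functorial in $\overline u\in S(X)$, for $y\in X$, with units $\mathbf 1\to P((y);y)$ and compositions $$P(\overline u;y)\otimes P(\overline w_1;u_1)\otimes\dots\otimes P(\overline w_n;u_n)\to P(\overline w_1\dots\overline w_n;y)$$ which are natural in the $\overline w_i$, compatible with permutations of $\overline u$, associative and unital. Let $\mathbb P$ be the associated PROP, $$\mathbb P(\overline x;\overline y)=\int^{\overline z_1,\dots,\overline z_n\in S(X)}S(X)(\overline x;\overline z_1\dots\overline z_n)\otimes\bigotimes_{i=1}^nP(\overline z_i;y_i)\qquad(\overline y=(y_1,\dots,y_n)),$$ with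 the composition and the identities induced by those of $P$. Let $\mathcal V^{S(X)}$ be the category of functors $S(X)^{op}\to\mathcal V$ and $\mathcal V^X$ the category of $X$-indexed families of objects of $\mathcal V$. Let $\mathbb P^\wedge$ be the endofunctor of $\mathcal V^{S(X)}$ given by $$\mathbb P^\wedge(N)(\overline y)=\int_{\overline x\in S(X)}[\mathbb P(\overline x;\overline y),N(\overline x)],$$ with the counit $\mathbb P^\wedge\to\mathrm{Id}$ and the comultiplication $\mathbb P^\wedge\to\mathbb P^\wedge\mathbb P^\wedge$ induced by the identities and the composition of $\mathbb P$. Let $$\epsilon:\mathcal V^X\to\mathcal V^{S(X)},\quad \epsilon(C)(\overline x)=C(x_1)\otimes\dots\otimes C(x_n),\qquad \pi:\mathcal V^{S(X)}\to\mathcal V^X,\quad \pi(N)(x)=N((x)),$$ so that $\pi\epsilon\cong\mathrm{Id}$. For a functor $N:S(X)^{op}\to\mathcal V$ equipped with maps $\bigotimes_iN(\overline z_i)\to N(\overline z_1\dots\overline z_n)$, natural in the $\overline z_i$ and compatible with permutations of blocks, the functor $\mathbb P^\wedge(N)$ is equipped with the maps $\bigotimes_i\mathbb P^\wedge(N)(\overline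 z_i)\to\mathbb P^\wedge(N)(\overline z_1\dots\overline z_n)$ obtained from $$\bigotimes_i[\mathbb P(\overline x_i;\overline z_i),N(\overline x_i)]\to\Big[\bigotimes_i\mathbb P(\overline x_i;\overline z_i),\bigotimes_iN(\overline x_i)\Big]\to\Big[\bigotimes_i\mathbb P(\overline x_i;\overline z_i),N(\overline x_1\dots\overline x_n)\Big]$$ and from the decomposition of $\mathbb P(-;\overline z_1\dots\overline z_n)$ through the $\mathbb P(-;\overline z_i)$. Starting from the canonical isomorphisms $\bigotimes_i\epsilon(C)(\overline z_i)\cong\epsilon(C)(\overline z_1\dots\overline z_n)$ and iterating, one gets such maps for $N=(\mathbb P^\wedge)^m\epsilon(C)$ for all $m\ge0$. Taking for the $\overline z_i$ the one-term sequences $(x_i)$, they give a natural transformation $\beta_m:\epsilon\pi(\mathbb P^\wedge)^m\epsilon\to(\mathbb P^\wedge)^m\epsilon$. Put, for $n,m\ge0$, $$\alpha_{n,m}=\pi(\mathbb P^\wedge)^n(\beta_m):\ \pi(\mathbb P^\wedge)^n\epsilon\,\pi(\mathbb P^\wedge)^m\epsilon\longrightarrow\pi(\mathbb P^\wedge)^{n+m}\epsilon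 .$$ Let $\Delta_+$ be the category of finite, possibly empty, ordinals with monotone maps, monoidal for the ordinal sum. Proposition. There is a functor $\Delta_+^{op}\to\mathrm{End}(\mathcal V^{S(X)})$ which is $n\mapsto(\mathbb P^\wedge)^n$ on objects and which sends the faces and the degeneracies to the maps given by the counit and the comultiplication of $\mathbb P^\wedge$ applied to the $i$-th factor. The composite functor $$\Delta_+^{op}\to\mathrm{End}(\mathcal V^X),\qquad n\mapsto P^\wedge_n=\pi(\mathbb P^\wedge)^n\epsilon,$$ is lax monoidal from $(\Delta_+^{op},+)$ to $(\mathrm{End}(\mathcal V^X),\circ)$, with the maps $\alpha_{n,m}:P^\wedge_n\circ P^\wedge_m\to P^\wedge_{n+m}$ as its multiplication and with the canonical isomorphism $\mathrm{Id}\cong\pi\epsilon=P^\wedge_0$ as its unit. That is, $P^\wedge$ is a lax comonad. -/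

import Mathlib

open CategoryTheory Limits Opposite
open MonoidalCategory hiding tensorHom_def
universe v u w

section Tens
variable {V : Type u} [Category.{v} V] [MonoidalCategory V]

/-- The tensor product of a family over a list. -/
@[reducible] def tens {ι : Type} (A : ι → V) : List ι → V
  | [] => 𝟙_ V
  | a :: l => A a ⊗ tens A l

def tensMap {ι : Type} {A B : ι → V} (f : ∀ i, A i ⟶ B i) : ∀ l : List ι, tens A l ⟶ tens B l
  | [] => 𝟙 _
  | a :: l => f a ⊗ₘ tensMap f l

lemma tensMap_id {ι : Type} {A : ι → V} (l : List ι) : tensMap (fun i => 𝟙 (A i)) l = 𝟙 _ := by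
  induction l with
  | nil => rfl
  | cons a l ih => simp [tensMap, ih]

variable [SymmetricCategory V]

def swapHead (A B Z : V) : A ⊗ (B ⊗ Z) ⟶ B ⊗ (A ⊗ Z) :=
  (α_ A B Z).inv ≫ (β_ A B).hom ▷ Z ≫ (α_ B A Z).hom

/-- The symmetries moving the first factor to another place. -/
inductive IsInsertion {ι : Type} (A : ι → V) (a : ι) :
    ∀ l m : List ι, (A a ⊗ tens A l ⟶ tens A m) → Prop
  | here (l : List ι) : IsInsertion A a l (a :: l) (𝟙 _)
  | there (b : ι) {l m : List ι} {f : A a ⊗ tens A l ⟶ tens A m} (hf : IsInsertion A a l m f) :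
      IsInsertion A a (b :: l) (b :: m) (swapHead (A a) (A b) (tens A l) ≫ A b ◁ f)

/-- Tensor products of morphisms followed by symmetries, where `e` tells which factor goes where. -/
inductive IsReindexing {ι κ : Type} {A : ι → V} {B : κ → V} (e : ι → κ) (f : ∀ i, A i ⟶ B (e i)) :
    ∀ (l : List ι) (m : List κ), (tens A l ⟶ tens B m) → Prop
  | nil : IsReindexing e f [] [] (𝟙 _)
  | cons (a : ι) {l : List ι} {m m' : List κ} {g : tens A l ⟶ tens B m}
      {h : B (e a) ⊗ tens B m ⟶ tens B m'} (hg : IsReindexing e f l m g)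
      (hh : IsInsertion B (e a) m m' h) :
      IsReindexing e f (a :: l) m' ((f a ⊗ₘ g) ≫ h)

lemma swapHead_natural {A A' B B' Z Z' : V} (f : A ⟶ A') (g : B ⟶ B') (h : Z ⟶ Z') :
    (f ⊗ₘ (g ⊗ₘ h)) ≫ swapHead A' B' Z' = swapHead A B Z ≫ (g ⊗ₘ (f ⊗ₘ h)) := by
  simp only [swapHead, Category.assoc]
  rw [associator_inv_naturality_assoc, ← tensorHom_id, tensorHom_comp_tensorHom_assoc,
    BraidedCategory.braiding_naturality, Category.comp_id, ← associator_naturality, ← tensorHom_id,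
    tensorHom_comp_tensorHom_assoc, Category.id_comp]

lemma swapHead_swapHead (A B Z : V) : swapHead A B Z ≫ swapHead B A Z = 𝟙 _ := by
  simp [swapHead, ← comp_whiskerRight_assoc]

lemma swapHead_yb (A B C Z : V) :
    B ◁ swapHead A C Z ≫ swapHead B C (A ⊗ Z) ≫ C ◁ swapHead B A Z =
      swapHead B A (C ⊗ Z) ≫ A ◁ swapHead B C Z ≫ swapHead A C (B ⊗ Z) := by
  have h := congrArg (fun t => (α_ B A (C ⊗ Z)).inv ≫ (α_ (B ⊗ A) C Z).inv ≫
    (α_ B A C).hom ▷ Z ≫ t ▷ Z ≫ (α_ _ _ _).hom ≫ C ◁ (α_ _ _ _).hom) (BraidedCategory.yang_baxter B A C)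
  simp only [comp_whiskerRight, Category.assoc] at h
  simp only [swapHead]
  calc _ = _ := ?_
    _ = _ := h.symm
    _ = _ := ?_
  · monoidal
  · monoidal

lemma IsInsertion.swap {ι : Type} {A : ι → V} {a b : ι} {l m r : List ι}
    {f : A a ⊗ tens A l ⟶ tens A m} {g : A b ⊗ tens A m ⟶ tens A r}
    (hf : IsInsertion A a l m f) (hg : IsInsertion A b m r g) :
    ∃ (l' : List ι) (f' : A b ⊗ tens A l ⟶ tens A l') (g' : A a ⊗ tens A l' ⟶ tens A r),
      IsInsertion A b l l' f' ∧ IsInsertion A a l' r g' ∧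
      A b ◁ f ≫ g = swapHead (A b) (A a) (tens A l) ≫ A a ◁ f' ≫ g' := by
  induction hg generalizing l with
  | here m => exact ⟨_, _, _, .here l, .there b hf, by
      simp only [whiskerLeft_id, Category.id_comp, Category.comp_id]
      exact (by simp [reassoc_of% (swapHead_swapHead (A b) (A a) (tens A l))])⟩
  | @there c m r g hg ih =>
    cases hf with
    | here => exact ⟨_, _, _, hg, .here _, by simp⟩
    | @there _ l _ f hf =>
      obtain ⟨l', f', g', hf', hg', h⟩ := ih hf
      refine ⟨_, _, _, .there c hf', .there c hg', ?_⟩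
      have n1 := swapHead_natural (𝟙 (A b)) (𝟙 (A c)) f
      have n2 := swapHead_natural (𝟙 (A a)) (𝟙 (A c)) f'
      simp only [id_tensorHom] at n1 n2
      have := swapHead_yb (A a) (A b) (A c) (tens A l)
      simp only [tens, MonoidalCategory.whiskerLeft_comp, Category.assoc]
      rw [reassoc_of% n1, reassoc_of% n2, ← MonoidalCategory.whiskerLeft_comp, h]
      simp only [MonoidalCategory.whiskerLeft_comp]
      rw [reassoc_of% this]

lemma IsReindexing.insertion {ι κ : Type} {A : ι → V} {B : κ → V} {e : ι → κ}
    {f : ∀ i, A i ⟶ B (e i)} {a : ι} {m' m : List ι} {r : List κ}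
    {h : A a ⊗ tens A m' ⟶ tens A m} {g : tens A m ⟶ tens B r}
    (hh : IsInsertion A a m' m h) (hg : IsReindexing e f m r g) :
    ∃ (r' : List κ) (g' : tens A m' ⟶ tens B r') (h' : B (e a) ⊗ tens B r' ⟶ tens B r),
      IsReindexing e f m' r' g' ∧ IsInsertion B (e a) r' r h' ∧ h ≫ g = (f a ⊗ₘ g') ≫ h' := by
  induction hh generalizing r with
  | here l =>
    cases hg with
    | cons _ hg hi => exact ⟨_, _, _, hg, hi, by simp⟩
  | @there b l m h hh ih =>
    cases hg with
    | cons _ hg hi =>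
      obtain ⟨r', g', h', hg', hh', q⟩ := ih hg
      obtain ⟨r'', f', g'', h1, h2, q'⟩ := hh'.swap hi
      refine ⟨_, _, _, .cons _ hg' h1, h2, ?_⟩
      rw [Category.assoc, ← id_tensorHom, tensorHom_comp_tensorHom_assoc, Category.id_comp, q]
      have e1 : f b ⊗ₘ (f a ⊗ₘ g') ≫ h' = (f b ⊗ₘ (f a ⊗ₘ g')) ≫ B (e b) ◁ h' := by
        rw [← id_tensorHom, tensorHom_comp_tensorHom, Category.comp_id]
      have e2 : f a ⊗ₘ (f b ⊗ₘ g') ≫ f' = (f a ⊗ₘ (f b ⊗ₘ g')) ≫ B (e a) ◁ f' := by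
        rw [← id_tensorHom, tensorHom_comp_tensorHom, Category.comp_id]
      rw [e1, e2, Category.assoc, q']
      have n := swapHead_natural (f b) (f a) g'
      rw [reassoc_of% n, reassoc_of% (swapHead_swapHead (A a) (A b) (tens A l)), Category.assoc]

lemma IsReindexing.comp {ι κ μ : Type} {A : ι → V} {B : κ → V} {C : μ → V} {e : ι → κ} {e' : κ → μ}
    {f : ∀ i, A i ⟶ B (e i)} {f' : ∀ i, B i ⟶ C (e' i)} {l : List ι} {m : List κ} {r : List μ}
    {g : tens A l ⟶ tens B m} {g' : tens B m ⟶ tens C r}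
    (hg : IsReindexing e f l m g) (hg' : IsReindexing e' f' m r g') :
    IsReindexing (e' ∘ e) (fun i => f i ≫ f' (e i)) l r (g ≫ g') := by
  induction hg generalizing r with
  | nil =>
    cases hg'
    simpa using IsReindexing.nil
  | cons a hg hh ih =>
    obtain ⟨r', g'', h', h1, h2, q⟩ := hg'.insertion hh
    rw [Category.assoc, q, tensorHom_comp_tensorHom_assoc]
    exact .cons a (ih h1) h2

lemma IsReindexing.id {ι : Type} (A : ι → V) (l : List ι) :
    IsReindexing (A := A) (B := A) (fun i => i) (fun i => 𝟙 (A i)) l l (𝟙 _) := by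
  induction l with
  | nil => exact .nil
  | cons a l ih => simpa using IsReindexing.cons a ih (.here l)

lemma IsInsertion.perm {ι : Type} {A : ι → V} {a : ι} {l m : List ι}
    {f : A a ⊗ tens A l ⟶ tens A m} (h : IsInsertion A a l m f) : (a :: l).Perm m := by
  induction h with
  | here => exact .refl _
  | there b _ ih => exact (List.Perm.swap _ _ _).trans (ih.cons b)

lemma IsReindexing.perm {ι κ : Type} {A : ι → V} {B : κ → V} {e : ι → κ} {f : ∀ i, A i ⟶ B (e i)}
    {l : List ι} {m : List κ} {g : tens A l ⟶ tens B m} (hg : IsReindexing e f l m g) :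
    (l.map e).Perm m := by
  induction hg with
  | nil => exact .refl _
  | cons a _ hh ih => exact (ih.cons _).trans hh.perm

lemma exists_isInsertion {ι : Type} (A : ι → V) {a : ι} {m : List ι} (h : a ∈ m) :
    ∃ (l : List ι) (f : A a ⊗ tens A l ⟶ tens A m), IsInsertion A a l m f := by
  induction m with
  | nil => simp at h
  | cons b m ih =>
    rcases List.mem_cons.1 h with rfl | h
    · exact ⟨_, _, .here _⟩
    · obtain ⟨l, f, hf⟩ := ih h
      exact ⟨_, _, .there b hf⟩

lemma exists_isReindexing {ι κ : Type} {A : ι → V} {B : κ → V} (e : ι → κ) (f : ∀ i, A i ⟶ B (e i))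
    {l : List ι} {m : List κ} (h : (l.map e).Perm m) :
    ∃ g : tens A l ⟶ tens B m, IsReindexing e f l m g := by
  induction l generalizing m with
  | nil =>
    obtain rfl := (List.nil_perm.1 h)
    exact ⟨_, .nil⟩
  | cons a l ih =>
    obtain ⟨m', k, hk⟩ := exists_isInsertion B (h.subset (by simp : e a ∈ (a :: l).map e))
    obtain ⟨g, hg⟩ := ih (m := m') ((h.trans hk.perm.symm).cons_inv)
    exact ⟨_, .cons a hg hk⟩

lemma IsInsertion.unique {ι : Type} {A : ι → V} {a : ι} {l l' m : List ι}
    {f : A a ⊗ tens A l ⟶ tens A m} {f' : A a ⊗ tens A l' ⟶ tens A m}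
    (hm : m.Nodup) (h : IsInsertion A a l m f) (h' : IsInsertion A a l' m f') :
    l = l' ∧ HEq f f' := by
  induction h generalizing l' with
  | here l =>
    cases h' with
    | here => exact ⟨rfl, .rfl⟩
    | there _ h' => exact absurd (h'.perm.subset (by simp)) (List.nodup_cons.1 hm).1
  | there b h ih =>
    cases h' with
    | here => exact absurd (h.perm.subset (by simp)) (List.nodup_cons.1 hm).1
    | there _ h' =>
      obtain ⟨rfl, q⟩ := ih (List.nodup_cons.1 hm).2 h'
      obtain rfl := eq_of_heq q
      exact ⟨rfl, .rfl⟩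

lemma IsReindexing.unique {ι κ : Type} {A : ι → V} {B : κ → V} {e : ι → κ} {f : ∀ i, A i ⟶ B (e i)}
    {l : List ι} {m : List κ} {g g' : tens A l ⟶ tens B m} (hm : m.Nodup)
    (hg : IsReindexing e f l m g) (hg' : IsReindexing e f l m g') : g = g' := by
  induction hg with
  | nil => cases hg'; rfl
  | cons a hg hh ih =>
    cases hg' with
    | cons _ hg' hh' =>
      obtain ⟨rfl, q⟩ := hh.unique hm hh'
      obtain rfl := eq_of_heq q
      obtain rfl := ih (List.nodup_cons.1 (hh.perm.nodup_iff.2 hm)).2 hg'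
      rfl

/-- Formal tensor products. -/
inductive TensTree (ι : Type) : Type 1
  | leaf (i : ι) : TensTree ι
  | unit : TensTree ι
  | node (s t : TensTree ι) : TensTree ι
  | big {κ : Type} (l : List κ) (t : κ → TensTree ι) : TensTree ι

namespace TensTree
variable {ι κ μ : Type}

@[reducible] def ev (A : ι → V) : TensTree ι → V
  | leaf i => A i
  | unit => 𝟙_ V
  | node s t => ev A s ⊗ ev A t
  | big l t => tens (fun k => ev A (t k)) l

@[reducible] def flat : TensTree ι → List ι → List ι
  | leaf i, r => i :: r
  | unit, r => r
  | node s t, r => flat s (flat t r)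
  | big l t, r => l.foldr (fun k r => flat (t k) r) r

@[reducible] def normBig {ν : Type} (A : ι → V) {E : ν → V} {F : ν → List ι → List ι}
    (N : ∀ k r, E k ⊗ tens A r ≅ tens A (F k r)) :
    ∀ (l : List ν) (r : List ι), tens E l ⊗ tens A r ≅ tens A (l.foldr F r)
  | [], _ => λ_ _
  | a :: l, r => α_ _ _ _ ≪≫ whiskerLeftIso _ (normBig A N l r) ≪≫ N a (l.foldr F r)

@[reducible] def norm (A : ι → V) : ∀ (t : TensTree ι) (r : List ι), ev A t ⊗ tens A r ≅ tens A (flat t r)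
  | leaf _, _ => Iso.refl _
  | unit, _ => λ_ _
  | node s t, r => α_ _ _ _ ≪≫ whiskerLeftIso _ (norm A t r) ≪≫ norm A s (flat t r)
  | big l t, r => normBig A (fun k r => norm A (t k) r) l r

/-- canonical -/
def IsCan {A : ι → V} {B : κ → V} (e : ι → κ) (φ : ∀ i, A i ⟶ B (e i)) (s : TensTree ι) (t : TensTree κ)
    (f : ev A s ⟶ ev B t) : Prop :=
  ∀ (r : List ι) (r' : List κ) (g : tens A r ⟶ tens B r'), IsReindexing e φ r r' g →
    IsReindexing e φ (flat s r) (flat t r') ((norm A s r).inv ≫ (f ⊗ₘ g) ≫ (norm B t r').hom)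

abbrev IsStr {A : ι → V} (s t : TensTree ι) (f : ev A s ⟶ ev A t) : Prop :=
  IsCan (A := A) (B := A) (fun i => i) (fun i => 𝟙 (A i)) s t f

variable {A : ι → V} {B : κ → V} {C : μ → V} {e : ι → κ} {φ : ∀ i, A i ⟶ B (e i)}

lemma _root_.IsReindexing.decomp {e' : κ → μ} {φ' : ∀ i, B i ⟶ C (e' i)} {l : List ι} {m : List μ}
    {g : tens A l ⟶ tens C m} (h : IsReindexing (e' ∘ e) (fun i => φ i ≫ φ' (e i)) l m g) :
    ∃ (g₁ : tens A l ⟶ tens B (l.map e)) (g₂ : tens B (l.map e) ⟶ tens C m),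
      IsReindexing e φ l (l.map e) g₁ ∧ IsReindexing e' φ' (l.map e) m g₂ ∧ g = g₁ ≫ g₂ := by
  induction h with
  | nil => exact ⟨_, _, .nil, .nil, by simp⟩
  | cons a hg hh ih =>
    obtain ⟨g₁, g₂, h₁, h₂, rfl⟩ := ih
    exact ⟨_, _, .cons a h₁ (.here _), .cons _ h₂ hh, by simp⟩

lemma IsCan.comp {e' : κ → μ} {φ' : ∀ i, B i ⟶ C (e' i)} {s : TensTree ι} {t : TensTree κ}
    {u : TensTree μ} {f : ev A s ⟶ ev B t} {g : ev B t ⟶ ev C u}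
    (hf : IsCan e φ s t f) (hg : IsCan e' φ' t u g) :
    IsCan (e' ∘ e) (fun i => φ i ≫ φ' (e i)) s u (f ≫ g) := by
  intro r r'' k hk
  obtain ⟨k₁, k₂, h₁, h₂, rfl⟩ := hk.decomp
  have := (hf _ _ _ h₁).comp (hg _ _ _ h₂)
  convert this using 1
  simp

lemma IsCan.leaf (i : ι) : IsCan e φ (leaf i) (leaf (e i)) (φ i) := by
  intro r r' g hg
  simpa using IsReindexing.cons i hg (.here _)

lemma IsCan.unit : IsCan e φ unit unit (𝟙 _) := by
  intro r r' g hg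
  simpa using hg

lemma IsCan.node {s s' : TensTree ι} {t t' : TensTree κ} {f : ev A s ⟶ ev B t} {f' : ev A s' ⟶ ev B t'}
    (h : IsCan e φ s t f) (h' : IsCan e φ s' t' f') :
    IsCan e φ (node s s') (node t t') (f ⊗ₘ f') := by
  intro r r' g hg
  have := h _ _ _ (h' _ _ _ hg)
  convert this using 1
  simp only [Iso.trans_inv, Iso.trans_hom, whiskerLeftIso_inv, whiskerLeftIso_hom,
    MonoidalCategory.tensorHom_def, MonoidalCategory.whiskerLeft_comp, Category.assoc,
    comp_whiskerRight]
  rw [← whisker_exchange_assoc f (norm A s' r).inv]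
  simp

lemma IsCan.big {ν : Type} (l : List ν) {t : ν → TensTree ι} {t' : ν → TensTree κ}
    {f : ∀ k, ev A (t k) ⟶ ev B (t' k)} (h : ∀ k, IsCan e φ (t k) (t' k) (f k)) :
    IsCan e φ (big l t) (big l t') (tensMap f l) := by
  induction l with
  | nil => exact IsCan.unit
  | cons a l ih => exact IsCan.node (h a) ih

lemma IsStr.id (s : TensTree ι) : IsStr (A := A) s s (𝟙 _) := by
  induction s with
  | leaf i => exact IsCan.leaf (φ := fun i => 𝟙 (A i)) i
  | unit => exact IsCan.unit
  | node s t hs ht => simpa using IsCan.node hs ht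
  | big l t h => simpa [tensMap_id] using IsCan.big l h

lemma IsStr.assoc (s t u : TensTree ι) :
    IsStr (A := A) (node (node s t) u) (node s (node t u)) (α_ _ _ _).hom := by
  intro r r' g hg
  have := IsStr.id (A := A) (node s (node t u)) r r' g hg
  convert this using 1
  simp [MonoidalCategory.tensorHom_def]

lemma IsStr.assocInv (s t u : TensTree ι) :
    IsStr (A := A) (node s (node t u)) (node (node s t) u) (α_ _ _ _).inv := by
  intro r r' g hg
  have := IsStr.id (A := A) (node s (node t u)) r r' g hg
  convert this using 1
  simp [MonoidalCategory.tensorHom_def]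

lemma IsStr.leftUnit (s : TensTree ι) : IsStr (A := A) (node unit s) s (λ_ _).hom := by
  intro r r' g hg
  have := IsStr.id (A := A) s r r' g hg
  convert this using 1
  simp [MonoidalCategory.tensorHom_def]

lemma IsStr.leftUnitInv (s : TensTree ι) : IsStr (A := A) s (node unit s) (λ_ _).inv := by
  intro r r' g hg
  have := IsStr.id (A := A) s r r' g hg
  convert this using 1
  simp [MonoidalCategory.tensorHom_def]

lemma IsStr.rightUnit (s : TensTree ι) : IsStr (A := A) (node s unit) s (ρ_ _).hom := by
  intro r r' g hg
  have := IsStr.id (A := A) s r r' g hg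
  convert this using 1
  simp [MonoidalCategory.tensorHom_def]

lemma IsStr.rightUnitInv (s : TensTree ι) : IsStr (A := A) s (node s unit) (ρ_ _).inv := by
  intro r r' g hg
  have := IsStr.id (A := A) s r r' g hg
  convert this using 1
  simp [MonoidalCategory.tensorHom_def]

lemma IsStr.comp_can {s t : TensTree ι} {u : TensTree κ} {f : ev A s ⟶ ev A t} {g : ev A t ⟶ ev B u}
    (h : IsStr s t f) (h' : IsCan e φ t u g) : IsCan e φ s u (f ≫ g) := by
  simpa using! IsCan.comp h h'

lemma IsCan.comp_str {s : TensTree ι} {t u : TensTree κ} {f : ev A s ⟶ ev B t} {g : ev B t ⟶ ev B u}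
    (h : IsCan e φ s t f) (h' : IsStr t u g) : IsCan e φ s u (f ≫ g) := by
  simpa using! IsCan.comp h h'

lemma IsStr.comp {s t u : TensTree ι} {f : ev A s ⟶ ev A t} {g : ev A t ⟶ ev A u}
    (h : IsStr s t f) (h' : IsStr t u g) : IsStr s u (f ≫ g) := h.comp_can h'

lemma IsStr.whiskerLeft (s : TensTree ι) {t u : TensTree ι} {f : ev A t ⟶ ev A u}
    (h : IsStr t u f) : IsStr (node s t) (node s u) (ev A s ◁ f) := by
  simpa using (IsStr.id s).node h

lemma IsStr.whiskerRight (s : TensTree ι) {t u : TensTree ι} {f : ev A t ⟶ ev A u}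
    (h : IsStr t u f) : IsStr (node t s) (node u s) (f ▷ ev A s) := by
  simpa using IsCan.node h (IsStr.id s)

lemma IsStr.braidLeafLeaf (i j : ι) :
    IsStr (A := A) (node (leaf i) (leaf j)) (node (leaf j) (leaf i)) (β_ _ _).hom := by
  intro r r' g hg
  have := IsReindexing.cons i (IsReindexing.cons j hg (.here _)) (.there j (.here _))
  convert this using 1
  have n := swapHead_natural (𝟙 (A i)) (𝟙 (A j)) g
  simp only [_root_.swapHead, id_tensorHom, Category.assoc] at n
  simp [_root_.swapHead, MonoidalCategory.tensorHom_def, n]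

lemma IsStr.braidNode {s t u : TensTree ι}
    (h : IsStr (A := A) (node s t) (node t s) (β_ _ _).hom)
    (h' : IsStr (A := A) (node s u) (node u s) (β_ _ _).hom) :
    IsStr (A := A) (node s (node t u)) (node (node t u) s) (β_ _ _).hom := by
  have := ((IsStr.assocInv s t u).comp (h.whiskerRight u)).comp (((IsStr.assoc t s u).comp
    (h'.whiskerLeft t)).comp (IsStr.assocInv t u s))
  simpa using this

lemma IsStr.braidUnit (s : TensTree ι) :
    IsStr (A := A) (node s unit) (node unit s) (β_ _ _).hom := by
  simpa using (IsStr.rightUnit s).comp (IsStr.leftUnitInv s)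

lemma IsStr.braidLeaf (i : ι) (t : TensTree ι) :
    IsStr (A := A) (node (leaf i) t) (node t (leaf i)) (β_ _ _).hom := by
  induction t with
  | leaf j => exact IsStr.braidLeafLeaf i j
  | unit => exact IsStr.braidUnit _
  | node s t hs ht => exact hs.braidNode ht
  | big l t h =>
    induction l with
    | nil => exact IsStr.braidUnit _
    | cons a l ih => exact (h a).braidNode ih

lemma IsStr.braidNode' {s t u : TensTree ι}
    (h : IsStr (A := A) (node s u) (node u s) (β_ _ _).hom)
    (h' : IsStr (A := A) (node t u) (node u t) (β_ _ _).hom) :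
    IsStr (A := A) (node (node s t) u) (node u (node s t)) (β_ _ _).hom := by
  have := ((IsStr.assoc s t u).comp (h'.whiskerLeft s)).comp (((IsStr.assocInv s u t).comp
    (h.whiskerRight t)).comp (IsStr.assoc u s t))
  simpa using this

lemma IsStr.braidUnit' (s : TensTree ι) :
    IsStr (A := A) (node unit s) (node s unit) (β_ _ _).hom := by
  simpa using (IsStr.leftUnit s).comp (IsStr.rightUnitInv s)

lemma IsStr.braid (s t : TensTree ι) :
    IsStr (A := A) (node s t) (node t s) (β_ _ _).hom := by
  induction s with
  | leaf j => exact IsStr.braidLeaf j t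
  | unit => exact IsStr.braidUnit' _
  | node s t hs ht => exact hs.braidNode' ht
  | big l t h =>
    induction l with
    | nil => exact IsStr.braidUnit' _
    | cons a l ih => exact (h a).braidNode' ih

lemma IsStr.swapHead (s t u : TensTree ι) :
    IsStr (A := A) (node s (node t u)) (node t (node s u)) (swapHead _ _ _) :=
  (IsStr.assocInv s t u).comp (((IsStr.braid s t).whiskerRight u).comp (IsStr.assoc t s u))

lemma IsStr.bigInsertion {ν : Type} {t : ν → TensTree ι} {a : ν} :
    ∀ {l m : List ν} {g : ev A (t a) ⊗ tens (fun k => ev A (t k)) l ⟶ tens (fun k => ev A (t k)) m},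
    IsInsertion (fun k => ev A (t k)) a l m g →
    IsStr (A := A) (TensTree.node (t a) (TensTree.big l t)) (TensTree.big m t) g
  | _, _, _, .here l => IsStr.id (TensTree.big (a :: l) t)
  | _, _, _, .there b hf => (IsStr.swapHead _ _ _).comp ((IsStr.bigInsertion hf).whiskerLeft (t b))

lemma IsCan.bigReindexing {ν ν' : Type} {t : ν → TensTree ι} {t' : ν' → TensTree κ}
    {e' : ν → ν'} {f : ∀ k, ev A (t k) ⟶ ev B (t' (e' k))}
    (h : ∀ k, IsCan e φ (t k) (t' (e' k)) (f k)) : ∀ {l : List ν} {m : List ν'}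
    {g : tens (fun k => ev A (t k)) l ⟶ tens (fun k => ev B (t' k)) m},
    IsReindexing (A := fun k => ev A (t k)) (B := fun k => ev B (t' k)) e' f l m g →
    IsCan e φ (TensTree.big l t) (TensTree.big m t') g
  | _, _, _, .nil => IsCan.unit
  | _, _, _, .cons a hg hh =>
    ((h a).node (IsCan.bigReindexing h hg)).comp_str (IsStr.bigInsertion hh)

lemma IsCan.unique {s : TensTree ι} {t : TensTree κ} {f f' : ev A s ⟶ ev B t}
    (ht : (flat t []).Nodup) (h : IsCan e φ s t f) (h' : IsCan e φ s t f') : f = f' := by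
  have := (h [] [] _ .nil).unique ht (h' [] [] _ .nil)
  simpa using this

end TensTree

section Ops
variable {ι κ : Type}

def tensZip (A B : ι → V) : ∀ l : List ι, tens A l ⊗ tens B l ⟶ tens (fun i => A i ⊗ B i) l
  | [] => (λ_ _).hom
  | _ :: l => tensorμ _ _ _ _ ≫ (_ ◁ tensZip A B l)

def tensSplitAppend (A : ι → V) (m : List ι) : ∀ l : List ι, tens A (l ++ m) ⟶ tens A l ⊗ tens A m
  | [] => (λ_ _).inv
  | _ :: l => (_ ◁ tensSplitAppend A m l) ≫ (α_ _ _ _).inv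

def tensUnmap (e : ι → κ) (A : κ → V) : ∀ l : List ι, tens A (l.map e) ⟶ tens (fun i => A (e i)) l
  | [] => 𝟙 _
  | _ :: l => _ ◁ tensUnmap e A l

def tensSplit {J : ι → Type} (A : (Σ i, J i) → V) (s : ∀ i, List (J i)) :
    ∀ l : List ι, tens A (l.sigma s) ⟶ tens (fun i => tens (fun j => A ⟨i, j⟩) (s i)) l
  | [] => 𝟙 _
  | i :: l => tensSplitAppend A (l.sigma s) ((s i).map (Sigma.mk i)) ≫
      (tensUnmap (Sigma.mk i) A (s i) ⊗ₘ tensSplit A s l)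

def tensOne {A : ι → V} (f : ∀ i, 𝟙_ V ⟶ A i) : ∀ l : List ι, 𝟙_ V ⟶ tens A l
  | [] => 𝟙 _
  | i :: l => (λ_ _).inv ≫ (f i ⊗ₘ tensOne f l)

namespace TensTree

lemma IsStr.tensorMu {A : ι → V} (s t u w : TensTree ι) :
    IsStr (A := A) (node (node s t) (node u w)) (node (node s u) (node t w)) (tensorμ _ _ _ _) := by
  unfold MonoidalCategory.tensorμ
  exact (IsStr.assoc _ _ _).comp (((IsStr.assocInv _ _ _).whiskerLeft _).comp
    ((((IsStr.braid _ _).whiskerRight _).whiskerLeft _).comp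
    (((IsStr.assoc _ _ _).whiskerLeft _).comp (IsStr.assocInv _ _ _))))

lemma IsStr.tensZip {A : ι → V} (l : List κ) (s t : κ → TensTree ι) :
    IsStr (A := A) (node (big l s) (big l t)) (big l (fun k => node (s k) (t k)))
      (tensZip (fun k => ev A (s k)) (fun k => ev A (t k)) l) := by
  induction l with
  | nil => exact IsStr.leftUnit _
  | cons a l ih => exact (IsStr.tensorMu (s a) (big l s) (t a) (big l t)).comp (ih.whiskerLeft _)

lemma IsStr.tensSplitAppend {A : ι → V} (l m : List κ) (s : κ → TensTree ι) :
    IsStr (A := A) (big (l ++ m) s) (node (big l s) (big m s))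
      (tensSplitAppend (fun k => ev A (s k)) m l) := by
  induction l with
  | nil => exact IsStr.leftUnitInv _
  | cons a l ih => exact (ih.whiskerLeft (s a)).comp (IsStr.assocInv _ _ _)

lemma IsStr.tensUnmap {μ : Type} {A : ι → V} (e : μ → κ) (l : List μ) (s : κ → TensTree ι) :
    IsStr (A := A) (big (l.map e) s) (big l (fun k => s (e k)))
      (tensUnmap e (fun k => ev A (s k)) l) := by
  induction l with
  | nil => exact IsStr.id _
  | cons a l ih => exact ih.whiskerLeft _

lemma IsStr.tensSplit {A : ι → V} {J : κ → Type} (l : List κ) (m : ∀ i, List (J i))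
    (s : (Σ i, J i) → TensTree ι) :
    IsStr (A := A) (big (l.sigma m) s) (big l (fun i => big (m i) (fun j => s ⟨i, j⟩)))
      (tensSplit (fun k => ev A (s k)) m l) := by
  induction l with
  | nil => exact IsStr.id _
  | cons a l ih =>
    exact (IsStr.tensSplitAppend ((m a).map (Sigma.mk a)) (l.sigma m) s).comp
      ((IsStr.tensUnmap (Sigma.mk a) (m a) s).node ih)

end TensTree
end Ops
end Tens

/-- An enumeration of a finite type. -/
class Enum (ι : Type) where
  list : List ι
  nodup : list.Nodup
  mem : ∀ i, i ∈ list

instance (n : ℕ) : Enum (Fin n) := ⟨List.finRange n, List.nodup_finRange n, List.mem_finRange⟩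

instance {ι : Type} {κ : ι → Type} [Enum ι] [∀ i, Enum (κ i)] : Enum (Σ i, κ i) where
  list := (Enum.list : List ι).sigma fun _ => Enum.list
  nodup := Enum.nodup.sigma fun _ => Enum.nodup
  mem p := List.mem_sigma.2 ⟨Enum.mem _, Enum.mem _⟩

section BigTensor
variable {V : Type u} [Category.{v} V] [MonoidalCategory V]
variable {ι κ μ : Type} [Enum ι] [Enum κ] [Enum μ]

/-- The tensor product `⨂ i, A i` of a finite family, in the order given by the enumeration. -/
@[reducible] def bigT (A : ι → V) : V := tens A Enum.list

/-- Tensor products of morphisms. -/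
def bigMap {A B : ι → V} (f : ∀ i, A i ⟶ B i) : bigT A ⟶ bigT B := tensMap f _

lemma tensMap_comp {ι : Type} {A B C : ι → V} (f : ∀ i, A i ⟶ B i) (g : ∀ i, B i ⟶ C i) (l : List ι) :
    tensMap f l ≫ tensMap g l = tensMap (fun i => f i ≫ g i) l := by
  induction l with
  | nil => simp [tensMap]
  | cons a l ih => simp [tensMap, ih]

lemma bigMap_comp {A B C : ι → V} (f : ∀ i, A i ⟶ B i) (g : ∀ i, B i ⟶ C i) :
    bigMap f ≫ bigMap g = bigMap (fun i => f i ≫ g i) := tensMap_comp _ _ _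

lemma bigMap_id (A : ι → V) : bigMap (fun i => 𝟙 (A i)) = 𝟙 _ := tensMap_id _

/-- The morphism `𝟙 ⟶ ⨂ i, A i` given by morphisms `𝟙 ⟶ A i`. -/
def bigOne {A : ι → V} (f : ∀ i, 𝟙_ V ⟶ A i) : 𝟙_ V ⟶ bigT A := tensOne f _

lemma tensOne_map {ι : Type} {A B : ι → V} (f : ∀ i, 𝟙_ V ⟶ A i) (g : ∀ i, A i ⟶ B i) (l : List ι) :
    tensOne f l ≫ tensMap g l = tensOne (fun i => f i ≫ g i) l := by
  induction l with
  | nil => simp [tensMap, tensOne]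
  | cons a l ih => simp [tensMap, tensOne, ih]

lemma bigOne_map {A B : ι → V} (f : ∀ i, 𝟙_ V ⟶ A i) (g : ∀ i, A i ⟶ B i) :
    bigOne f ≫ bigMap g = bigOne (fun i => f i ≫ g i) := tensOne_map _ _ _

variable [SymmetricCategory V]

lemma Enum.perm (e : ι ≃ κ) : ((Enum.list : List ι).map e).Perm Enum.list :=
  (List.perm_ext_iff_of_nodup (Enum.nodup.map e.injective) Enum.nodup).2 fun k => by
    simp only [List.mem_map, Enum.mem, true_and, iff_true]
    exact ⟨e.symm k, by simp⟩

/-- The symmetry isomorphism `⨂ i, A i ⟶ ⨂ k, A (e k)`. -/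
noncomputable def bigPull (e : κ ≃ ι) (A : ι → V) : bigT A ⟶ bigT (fun k => A (e k)) :=
  (exists_isReindexing (A := A) (B := fun k => A (e k)) e.symm
    (fun i => eqToHom (congrArg A (e.apply_symm_apply i).symm)) (Enum.perm (e := e.symm))).choose

lemma isReindexing_bigPull (e : κ ≃ ι) (A : ι → V) :
    IsReindexing (A := A) (B := fun k => A (e k)) e.symm
      (fun i => eqToHom (congrArg A (e.apply_symm_apply i).symm)) Enum.list Enum.list
      (bigPull e A) := (exists_isReindexing (A := A) (B := fun k => A (e k)) e.symm
    (fun i => eqToHom (congrArg A (e.apply_symm_apply i).symm)) (Enum.perm (e := e.symm))).choose_spec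

lemma isReindexing_tensMap {ι : Type} {A B : ι → V} (f : ∀ i, A i ⟶ B i) (l : List ι) :
    IsReindexing (A := A) (B := B) (fun i => i) f l l (tensMap f l) := by
  induction l with
  | nil => exact .nil
  | cons a l ih => simpa [tensMap] using IsReindexing.cons a ih (.here l)

lemma bigPull_natural (e : κ ≃ ι) {A B : ι → V} (f : ∀ i, A i ⟶ B i) :
    bigMap f ≫ bigPull e B = bigPull e A ≫ bigMap (fun k => f (e k)) := by
  have key : ∀ i, f i ≫ eqToHom (congrArg B (e.apply_symm_apply i).symm) =
      eqToHom (congrArg A (e.apply_symm_apply i).symm) ≫ f (e (e.symm i)) := by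
    have : ∀ i j (h : i = j), f i ≫ eqToHom (congrArg B h) = eqToHom (congrArg A h) ≫ f j := by
      rintro i _ rfl; simp
    exact fun i => this _ _ (e.apply_symm_apply i).symm
  have h1 := (isReindexing_tensMap f _).comp (isReindexing_bigPull e B)
  have h2 := (isReindexing_bigPull e A).comp (isReindexing_tensMap (fun k => f (e k)) _)
  rw [funext key] at h1
  exact h1.unique Enum.nodup h2

/-- The symmetry isomorphism `(⨂ i, A i) ⊗ (⨂ i, B i) ⟶ ⨂ i, A i ⊗ B i`. -/
def bigZip (A B : ι → V) : bigT A ⊗ bigT B ⟶ bigT (fun i => A i ⊗ B i) := tensZip A B _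

lemma tensZip_natural {ι : Type} {A A' B B' : ι → V} (f : ∀ i, A i ⟶ A' i) (g : ∀ i, B i ⟶ B' i) (l : List ι) :
    (tensMap f l ⊗ₘ tensMap g l) ≫ tensZip A' B' l =
      tensZip A B l ≫ tensMap (fun i => f i ⊗ₘ g i) l := by
  induction l with
  | nil => simp [tensMap, tensZip]
  | cons a l ih =>
    simp only [tensMap, tensZip, ← id_tensorHom, Category.assoc, tensorHom_comp_tensorHom,
      Category.id_comp, ← ih]
    rw [tensorμ_natural_assoc, tensorHom_comp_tensorHom, Category.comp_id]

lemma bigZip_natural {A A' B B' : ι → V} (f : ∀ i, A i ⟶ A' i) (g : ∀ i, B i ⟶ B' i) :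
    (bigMap f ⊗ₘ bigMap g) ≫ bigZip A' B' = bigZip A B ≫ bigMap (fun i => f i ⊗ₘ g i) :=
  tensZip_natural _ _ _

/-- The associativity isomorphism `⨂ (i, j), A (i, j) ⟶ ⨂ i, ⨂ j, A (i, j)`. -/
def bigSplit {J : ι → Type} [∀ i, Enum (J i)] (A : (Σ i, J i) → V) :
    bigT A ⟶ bigT (fun i => bigT (fun j => A ⟨i, j⟩)) := tensSplit A _ _

lemma tensSplitAppend_natural {ι : Type} {A B : ι → V} (f : ∀ i, A i ⟶ B i) (l m : List ι) :
    tensMap f (l ++ m) ≫ tensSplitAppend B m l =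
      tensSplitAppend A m l ≫ (tensMap f l ⊗ₘ tensMap f m) := by
  induction l with
  | nil => simp [tensMap, tensSplitAppend]
  | cons a l ih =>
    simp only [tensMap, tensSplitAppend, List.cons_append, ← id_tensorHom,
      tensorHom_comp_tensorHom_assoc, ih, Category.comp_id, Category.assoc]
    rw [← associator_inv_naturality, tensorHom_comp_tensorHom_assoc, Category.id_comp]

lemma tensUnmap_natural {ι κ : Type} (e : ι → κ) {A B : κ → V} (f : ∀ i, A i ⟶ B i) (l : List ι) :
    tensMap f (l.map e) ≫ tensUnmap e B l = tensUnmap e A l ≫ tensMap (fun i => f (e i)) l := by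
  induction l with
  | nil => rfl
  | cons a l ih =>
    change (f (e a) ⊗ₘ tensMap f (l.map e)) ≫ (_ ◁ tensUnmap e B l) =
      (_ ◁ tensUnmap e A l) ≫ (f (e a) ⊗ₘ tensMap (fun i => f (e i)) l)
    simp only [← id_tensorHom, tensorHom_comp_tensorHom, ih, Category.comp_id, Category.id_comp]

lemma bigSplit_natural {J : ι → Type} [∀ i, Enum (J i)] {A B : (Σ i, J i) → V}
    (f : ∀ p, A p ⟶ B p) :
    bigMap f ≫ bigSplit B = bigSplit A ≫ bigMap (fun i => bigMap (fun j => f ⟨i, j⟩)) := by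
  have : ∀ l : List ι, tensMap f (l.sigma fun _ => Enum.list) ≫ tensSplit B (fun _ => Enum.list) l =
      tensSplit A (fun _ => Enum.list) l ≫
        tensMap (fun i => (bigMap (fun j => f ⟨i, j⟩) : bigT _ ⟶ bigT _)) l := by
    intro l
    induction l with
    | nil => simp [tensMap, tensSplit]
    | cons a l ih =>
      have h1 := tensSplitAppend_natural f ((Enum.list : List (J a)).map (Sigma.mk a))
        (l.sigma fun _ => Enum.list)
      have h2 := tensUnmap_natural (Sigma.mk a) f (Enum.list : List (J a))
      simp only [tensSplit, tensMap, List.sigma_cons, reassoc_of% h1, tensorHom_comp_tensorHom, h2, ih,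
        Category.assoc, bigMap]
  exact this _

namespace TensTree

lemma IsStr.eqToHom {ι : Type} {A : ι → V} {s t : TensTree ι} (h : s = t) :
    IsStr (A := A) s t (eqToHom (congrArg (ev A) h)) := by
  subst h; exact IsStr.id s

lemma IsStr.pull {μ : Type} {A : μ → V} (e : κ ≃ ι) (t : ι → TensTree μ) :
    IsStr (A := A) (big Enum.list t) (big Enum.list (fun k => t (e k)))
      (bigPull e (fun i => ev A (t i))) :=
  IsCan.bigReindexing (t' := fun k => t (e k))
    (fun _ => IsStr.eqToHom (congrArg t (e.apply_symm_apply _).symm)) (isReindexing_bigPull e _)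

lemma IsCan.perm {ι κ : Type} {A : ι → V} {B : κ → V} {e : ι → κ} {φ : ∀ i, A i ⟶ B (e i)} {s : TensTree ι}
    {t : TensTree κ} {f : ev A s ⟶ ev B t} (h : IsCan e φ s t f) :
    ((flat s []).map e).Perm (flat t []) := (h [] [] _ .nil).perm

lemma IsStr.unique {ι : Type} {A : ι → V} {s t : TensTree ι} {f f' : ev A s ⟶ ev A t}
    (hs : (flat s []).Nodup) (h : IsStr s t f) (h' : IsStr s t f') : f = f' :=
  IsCan.unique ((by simpa using! IsCan.perm h : (flat s []).Perm (flat t [])).nodup_iff.1 hs) h h'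

end TensTree
open TensTree

lemma bigPull_trans (e : κ ≃ ι) (e' : μ ≃ κ) (A : ι → V) :
    bigPull e A ≫ bigPull e' (fun k => A (e k)) = bigPull (e'.trans e) A := by
  have h1 := IsStr.pull (A := A) e leaf
  have h2 := IsStr.pull (A := A) e' (fun k => leaf (e k))
  have h3 := IsStr.pull (A := A) (e'.trans e) leaf
  exact IsStr.unique (by simpa using Enum.nodup) (h1.comp h2) h3

lemma bigPull_refl (A : ι → V) : bigPull (Equiv.refl ι) A = 𝟙 _ :=
  IsStr.unique (A := A) (s := big Enum.list leaf) (t := big Enum.list leaf)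
    (by simpa using Enum.nodup) (IsStr.pull (Equiv.refl ι) leaf) (IsStr.id _)

end BigTensor

/-- Finite sequences of elements of `X`. -/
structure ColorSeq (X : Type w) where
  len : ℕ
  col : Fin len → X

namespace ColorSeq
variable {X : Type w}

/-- Morphisms of sequences are permutations that respect the entries. -/
@[ext]
structure Hom (x y : ColorSeq X) where
  equiv : Fin x.len ≃ Fin y.len
  col_eq : ∀ i, x.col i = y.col (equiv i)

instance : Category (ColorSeq X) where
  Hom := Hom
  id x := ⟨Equiv.refl _, fun _ => rfl⟩
  comp f g := ⟨f.equiv.trans g.equiv, fun i => (f.col_eq i).trans (g.col_eq _)⟩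

@[ext] lemma hom_ext {x y : ColorSeq X} {f g : x ⟶ y} (h : ∀ i, f.equiv i = g.equiv i) : f = g :=
  Hom.ext (Equiv.ext h)

@[simp] lemma id_equiv (x : ColorSeq X) : (𝟙 x : x ⟶ x).equiv = Equiv.refl _ := rfl
@[simp] lemma comp_equiv {x y z : ColorSeq X} (f : x ⟶ y) (g : y ⟶ z) :
    (f ≫ g).equiv = f.equiv.trans g.equiv := rfl

/-- The inverse permutation. -/
def rev {x y : ColorSeq X} (f : x ⟶ y) : y ⟶ x where
  equiv := f.equiv.symm
  col_eq i := by rw [f.col_eq, Equiv.apply_symm_apply]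

@[simp] lemma rev_equiv {x y : ColorSeq X} (f : x ⟶ y) : (rev f).equiv = f.equiv.symm := rfl
@[simp] lemma rev_rev {x y : ColorSeq X} (f : x ⟶ y) : rev (rev f) = f := rfl
@[simp] lemma rev_id (x : ColorSeq X) : rev (𝟙 x) = 𝟙 x := rfl
lemma rev_comp {x y z : ColorSeq X} (f : x ⟶ y) (g : y ⟶ z) : rev (f ≫ g) = rev g ≫ rev f := rfl
@[simp] lemma rev_hom {x y : ColorSeq X} (f : x ⟶ y) : rev f ≫ f = 𝟙 _ := by ext; simp
@[simp] lemma hom_rev {x y : ColorSeq X} (f : x ⟶ y) : f ≫ rev f = 𝟙 _ := by ext; simp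
@[simp] lemma rev_hom_assoc {x y z : ColorSeq X} (f : x ⟶ y) (g : y ⟶ z) : rev f ≫ f ≫ g = g := by
  rw [← Category.assoc, rev_hom, Category.id_comp]
@[simp] lemma hom_rev_assoc {x y z : ColorSeq X} (f : x ⟶ y) (g : x ⟶ z) : f ≫ rev f ≫ g = g := by
  rw [← Category.assoc, hom_rev, Category.id_comp]

/-- The sequence with the single entry `c`. -/
def single (c : X) : ColorSeq X := ⟨1, fun _ => c⟩

/-- Concatenation of a list of sequences. -/
def concat {n : ℕ} (z : Fin n → ColorSeq X) : ColorSeq X where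
  len := ∑ i, (z i).len
  col j := (z (finSigmaFinEquiv.symm j).1).col (finSigmaFinEquiv.symm j).2

/-- The entries of a concatenation correspond to pairs of an index and a position. -/
def idx {n : ℕ} (z : Fin n → ColorSeq X) : (Σ i, Fin (z i).len) ≃ Fin (concat z).len :=
  finSigmaFinEquiv

lemma concat_col {n : ℕ} (z : Fin n → ColorSeq X) (j : Fin (concat z).len) :
    (concat z).col j = (z ((idx z).symm j).1).col ((idx z).symm j).2 := rfl

@[simp] lemma col_idx {n : ℕ} (z : Fin n → ColorSeq X) (p : Σ i, Fin (z i).len) :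
    (concat z).col (idx z p) = (z p.1).col p.2 := by
  rw [concat_col, Equiv.symm_apply_apply]

lemma concat_hom_ext {n : ℕ} {z : Fin n → ColorSeq X} {y : ColorSeq X} {f g : concat z ⟶ y}
    (h : ∀ i a, f.equiv (idx z ⟨i, a⟩) = g.equiv (idx z ⟨i, a⟩)) : f = g := by
  ext j
  obtain ⟨⟨i, a⟩, rfl⟩ := (idx z).surjective j
  rw [h]

/-- The morphism out of a concatenation with given effect on positions. -/
def ofIdx {n : ℕ} (z : Fin n → ColorSeq X) {y : ColorSeq X} (e : (Σ i, Fin (z i).len) ≃ Fin y.len)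
    (h : ∀ p, (z p.1).col p.2 = y.col (e p)) : concat z ⟶ y where
  equiv := (idx z).symm.trans e
  col_eq j := by
    obtain ⟨p, rfl⟩ := (idx z).surjective j
    simp [h]

@[simp] lemma ofIdx_equiv {n : ℕ} (z : Fin n → ColorSeq X) {y : ColorSeq X}
    (e : (Σ i, Fin (z i).len) ≃ Fin y.len) (h : ∀ p, (z p.1).col p.2 = y.col (e p))
    (p : Σ i, Fin (z i).len) : (ofIdx z e h).equiv (idx z p) = e p := by
  simp [ofIdx]

/-- Concatenation of morphisms. -/
def concatMap {n : ℕ} {z z' : Fin n → ColorSeq X} (τ : ∀ i, z i ⟶ z' i) : concat z ⟶ concat z' :=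
  ofIdx z ((Equiv.sigmaCongrRight fun i => (τ i).equiv).trans (idx z')) fun p => by
    simp [(τ p.1).col_eq]

@[simp] lemma concatMap_equiv {n : ℕ} {z z' : Fin n → ColorSeq X} (τ : ∀ i, z i ⟶ z' i) (i : Fin n)
    (a : Fin (z i).len) : (concatMap τ).equiv (idx z ⟨i, a⟩) = idx z' ⟨i, (τ i).equiv a⟩ := by
  simp [concatMap]

/-- The block permutation. -/
def concatPush {m n : ℕ} (e : Fin m ≃ Fin n) (z : Fin n → ColorSeq X) :
    concat (fun i => z (e i)) ⟶ concat z :=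
  ofIdx _ ((Equiv.sigmaCongrLeft e).trans (idx z)) fun p => by simp [Equiv.sigmaCongrLeft]

@[simp] lemma concatPush_equiv {m n : ℕ} (e : Fin m ≃ Fin n) (z : Fin n → ColorSeq X) (i : Fin m)
    (a : Fin (z (e i)).len) :
    (concatPush e z).equiv (idx (fun i => z (e i)) ⟨i, a⟩) = idx z ⟨e i, a⟩ := by
  simp [concatPush, Equiv.sigmaCongrLeft]

/-- Removing the inner brackets from an iterated concatenation. -/
def concatAssoc {n : ℕ} (y : Fin n → ColorSeq X) (z : Fin (concat y).len → ColorSeq X) :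
    concat (fun i => concat fun l : Fin (y i).len => z (idx y ⟨i, l⟩)) ⟶ concat z :=
  ofIdx _ (((Equiv.sigmaCongrRight fun i => (idx fun l : Fin (y i).len => z (idx y ⟨i, l⟩)).symm).trans
    (Equiv.sigmaAssoc fun i (l : Fin (y i).len) => Fin (z (idx y ⟨i, l⟩)).len).symm).trans
    ((Equiv.sigmaCongrLeft (β := fun j => Fin (z j).len) (idx y)).trans (idx z))) fun p => by
    obtain ⟨i, a⟩ := p
    obtain ⟨⟨l, a⟩, rfl⟩ := (idx _).surjective a
    simp [Equiv.sigmaCongrLeft]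
    rfl

@[simp] lemma concatAssoc_equiv {n : ℕ} (y : Fin n → ColorSeq X) (z : Fin (concat y).len → ColorSeq X)
    (i : Fin n) (l : Fin (y i).len) (a : Fin (z (idx y ⟨i, l⟩)).len) :
    (concatAssoc y z).equiv (idx (fun i => concat fun l : Fin (y i).len => z (idx y ⟨i, l⟩))
      ⟨i, idx (fun l : Fin (y i).len => z (idx y ⟨i, l⟩)) ⟨l, a⟩⟩) = idx z ⟨idx y ⟨i, l⟩, a⟩ := by
  simp [concatAssoc, Equiv.sigmaCongrLeft]
  exact ⟨rfl, .rfl⟩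

/-- A one-term concatenation. -/
def concatOne (z : Fin 1 → ColorSeq X) : concat z ⟶ z 0 :=
  ofIdx _ (Equiv.uniqueSigma (fun i => Fin (z i).len)) fun p => by
    obtain ⟨i, a⟩ := p
    obtain rfl := Subsingleton.elim 0 i
    rfl

/-- A concatenation of one-term sequences. -/
def concatSingles (u : ColorSeq X) : concat (fun i : Fin u.len => single (u.col i)) ⟶ u :=
  ofIdx _ (Equiv.sigmaUnique (Fin u.len) fun _ => Fin 1) fun p => rfl

@[simp] lemma concatSingles_equiv (u : ColorSeq X) (i : Fin u.len) (a : Fin 1) :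
    (concatSingles u).equiv (idx (fun i : Fin u.len => single (u.col i)) ⟨i, a⟩) = i :=
  ofIdx_equiv (fun i : Fin u.len => single (u.col i)) (Equiv.sigmaUnique (Fin u.len) fun _ => Fin 1)
    (fun p => rfl) ⟨i, a⟩

end ColorSeq

/-- Distributors from sequences of elements of `X` to elements of `X`: the object
`(P y).obj (op x)` is the object of operations from `x` to `y`. -/
abbrev ColoredCollection (X : Type w) (V : Type u) [Category.{v} V] := X → (ColorSeq X)ᵒᵖ ⥤ V

namespace ColoredCollection
open ColorSeq
variable {X : Type w} {V : Type u} [Category.{v} V] (P : ColoredCollection X V)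

/-- Transport along an equality of output colors. -/
def cast {c c' : X} (h : c = c') : P c ⟶ P c' := eqToHom (congrArg P h)

lemma cast_refl (c : X) (h : c = c) : P.cast h = 𝟙 _ := rfl
@[simp] lemma cast_comp {c c' c'' : X} (h : c = c') (h' : c' = c'') :
    P.cast h ≫ P.cast h' = P.cast (h.trans h') := by
  subst h h'; simp [cast]
@[simp] lemma cast_comp_app {c c' c'' : X} (h : c = c') (h' : c' = c'') (x) :
    (P.cast h).app x ≫ (P.cast h').app x = (P.cast (h.trans h')).app x := by
  rw [← P.cast_comp h h']; rfl

variable [MonoidalCategory V]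

/-- The tensor product over `i` of the operations from `w i` to the `i`-th entry of `u`. -/
@[reducible] def arr (u : ColorSeq X) (w : Fin u.len → ColorSeq X) : V :=
  bigT fun i => (P (u.col i)).obj (op (w i))

def arrMap (u : ColorSeq X) {w w' : Fin u.len → ColorSeq X} (τ : ∀ i, w i ⟶ w' i) :
    P.arr u w' ⟶ P.arr u w := bigMap fun i => (P (u.col i)).map (τ i).op

variable [SymmetricCategory V]

/-- The symmetry permuting the tensor factors along `s`. -/
noncomputable def arrPull {u u' : ColorSeq X} (s : u ⟶ u') (w : Fin u'.len → ColorSeq X) :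
    P.arr u' w ⟶ P.arr u fun i => w (s.equiv i) :=
  bigPull s.equiv (fun i => (P (u'.col i)).obj (op (w i))) ≫
    bigMap fun i => (P.cast (s.col_eq i).symm).app _

/-- Bracketing of the tensor factors according to `y`. -/
noncomputable def arrSplit {n : ℕ} (y : Fin n → ColorSeq X) (z : Fin (concat y).len → ColorSeq X) :
    P.arr (concat y) z ⟶ bigT fun i => P.arr (y i) fun l => z (idx y ⟨i, l⟩) :=
  bigPull (idx y) (fun j => (P ((concat y).col j)).obj (op (z j))) ≫
    bigMap (fun p => (P.cast (col_idx y p)).app _) ≫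
    bigSplit fun p : (Σ i, Fin (y i).len) => (P ((y p.1).col p.2)).obj (op (z (idx y p)))

end ColoredCollection

open ColorSeq in
/-- Symmetric colored operads with set of colors `X`: units, compositions
`P (u; y) ⊗ P (w 1; u 1) ⊗ ⋯ ⊗ P (w n; u n) ⟶ P (w 1 ⋯ w n; y)`, natural in the `w i`, compatible with
permutations of `u`, associative and unital. -/
structure ColoredOperad (X : Type w) (V : Type u) [Category.{v} V] [MonoidalCategory V]
    [SymmetricCategory V] where
  obj : ColoredCollection X V
  one (y : X) : 𝟙_ V ⟶ (obj y).obj (op (single y))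
  comp (u : ColorSeq X) (w : Fin u.len → ColorSeq X) (y : X) :
    (obj y).obj (op u) ⊗ obj.arr u w ⟶ (obj y).obj (op (concat w))
  comp_map (u : ColorSeq X) {w w' : Fin u.len → ColorSeq X} (τ : ∀ i, w i ⟶ w' i) (y : X) :
    (_ ◁ obj.arrMap u τ) ≫ comp u w y = comp u w' y ≫ (obj y).map (concatMap τ).op
  comp_perm {u u' : ColorSeq X} (s : u ⟶ u') (w : Fin u'.len → ColorSeq X) (y : X) :
    ((obj y).map s.op ⊗ₘ obj.arrPull s w) ≫ comp u (fun i => w (s.equiv i)) y =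
      comp u' w y ≫ (obj y).map (concatPush s.equiv w).op
  assoc (u : ColorSeq X) (z : Fin u.len → ColorSeq X) (x : Fin (concat z).len → ColorSeq X) (y : X) :
    (comp u z y ▷ _) ≫ comp (concat z) x y ≫ (obj y).map (concatAssoc z x).op =
      (α_ _ _ _).hom ≫ (_ ◁ ((_ ◁ obj.arrSplit z x) ≫ bigZip _ _ ≫
        bigMap fun i => comp (z i) (fun l => x (idx z ⟨i, l⟩)) (u.col i))) ≫
      comp u (fun i => concat fun l => x (idx z ⟨i, l⟩)) y
  one_comp (x : Fin 1 → ColorSeq X) (y : X) :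
    (one y ▷ _) ≫ comp (single y) x y =
      (λ_ _).hom ≫ (ρ_ _).hom ≫ (obj y).map (concatOne x).op
  comp_one (u : ColorSeq X) (y : X) :
    (_ ◁ bigOne fun i => one (u.col i)) ≫ comp u (fun i => single (u.col i)) y =
      (ρ_ _).hom ≫ (obj y).map (concatSingles u).op

instance hasCoproducts_zero (V : Type u) [Category.{v} V] [HasColimits V] :
    HasCoproducts.{0} V := hasCoproducts_shrink.{0, v}

namespace ColoredOperad
open ColorSeq ColoredCollection
variable {X : Type v} {V : Type u} [Category.{v} V] [MonoidalCategory V] [SymmetricCategory V]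
  [HasColimits V] (P : ColoredOperad X V)

/-- `z ↦ ⨂ i, P (z i; y i)` -/
def arrFunctor (y : ColorSeq X) : (Fin y.len → ColorSeq X)ᵒᵖ ⥤ V where
  obj z := P.obj.arr y z.unop
  map τ := P.obj.arrMap y τ.unop
  map_id z := by
    simp only [arrMap]
    rw [← bigMap_id]
    congr 1; funext i; exact (P.obj _).map_id _
  map_comp f g := by
    simp only [arrMap]
    rw [bigMap_comp]
    congr 1; funext i; exact (P.obj _).map_comp _ _

/-- `z ↦ z 1 z 2 ⋯ z n` -/
def concatFunctor (X : Type w) (n : ℕ) : (Fin n → ColorSeq X) ⥤ ColorSeq X where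
  obj z := concat z
  map τ := concatMap τ
  map_id z := concat_hom_ext fun i a => by simp
  map_comp f g := concat_hom_ext fun i a => by simp

/-- `(z', z) ↦ S(X)(x; z 1 ⋯ z n) × ⨂ i, P (z' i; y i)` -/
noncomputable def propDiagram (x y : ColorSeq X) :
    (Fin y.len → ColorSeq X)ᵒᵖ ⥤ (Fin y.len → ColorSeq X) ⥤ V :=
  P.arrFunctor y ⋙ sigmaConst.{0} ⋙ (Functor.whiskeringLeft _ _ _).obj
    (concatFunctor X y.len ⋙ coyoneda.obj (op x))

/-- The coend over `z` of `S(X)(x; z 1 ⋯ z n) × ⨂ i, P (z i; y i)`, where `n` is the length of `y`. -/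
noncomputable def propObj (x y : ColorSeq X) : V := coend (P.propDiagram x y)

end ColoredOperad

namespace ColoredOperad
open ColorSeq ColoredCollection
variable {X : Type v} {V : Type u} [Category.{v} V] [MonoidalCategory V] [SymmetricCategory V]
  [HasColimits V] (P : ColoredOperad X V)

section Coend
variable {x y : ColorSeq X}

lemma ι_propDiagram_left_assoc {z z' : Fin y.len → ColorSeq X} (τ : z ⟶ z') (σ : x ⟶ concat z)
    {A : V} (h : ((P.propDiagram x y).obj (op z)).obj z ⟶ A) :
    Sigma.ι (fun _ : x ⟶ concat z => P.obj.arr y z') σ ≫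
      ((P.propDiagram x y).map τ.op).app z ≫ h =
      P.obj.arrMap y τ ≫ Sigma.ι (fun _ : x ⟶ concat z => P.obj.arr y z) σ ≫ h :=
  Sigma.ι_map_assoc (f := fun _ : x ⟶ concat z => P.obj.arr y z')
    (g := fun _ : x ⟶ concat z => P.obj.arr y z) (fun _ => P.obj.arrMap y τ) σ h

lemma ι_propDiagram_right_assoc {z z' : Fin y.len → ColorSeq X} (τ : z ⟶ z') (σ : x ⟶ concat z)
    {A : V} (h : ((P.propDiagram x y).obj (op z')).obj z' ⟶ A) :
    Sigma.ι (fun _ : x ⟶ concat z => P.obj.arr y z') σ ≫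
      ((P.propDiagram x y).obj (op z')).map τ ≫ h =
      Sigma.ι (fun _ : x ⟶ concat z' => P.obj.arr y z') (σ ≫ concatMap τ) ≫ h :=
  (Sigma.ι_comp_map'_assoc _ _ _ _).trans (Category.id_comp _)

noncomputable def sum (z : Fin y.len → ColorSeq X) :
    (∐ fun _ : x ⟶ concat z => P.obj.arr y z) ⟶ P.propObj x y := coend.ι (P.propDiagram x y) z

/-- The structure morphisms of the coend. -/
noncomputable def ι (z : Fin y.len → ColorSeq X) (σ : x ⟶ concat z) :
    P.obj.arr y z ⟶ P.propObj x y :=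
  Sigma.ι (fun _ : x ⟶ concat z => P.obj.arr y z) σ ≫ P.sum z

lemma ι_map {z z' : Fin y.len → ColorSeq X} (τ : ∀ i, z i ⟶ z' i) (σ : x ⟶ concat z) :
    P.obj.arrMap y τ ≫ P.ι z σ = P.ι z' (σ ≫ concatMap τ) := by
  have := Sigma.ι (fun _ : x ⟶ concat z => P.obj.arr y z') σ ≫=
    coend.condition (P.propDiagram x y) (i := z) (j := z') τ
  erw [ι_propDiagram_left_assoc, ι_propDiagram_right_assoc] at this
  exact this

noncomputable def propDesc {A : V} (f : ∀ z : Fin y.len → ColorSeq X, (x ⟶ concat z) → (P.obj.arr y z ⟶ A))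
    (hf : ∀ (z z' : Fin y.len → ColorSeq X) (τ : ∀ i, z i ⟶ z' i) (σ : x ⟶ concat z),
      P.obj.arrMap y τ ≫ f z σ = f z' (σ ≫ concatMap τ)) : P.propObj x y ⟶ A :=
  coend.desc (F := P.propDiagram x y) (fun z => Sigma.desc fun σ : x ⟶ concat z => f z σ) (by
    intro z z' τ
    apply Sigma.hom_ext
    intro σ
    erw [ι_propDiagram_left_assoc, ι_propDiagram_right_assoc, Sigma.ι_desc, Sigma.ι_desc]
    exact hf _ _ _ _)

@[simp] lemma ι_propDesc {A : V} (f : ∀ z : Fin y.len → ColorSeq X, (x ⟶ concat z) → (P.obj.arr y z ⟶ A))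
    (hf : ∀ (z z' : Fin y.len → ColorSeq X) (τ : ∀ i, z i ⟶ z' i) (σ : x ⟶ concat z),
      P.obj.arrMap y τ ≫ f z σ = f z' (σ ≫ concatMap τ)) (z) (σ : x ⟶ concat z) :
    P.ι z σ ≫ P.propDesc f hf = f z σ := by
  have : P.sum z ≫ P.propDesc f hf = Sigma.desc fun σ : x ⟶ concat z => f z σ :=
    coend.ι_desc _ _ _
  rw [ι, Category.assoc, this, Sigma.ι_desc]

lemma prop_ext {A : V} {f g : P.propObj x y ⟶ A}
    (h : ∀ (z : Fin y.len → ColorSeq X) (σ : x ⟶ concat z), P.ι z σ ≫ f = P.ι z σ ≫ g) : f = g := by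
  apply coend.hom_ext
  intro z
  change P.sum z ≫ f = P.sum z ≫ g
  apply Sigma.hom_ext
  intro σ
  have := h z σ
  simp only [ι, Category.assoc] at this
  exact this

variable [MonoidalClosed V]

lemma prop_ext_left {A B : V} {f g : A ⊗ P.propObj x y ⟶ B}
    (h : ∀ (z : Fin y.len → ColorSeq X) (σ : x ⟶ concat z), (A ◁ P.ι z σ) ≫ f = (A ◁ P.ι z σ) ≫ g) :
    f = g := by
  apply MonoidalClosed.curry_injective
  apply P.prop_ext
  intro z σ
  rw [← MonoidalClosed.curry_natural_left, ← MonoidalClosed.curry_natural_left, h]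

lemma prop_ext_right {A B : V} {f g : P.propObj x y ⊗ A ⟶ B}
    (h : ∀ (z : Fin y.len → ColorSeq X) (σ : x ⟶ concat z), (P.ι z σ ▷ A) ≫ f = (P.ι z σ ▷ A) ≫ g) :
    f = g := by
  rw [← cancel_epi (β_ A (P.propObj x y)).hom]
  apply P.prop_ext_left
  intro z σ
  simp [h]

noncomputable def propDescLeft {A B : V}
    (f : ∀ z : Fin y.len → ColorSeq X, (x ⟶ concat z) → (A ⊗ P.obj.arr y z ⟶ B))
    (hf : ∀ (z z' : Fin y.len → ColorSeq X) (τ : ∀ i, z i ⟶ z' i) (σ : x ⟶ concat z),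
      (A ◁ P.obj.arrMap y τ) ≫ f z σ = f z' (σ ≫ concatMap τ)) : A ⊗ P.propObj x y ⟶ B :=
  MonoidalClosed.uncurry (P.propDesc (fun z σ => MonoidalClosed.curry (f z σ)) fun z z' τ σ => by
    rw [← hf, MonoidalClosed.curry_natural_left])

@[simp] lemma ι_propDescLeft {A B : V}
    (f : ∀ z : Fin y.len → ColorSeq X, (x ⟶ concat z) → (A ⊗ P.obj.arr y z ⟶ B))
    (hf : ∀ (z z' : Fin y.len → ColorSeq X) (τ : ∀ i, z i ⟶ z' i) (σ : x ⟶ concat z),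
      (A ◁ P.obj.arrMap y τ) ≫ f z σ = f z' (σ ≫ concatMap τ)) (z) (σ : x ⟶ concat z) :
    (A ◁ P.ι z σ) ≫ P.propDescLeft f hf = f z σ := by
  rw [propDescLeft, ← MonoidalClosed.uncurry_natural_left, ι_propDesc, MonoidalClosed.uncurry_curry]

noncomputable def propDescRight {A B : V}
    (f : ∀ z : Fin y.len → ColorSeq X, (x ⟶ concat z) → (P.obj.arr y z ⊗ A ⟶ B))
    (hf : ∀ (z z' : Fin y.len → ColorSeq X) (τ : ∀ i, z i ⟶ z' i) (σ : x ⟶ concat z),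
      (P.obj.arrMap y τ ▷ A) ≫ f z σ = f z' (σ ≫ concatMap τ)) : P.propObj x y ⊗ A ⟶ B :=
  (β_ _ _).hom ≫ P.propDescLeft (fun z σ => (β_ _ _).hom ≫ f z σ) fun z z' τ σ => by
    rw [← hf]; simp

@[simp] lemma ι_propDescRight {A B : V}
    (f : ∀ z : Fin y.len → ColorSeq X, (x ⟶ concat z) → (P.obj.arr y z ⊗ A ⟶ B))
    (hf : ∀ (z z' : Fin y.len → ColorSeq X) (τ : ∀ i, z i ⟶ z' i) (σ : x ⟶ concat z),
      (P.obj.arrMap y τ ▷ A) ≫ f z σ = f z' (σ ≫ concatMap τ)) (z) (σ : x ⟶ concat z) :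
    (P.ι z σ ▷ A) ≫ P.propDescRight f hf = f z σ := by
  rw [propDescRight, BraidedCategory.braiding_naturality_left_assoc, ι_propDescLeft,
    SymmetricCategory.symmetry_assoc]

end Coend
end ColoredOperad

namespace ColoredCollection
open ColorSeq
variable {X : Type w} {V : Type u} [Category.{v} V] (P : ColoredCollection X V)

lemma cast_map {c c' : X} (h : c = c') {x x' : ColorSeq X} (f : x ⟶ x') :
    (P c).map f.op ≫ (P.cast h).app _ = (P.cast h).app _ ≫ (P c').map f.op :=
  (P.cast h).naturality _

variable [MonoidalCategory V]

variable [SymmetricCategory V]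

lemma arrMap_arrPull {u u' : ColorSeq X} (s : u ⟶ u') {w w' : Fin u'.len → ColorSeq X}
    (τ : ∀ i, w i ⟶ w' i) :
    P.arrMap u' τ ≫ P.arrPull s w = P.arrPull s w' ≫ P.arrMap u fun i => τ (s.equiv i) := by
  simp only [arrMap, arrPull, Category.assoc]
  rw [← Category.assoc, bigPull_natural, Category.assoc, bigMap_comp, bigMap_comp]
  simp only [cast_map]

lemma arrPull_id {u : ColorSeq X} (w : Fin u.len → ColorSeq X) : P.arrPull (𝟙 u) w = 𝟙 _ := by
  simp only [arrPull, id_equiv]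
  erw [bigPull_refl, Category.id_comp, bigMap_id]
  rfl

lemma arrPull_comp {u u' u'' : ColorSeq X} (s : u ⟶ u') (s' : u' ⟶ u'')
    (w : Fin u''.len → ColorSeq X) :
    P.arrPull (s ≫ s') w = P.arrPull s' w ≫ P.arrPull s fun i => w (s'.equiv i) := by
  simp only [arrPull, Category.assoc]
  rw [← Category.assoc (bigMap _) (bigPull _ _), bigPull_natural, Category.assoc, bigMap_comp,
    ← Category.assoc (bigPull _ _) (bigPull _ _), bigPull_trans]
  simp only [cast_comp_app]
  rfl

lemma arrMap_arrSplit {n : ℕ} (y : Fin n → ColorSeq X) {z z' : Fin (concat y).len → ColorSeq X}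
    (τ : ∀ j, z j ⟶ z' j) :
    P.arrMap (concat y) τ ≫ P.arrSplit y z =
      P.arrSplit y z' ≫ bigMap fun i => P.arrMap (y i) fun l => τ (idx y ⟨i, l⟩) := by
  simp only [arrMap, arrSplit, Category.assoc]
  rw [← Category.assoc (bigMap _) (bigPull _ _), bigPull_natural, Category.assoc,
    ← Category.assoc (bigMap _) (bigMap _), bigMap_comp]
  simp only [cast_map]
  rw [← bigMap_comp, Category.assoc, bigSplit_natural]

end ColoredCollection

namespace ColoredOperad
open ColorSeq ColoredCollection
variable {X : Type v} {V : Type u} [Category.{v} V] [MonoidalCategory V] [SymmetricCategory V]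
  [HasColimits V] (P : ColoredOperad X V)

/-- Functoriality in the source. -/
noncomputable def propPre {x x' : ColorSeq X} (f : x ⟶ x') (y : ColorSeq X) :
    P.propObj x' y ⟶ P.propObj x y :=
  P.propDesc (fun z σ => P.ι z (f ≫ σ)) fun z z' τ σ => by rw [P.ι_map, Category.assoc]

@[simp] lemma ι_propPre {x x' : ColorSeq X} (f : x ⟶ x') (y : ColorSeq X)
    (z : Fin y.len → ColorSeq X) (σ : x' ⟶ concat z) :
    P.ι z σ ≫ P.propPre f y = P.ι z (f ≫ σ) := P.ι_propDesc _ _ _ _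

lemma rev_concatPush_map {m n : ℕ} (e : Fin m ≃ Fin n) {z z' : Fin n → ColorSeq X}
    (τ : ∀ i, z i ⟶ z' i) :
    concatMap τ ≫ rev (concatPush e z') = rev (concatPush e z) ≫ concatMap fun i => τ (e i) := by
  have : concatPush e z ≫ concatMap τ = (concatMap fun i => τ (e i)) ≫ concatPush e z' :=
    concat_hom_ext fun i a => by simp
  rw [← rev_hom_assoc (concatPush e z) (concatMap τ ≫ _), ← Category.assoc _ (concatMap τ), this]
  simp

/-- Functoriality in the target. -/
noncomputable def propPost (x : ColorSeq X) {y y' : ColorSeq X} (s : y' ⟶ y) :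
    P.propObj x y ⟶ P.propObj x y' :=
  P.propDesc (fun z σ => P.obj.arrPull s z ≫
      P.ι (fun i => z (s.equiv i)) (σ ≫ rev (concatPush s.equiv z))) fun z z' τ σ => by
    rw [← Category.assoc, P.obj.arrMap_arrPull, Category.assoc, P.ι_map, Category.assoc, Category.assoc,
      rev_concatPush_map]

@[simp] lemma ι_propPost (x : ColorSeq X) {y y' : ColorSeq X} (s : y' ⟶ y)
    (z : Fin y.len → ColorSeq X) (σ : x ⟶ concat z) :
    P.ι z σ ≫ P.propPost x s = P.obj.arrPull s z ≫
      P.ι (fun i => z (s.equiv i)) (σ ≫ rev (concatPush s.equiv z)) := P.ι_propDesc _ _ _ _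

lemma propPre_propPost {x x' y y' : ColorSeq X} (f : x ⟶ x') (s : y' ⟶ y) :
    P.propPre f y ≫ P.propPost x s = P.propPost x' s ≫ P.propPre f y' := by
  apply P.prop_ext
  intro z σ
  rw [← Category.assoc, ι_propPre, ι_propPost, ← Category.assoc, ι_propPost]
  simp only [Category.assoc, ι_propPre]

lemma propPost_comp (x : ColorSeq X) {y y' y'' : ColorSeq X} (s : y' ⟶ y) (t : y'' ⟶ y') :
    P.propPost x s ≫ P.propPost x t = P.propPost x (t ≫ s) := by
  apply P.prop_ext
  intro z σ
  have : (rev (concatPush s.equiv z) ≫ rev (concatPush t.equiv fun i => z (s.equiv i)) :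
      concat z ⟶ concat fun i => z (s.equiv (t.equiv i))) = rev (concatPush (t ≫ s).equiv z) := by
    rw [← rev_comp]
    exact congrArg rev (concat_hom_ext fun i a => by
      simp; exact (concatPush_equiv (t.equiv.trans s.equiv) z i a).symm)
  rw [← Category.assoc, ι_propPost, Category.assoc, ι_propPost, ι_propPost, arrPull_comp, Category.assoc,
    this]
  exact (Category.assoc _ _ _).symm

lemma propPost_id (x y : ColorSeq X) : P.propPost x (𝟙 y) = 𝟙 _ := by
  apply P.prop_ext
  intro z σ
  rw [ι_propPost, arrPull_id, Category.comp_id]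
  have : rev (concatPush (𝟙 y : y ⟶ y).equiv z) = 𝟙 _ := by
    exact congrArg rev (show concatPush (𝟙 y : y ⟶ y).equiv z = 𝟙 (concat z) from
      concat_hom_ext fun i a => by simp; exact concatPush_equiv (Equiv.refl _) z i a)
  erw [Category.id_comp, this, Category.comp_id]
  rfl

lemma propPre_id (x y : ColorSeq X) : P.propPre (𝟙 x) y = 𝟙 _ :=
  P.prop_ext fun z σ => by rw [ι_propPre, Category.id_comp, Category.comp_id]

lemma propPre_comp {x x' x'' : ColorSeq X} (f : x ⟶ x') (g : x' ⟶ x'') (y : ColorSeq X) :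
    P.propPre (f ≫ g) y = P.propPre g y ≫ P.propPre f y :=
  P.prop_ext fun z σ => by rw [ι_propPre, ← Category.assoc, ι_propPre, ι_propPre, Category.assoc]

/-- The functor `x ↦ ℙ(x; y)`. -/
noncomputable def propPresheaf (y : ColorSeq X) : (ColorSeq X)ᵒᵖ ⥤ V where
  obj x := P.propObj x.unop y
  map f := P.propPre f.unop y
  map_id x := P.propPre_id _ _
  map_comp f g := P.propPre_comp _ _ _

/-- The PROP `(y, x) ↦ ℙ(x; y)` generated by the operad. -/
noncomputable def prop : ColorSeq X ⥤ (ColorSeq X)ᵒᵖ ⥤ V where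
  obj y := P.propPresheaf y
  map s :=
    { app x := P.propPost x.unop (rev s)
      naturality x x' f := P.propPre_propPost _ _ }
  map_id y := NatTrans.ext (funext fun x => P.propPost_id x.unop y)
  map_comp s t := NatTrans.ext (funext fun x => by
    exact (P.propPost_comp x.unop (rev s) (rev t)).symm)

end ColoredOperad

section
variable {V : Type u} [Category.{v} V] [MonoidalCategory V] [SymmetricCategory V]
variable {ι κ μ : Type} [Enum ι] [Enum κ] [Enum μ]
open TensTree

lemma bigPull_congr {e e' : κ ≃ ι} (h : e = e') (A : ι → V) :
    bigPull e A = bigPull e' A ≫ bigMap fun k => eqToHom (by rw [h]) := by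
  subst h
  simp only [eqToHom_refl]
  rw [bigMap_id, Category.comp_id]

lemma bigPull_bigSplit {J J' : ι → Type} [∀ i, Enum (J i)] [∀ i, Enum (J' i)] (s : ∀ i, J' i ≃ J i)
    (A : (Σ i, J i) → V) :
    bigPull (Equiv.sigmaCongrRight s) A ≫ bigSplit (fun p : Σ i, J' i => A ⟨p.1, s p.1 p.2⟩) =
      bigSplit A ≫ bigMap fun i => bigPull (s i) (fun j => A ⟨i, j⟩) := by
  have h1 := IsStr.pull (A := A) (Equiv.sigmaCongrRight s) leaf
  have h2 := IsStr.tensSplit (A := A) (Enum.list : List ι) (fun i => (Enum.list : List (J' i)))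
    (fun p : Σ i, J' i => leaf ⟨p.1, s p.1 p.2⟩)
  have h3 := IsStr.tensSplit (A := A) (Enum.list : List ι) (fun i => (Enum.list : List (J i)))
    (fun p : Σ i, J i => leaf p)
  have h4 := IsCan.big (Enum.list : List ι) fun i => IsStr.pull (A := A) (s i) (fun j => leaf ⟨i, j⟩)
  exact IsStr.unique (s := big Enum.list leaf) (by simpa using Enum.nodup) (h1.comp h2) (h3.comp h4)

lemma bigPull_bigSplit_coherence {J J' : ι → Type} [∀ i, Enum (J i)] [∀ i, Enum (J' i)]
    (e : μ ≃ κ) (a : (Σ i, J i) ≃ κ) (b : (Σ i, J' i) ≃ μ) (s : ∀ i, J' i ≃ J i)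
    (h : b.trans e = (Equiv.sigmaCongrRight s).trans a) (F : κ → V) (G : μ → V)
    (H : (Σ i, J' i) → V) (K : (Σ i, J i) → V) (L : ∀ i, J' i → V)
    (h1 : ∀ k, F (e k) = G k) (h2 : ∀ p, G (b p) = H p) (h3 : ∀ i j, H ⟨i, j⟩ = L i j)
    (h4 : ∀ p, F (a p) = K p) (h5 : ∀ i j, K ⟨i, s i j⟩ = L i j) :
    (bigPull e F ≫ bigMap fun k => eqToHom (h1 k)) ≫
      (bigPull b G ≫ bigMap (fun p => eqToHom (h2 p)) ≫ bigSplit H) ≫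
      bigMap (fun i => bigMap fun j => eqToHom (h3 i j)) =
    (bigPull a F ≫ bigMap (fun p => eqToHom (h4 p)) ≫ bigSplit K) ≫
      bigMap fun i => bigPull (s i) (fun j => K ⟨i, j⟩) ≫ bigMap fun j => eqToHom (h5 i j) := by
  obtain rfl : G = fun k => F (e k) := funext fun k => (h1 k).symm
  obtain rfl : H = fun p => F (e (b p)) := funext fun k => (h2 k).symm
  obtain rfl : K = fun p => F (a p) := funext fun k => (h4 k).symm
  obtain rfl : L = fun i j => F (e (b ⟨i, j⟩)) := funext₂ fun i j => (h3 i j).symm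
  simp only [eqToHom_refl, bigMap_id, Category.comp_id, Category.id_comp, Category.assoc]
  have q1 : bigPull e F ≫ bigPull b (fun k => F (e k)) =
      bigPull a F ≫ bigPull (Equiv.sigmaCongrRight s) (fun p => F (a p)) ≫
        bigMap fun p : Σ i, J' i => (eqToHom (h5 p.1 p.2) : _ ⟶ F (e (b p))) := by
    rw [bigPull_trans, bigPull_congr h]
    have := bigPull_trans a (Equiv.sigmaCongrRight s) F
    exact (congrArg (· ≫ _) this.symm).trans (Category.assoc _ _ _)
  have q2 := bigSplit_natural (A := fun p : Σ i, J' i => F (a ⟨p.1, s p.1 p.2⟩))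
    (B := fun p => F (e (b p))) (fun p => eqToHom (h5 p.1 p.2))
  have q3 := bigPull_bigSplit s (fun p => F (a p))
  rw [← bigMap_comp, ← reassoc_of% q3, reassoc_of% q1]
  refine (congrArg (fun t => bigPull a F ≫ bigPull (Equiv.sigmaCongrRight s) (fun p => F (a p)) ≫ t)
    q2).trans ?_
  exact congrArg (fun t => bigPull a F ≫ t) (Category.assoc _ _ _).symm

end

namespace ColorSeq
variable {X : Type w}

lemma concatMap_idx {n : ℕ} {y y' : Fin n → ColorSeq X} (s : ∀ i, y' i ⟶ y i)
    (z : Fin (concat y).len → ColorSeq X) (i : Fin n) (l : Fin (y' i).len) :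
    z (idx y ⟨i, (s i).equiv l⟩) = z ((concatMap s).equiv (idx y' ⟨i, l⟩)) := by
  rw [concatMap_equiv]

end ColorSeq

namespace ColoredCollection
open ColorSeq
variable {X : Type w} {V : Type u} [Category.{v} V] (P : ColoredCollection X V)

lemma cast_app {c c' : X} (h : c = c') (x : (ColorSeq X)ᵒᵖ) :
    (P.cast h).app x = eqToHom (by rw [h]) := by
  subst h; rfl

lemma map_eqToHom {c : X} {x x' : ColorSeq X} (h : x = x') :
    (P c).map (eqToHom h).op = eqToHom (by rw [h]) := by
  subst h; exact (P c).map_id _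

variable [MonoidalCategory V] [SymmetricCategory V]

lemma arrPull_arrSplit {n : ℕ} {y y' : Fin n → ColorSeq X} (s : ∀ i, y' i ⟶ y i)
    (z : Fin (concat y).len → ColorSeq X) :
    P.arrPull (concatMap s) z ≫ P.arrSplit y' (fun j => z ((concatMap s).equiv j)) ≫
      bigMap (fun i => P.arrMap (y' i) fun l => eqToHom (concatMap_idx s z i l)) =
    P.arrSplit y z ≫ bigMap fun i => P.arrPull (s i) fun l => z (idx y ⟨i, l⟩) := by
  have e1 : (idx y').trans (concatMap s).equiv =
      (Equiv.sigmaCongrRight fun i => (s i).equiv).trans (idx y) := by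
    ext ⟨i, l⟩; simp
  simp only [arrPull, arrSplit, arrMap, cast_app, map_eqToHom]
  exact bigPull_bigSplit_coherence _ _ _ _ e1 _ _ _ _ _ _ _ _ _ _

end ColoredCollection

namespace ColorSeq
variable {X : Type w}

lemma square_rev {a b c d : ColorSeq X} {f : a ⟶ b} {g : b ⟶ d} {h : a ⟶ c} {k : c ⟶ d}
    (e : f ≫ g = h ≫ k) : g ≫ rev k = rev f ≫ h := by
  rw [← rev_hom_assoc f (g ≫ _), ← Category.assoc f, e, Category.assoc, hom_rev, Category.comp_id]

lemma concat_concat_hom_ext {n : ℕ} {m : Fin n → ℕ} {z : ∀ i, Fin (m i) → ColorSeq X} {y : ColorSeq X}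
    {f g : concat (fun i => concat (z i)) ⟶ y}
    (h : ∀ i l a, f.equiv (idx (fun i => concat (z i)) ⟨i, idx (z i) ⟨l, a⟩⟩) =
      g.equiv (idx (fun i => concat (z i)) ⟨i, idx (z i) ⟨l, a⟩⟩)) : f = g :=
  concat_hom_ext fun i a => by
    obtain ⟨⟨l, a⟩, rfl⟩ := (idx (z i)).surjective a
    exact h i l a

lemma rev_concatAssoc_map {n : ℕ} (y : Fin n → ColorSeq X) {z z' : Fin (concat y).len → ColorSeq X}
    (τ : ∀ i, z i ⟶ z' i) :
    concatMap τ ≫ rev (concatAssoc y z') = rev (concatAssoc y z) ≫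
      concatMap fun i => concatMap fun l : Fin (y i).len => τ (idx y ⟨i, l⟩) :=
  square_rev (concat_concat_hom_ext fun i l a => by simp)

lemma concatMap_comp {n : ℕ} {z z' z'' : Fin n → ColorSeq X} (f : ∀ i, z i ⟶ z' i)
    (g : ∀ i, z' i ⟶ z'' i) : concatMap f ≫ concatMap g = concatMap fun i => f i ≫ g i :=
  concat_hom_ext fun i a => by simp

lemma rev_concatMap {n : ℕ} {z z' : Fin n → ColorSeq X} (f : ∀ i, z i ⟶ z' i) :
    rev (concatMap f) = concatMap fun i => rev (f i) :=
  concat_hom_ext fun i a => by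
    rw [rev_equiv, Equiv.symm_apply_eq, concatMap_equiv, concatMap_equiv]; simp

lemma idx_eqToHom {n : ℕ} (z : Fin n → ColorSeq X) {j j' : Fin n} (h : j = j') (h' : z j = z j')
    (a : Fin (z j).len) : idx z ⟨j', (eqToHom h').equiv a⟩ = idx z ⟨j, a⟩ := by
  subst h; rfl

lemma spread_perm {n : ℕ} {y y' : Fin n → ColorSeq X} (s : ∀ i, y' i ⟶ y i)
    (z : Fin (concat y).len → ColorSeq X) {x : ColorSeq X} (σ : x ⟶ concat z) :
    (σ ≫ rev (concatAssoc y z)) ≫ (concatMap fun i =>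
      rev (concatPush (s i).equiv fun l => z (idx y ⟨i, l⟩)) ≫
          concatMap fun l => eqToHom (concatMap_idx s z i l)) =
    (σ ≫ rev (concatPush (concatMap s).equiv z)) ≫
      rev (concatAssoc y' fun j => z ((concatMap s).equiv j)) := by
  have h : concatMap (fun i => concatMap fun l => eqToHom (concatMap_idx s z i l)) ≫
      concatAssoc y' (fun j => z ((concatMap s).equiv j)) ≫ concatPush (concatMap s).equiv z =
      concatMap (fun i => concatPush (s i).equiv fun l => z (idx y ⟨i, l⟩)) ≫ concatAssoc y z := by
    refine concat_concat_hom_ext fun i l a => ?_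
    simp only [comp_equiv, Equiv.trans_apply, concatMap_equiv, concatAssoc_equiv, concatPush_equiv]
    exact idx_eqToHom z (concatMap_equiv s i l).symm _ a
  rw [← concatMap_comp, ← rev_concatMap, ← square_rev h.symm, rev_comp]
  simp only [Category.assoc, rev_hom_assoc]

end ColorSeq

namespace ColoredOperad
open ColorSeq ColoredCollection
variable {X : Type v} {V : Type u} [Category.{v} V] [MonoidalCategory V] [SymmetricCategory V]
  [MonoidalClosed V] [HasColimits V] (P : ColoredOperad X V)

/-- The action of `ℙ` on operations. -/
noncomputable def act (u : ColorSeq X) (y : X) (x : ColorSeq X) :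
    (P.obj y).obj (op u) ⊗ P.propObj x u ⟶ (P.obj y).obj (op x) :=
  P.propDescLeft (fun z σ => P.comp u z y ≫ (P.obj y).map σ.op) fun z z' τ σ => by
    rw [← Category.assoc, P.comp_map, Category.assoc, ← Functor.map_comp, ← op_comp]

@[simp] lemma ι_act (u : ColorSeq X) (y : X) (x : ColorSeq X) (z : Fin u.len → ColorSeq X)
    (σ : x ⟶ concat z) :
    (_ ◁ P.ι z σ) ≫ P.act u y x = P.comp u z y ≫ (P.obj y).map σ.op := P.ι_propDescLeft _ _ _ _

lemma act_natural (u : ColorSeq X) (y : X) {x x' : ColorSeq X} (f : x ⟶ x') :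
    (_ ◁ P.propPre f u) ≫ P.act u y x = P.act u y x' ≫ (P.obj y).map f.op := by
  apply P.prop_ext_left
  intro z σ
  rw [← Category.assoc, ← MonoidalCategory.whiskerLeft_comp, ι_propPre, ι_act, ← Category.assoc, ι_act,
    Category.assoc, op_comp, Functor.map_comp]

lemma act_dinatural {u u' : ColorSeq X} (s : u' ⟶ u) (y : X) (x : ColorSeq X) :
    ((P.obj y).map s.op ▷ _) ≫ (_ ◁ P.propPost x s) ≫ P.act u' y x = P.act u y x := by
  apply P.prop_ext_left
  intro z σ
  rw [whisker_exchange_assoc, ← MonoidalCategory.whiskerLeft_comp_assoc, ι_propPost,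
    MonoidalCategory.whiskerLeft_comp, Category.assoc, ι_act, ι_act,
    ← MonoidalCategory.tensorHom_def_assoc]
  rw [← Category.assoc, P.comp_perm, Category.assoc, ← Functor.map_comp, ← op_comp, Category.assoc,
    rev_hom, Category.comp_id]

section Spread
variable {n : ℕ} (y : Fin n → ColorSeq X) {A : Fin n → V} (B : Fin n → (ColorSeq X)ᵒᵖ ⥤ V)
  (Q : (ColorSeq X)ᵒᵖ ⥤ V) (a : ∀ i x, A i ⊗ P.propObj x (y i) ⟶ (B i).obj (op x))
  (q : ∀ w : Fin n → ColorSeq X, bigT (fun i => (B i).obj (op (w i))) ⟶ Q.obj (op (concat w)))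

noncomputable def spreadAux (z : Fin (concat y).len → ColorSeq X) :
    bigT A ⊗ P.obj.arr (concat y) z ⟶
      bigT fun i => (B i).obj (op (concat fun l => z (idx y ⟨i, l⟩))) :=
  (_ ◁ P.obj.arrSplit y z) ≫ bigZip A _ ≫ bigMap (fun i => (A i ◁ P.ι _ (𝟙 _)) ≫ a i _)

/-- Given `A i ⊗ ℙ(x; y i) ⟶ B i x` natural in `x` and `⨂ i, B i (w i) ⟶ Q (w 1 ⋯ w n)`, natural in
`w`, the resulting map `(⨂ i, A i) ⊗ ℙ(x; y 1 ⋯ y n) ⟶ Q x`. -/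
noncomputable def spread
    (ha : ∀ i {x x' : ColorSeq X} (f : x ⟶ x'),
      (A i ◁ P.propPre f (y i)) ≫ a i x = a i x' ≫ (B i).map f.op)
    (hq : ∀ {w w' : Fin n → ColorSeq X} (τ : ∀ i, w i ⟶ w' i),
      (bigMap fun i => (B i).map (τ i).op) ≫ q w = q w' ≫ Q.map (concatMap τ).op) (x : ColorSeq X) :
    bigT A ⊗ P.propObj x (concat y) ⟶ Q.obj (op x) :=
  P.propDescLeft (fun z σ => P.spreadAux y B a z ≫ q _ ≫ Q.map (σ ≫ rev (concatAssoc y z)).op) <| by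
    intro z z' τ σ
    have h1 : (_ ◁ P.obj.arrMap _ τ) ≫ P.spreadAux y B a z = P.spreadAux y B a z' ≫
        bigMap fun i => (B i).map (concatMap fun l : Fin (y i).len => τ (idx y ⟨i, l⟩)).op := by
      simp only [spreadAux, Category.assoc]
      rw [← MonoidalCategory.whiskerLeft_comp_assoc, P.obj.arrMap_arrSplit,
        MonoidalCategory.whiskerLeft_comp_assoc, ← id_tensorHom (bigT A) (bigMap _), ← bigMap_id]
      rw [← Category.assoc (bigMap _ ⊗ₘ bigMap _), bigZip_natural, Category.assoc, bigMap_comp, bigMap_comp]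
      congr 4
      funext i
      rw [id_tensorHom, ← MonoidalCategory.whiskerLeft_comp_assoc, P.ι_map, Category.assoc, ← ha,
        ← MonoidalCategory.whiskerLeft_comp_assoc, ι_propPre, Category.comp_id, Category.id_comp]
    rw [← Category.assoc, h1, Category.assoc]
    congr 1
    rw [← Category.assoc, hq, Category.assoc, ← Functor.map_comp, ← op_comp]
    rw [Category.assoc, Category.assoc, rev_concatAssoc_map]

variable (ha : ∀ i {x x' : ColorSeq X} (f : x ⟶ x'),
      (A i ◁ P.propPre f (y i)) ≫ a i x = a i x' ≫ (B i).map f.op)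
    (hq : ∀ {w w' : Fin n → ColorSeq X} (τ : ∀ i, w i ⟶ w' i),
      (bigMap fun i => (B i).map (τ i).op) ≫ q w = q w' ≫ Q.map (concatMap τ).op)

lemma ι_spread (x : ColorSeq X) (z : Fin (concat y).len → ColorSeq X) (σ : x ⟶ concat z) :
    (_ ◁ P.ι z σ) ≫ P.spread y B Q a q ha hq x =
      P.spreadAux y B a z ≫ q _ ≫ Q.map (σ ≫ rev (concatAssoc y z)).op := P.ι_propDescLeft _ _ _ _

lemma spread_natural {x x' : ColorSeq X} (f : x ⟶ x') :
    (_ ◁ P.propPre f _) ≫ P.spread y B Q a q ha hq x = P.spread y B Q a q ha hq x' ≫ Q.map f.op := by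
  apply P.prop_ext_left
  intro z σ
  rw [← Category.assoc, ← MonoidalCategory.whiskerLeft_comp, ι_propPre, ι_spread,
    ← Category.assoc (_ ◁ P.ι z σ), ι_spread, op_comp, op_comp, op_comp, Functor.map_comp, Functor.map_comp,
    Functor.map_comp]
  simp only [Category.assoc]

lemma spreadAux_dinatural
    (ha : ∀ i {x x' : ColorSeq X} (f : x ⟶ x'),
      (A i ◁ P.propPre f (y i)) ≫ a i x = a i x' ≫ (B i).map f.op) {y' : Fin n → ColorSeq X} {A' : Fin n → V}
    (a' : ∀ i x, A' i ⊗ P.propObj x (y' i) ⟶ (B i).obj (op x))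
    (s : ∀ i, y' i ⟶ y i) (m : ∀ i, A' i ⟶ A i)
    (ha' : ∀ i {x x' : ColorSeq X} (f : x ⟶ x'),
      (A' i ◁ P.propPre f (y' i)) ≫ a' i x = a' i x' ≫ (B i).map f.op)
    (h : ∀ i x, (m i ▷ _) ≫ a i x = (_ ◁ P.propPost x (s i)) ≫ a' i x)
    (z : Fin (concat y).len → ColorSeq X) :
    (bigMap m ▷ _) ≫ P.spreadAux y B a z =
      (_ ◁ P.obj.arrPull (concatMap s) z) ≫
        P.spreadAux y' B a' (fun j => z ((concatMap s).equiv j)) ≫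
        bigMap fun i => (B i).map (rev (concatPush (s i).equiv fun l => z (idx y ⟨i, l⟩)) ≫
          concatMap fun l => eqToHom (concatMap_idx s z i l)).op := by
  simp only [spreadAux, Category.assoc]
  rw [← whisker_exchange_assoc, ← tensorHom_id (bigMap m), ← bigMap_id, ← Category.assoc (_ ⊗ₘ _), bigZip_natural,
    Category.assoc, bigMap_comp, bigMap_comp]
  have e1 : ∀ i, (m i ⊗ₘ 𝟙 (P.obj.arr (y i) fun l => z (idx y ⟨i, l⟩))) ≫ (A i ◁ P.ι _ (𝟙 _)) ≫ a i _ =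
      (𝟙 _ ⊗ₘ P.obj.arrPull (s i) fun l => z (idx y ⟨i, l⟩)) ≫
       (A' i ◁ P.ι _ (rev (concatPush (s i).equiv fun l => z (idx y ⟨i, l⟩)))) ≫ a' i _ := by
    intro i
    rw [tensorHom_id, ← whisker_exchange_assoc, h, ← MonoidalCategory.whiskerLeft_comp_assoc, ι_propPost,
      Category.id_comp, MonoidalCategory.whiskerLeft_comp_assoc, id_tensorHom]
  have e2 : ∀ i, ((A' i ◁ P.ι (fun l => z ((concatMap s).equiv (idx y' ⟨i, l⟩))) (𝟙 _)) ≫ a' i _) ≫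
      (B i).map (rev (concatPush (s i).equiv fun l => z (idx y ⟨i, l⟩)) ≫
          concatMap fun l => eqToHom (concatMap_idx s z i l)).op =
      (𝟙 _ ⊗ₘ P.obj.arrMap (y' i) fun l => eqToHom (concatMap_idx s z i l)) ≫
       (A' i ◁ P.ι _ (rev (concatPush (s i).equiv fun l => z (idx y ⟨i, l⟩)))) ≫ a' i _ := by
    intro i
    rw [Category.assoc, ← ha', id_tensorHom, ← MonoidalCategory.whiskerLeft_comp_assoc, ι_propPre,
      ← MonoidalCategory.whiskerLeft_comp_assoc, P.ι_map, Category.comp_id]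
  have key : ∀ {D : Fin n → V} (c : ∀ i,
      A' i ⊗ P.obj.arr (y' i) (fun l => z (idx y ⟨i, (s i).equiv l⟩)) ⟶ D i),
      (bigT A' ◁ P.obj.arrSplit y z) ≫ bigZip A' _ ≫
        bigMap (fun i => (𝟙 _ ⊗ₘ P.obj.arrPull (s i) fun l => z (idx y ⟨i, l⟩)) ≫ c i) =
      (_ ◁ P.obj.arrPull (concatMap s) z) ≫ (_ ◁ P.obj.arrSplit y' _) ≫ bigZip A' _ ≫
        bigMap (fun i => (𝟙 _ ⊗ₘ P.obj.arrMap (y' i) fun l => eqToHom (concatMap_idx s z i l)) ≫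
          c i) := by
    intro D c
    rw [← bigMap_comp, ← bigMap_comp, ← reassoc_of% bigZip_natural, ← reassoc_of% bigZip_natural]
    simp only [bigMap_id, id_tensorHom]
    rw [← MonoidalCategory.whiskerLeft_comp_assoc, ← MonoidalCategory.whiskerLeft_comp_assoc,
      ← MonoidalCategory.whiskerLeft_comp_assoc, ← P.obj.arrPull_arrSplit, Category.assoc]
  simp only [e1, e2]
  exact key _

lemma spread_dinatural {y' : Fin n → ColorSeq X} {A' : Fin n → V}
    (a' : ∀ i x, A' i ⊗ P.propObj x (y' i) ⟶ (B i).obj (op x))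
    (s : ∀ i, y' i ⟶ y i) (m : ∀ i, A' i ⟶ A i)
    (ha' : ∀ i {x x' : ColorSeq X} (f : x ⟶ x'),
      (A' i ◁ P.propPre f (y' i)) ≫ a' i x = a' i x' ≫ (B i).map f.op)
    (h : ∀ i x, (m i ▷ _) ≫ a i x = (_ ◁ P.propPost x (s i)) ≫ a' i x) (x : ColorSeq X) :
    (bigMap m ▷ _) ≫ P.spread y B Q a q ha hq x =
      (_ ◁ P.propPost x (concatMap s)) ≫ P.spread y' B Q a' q ha' hq x := by
  apply P.prop_ext_left
  intro z σ
  rw [whisker_exchange_assoc, ι_spread, ← MonoidalCategory.whiskerLeft_comp_assoc, ι_propPost,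
    MonoidalCategory.whiskerLeft_comp_assoc, ι_spread, ← Category.assoc,
    P.spreadAux_dinatural y B a ha a' s m ha' h]
  simp only [Category.assoc]
  congr 2
  rw [← Category.assoc, hq, Category.assoc, ← Functor.map_comp, ← op_comp]
  rw [spread_perm, Category.assoc]

end Spread
end ColoredOperad

section
variable {V : Type u} [Category.{v} V] [MonoidalCategory V] [SymmetricCategory V]
variable {ι κ μ ν : Type} [Enum ι] [Enum κ] [Enum μ] [Enum ν]
open TensTree

lemma bigPull_bigSplit' {J : ι → Type} [∀ i, Enum (J i)] (e : κ ≃ ι) (A : (Σ i, J i) → V) :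
    bigPull (Equiv.sigmaCongrLeft e) A ≫ bigSplit (fun p : Σ k, J (e k) => A ⟨e p.1, p.2⟩) =
      bigSplit A ≫ bigPull e fun i => bigT (fun j => A ⟨i, j⟩) := by
  have h1 := IsStr.pull (A := A) (Equiv.sigmaCongrLeft e) leaf
  have h2 := IsStr.tensSplit (A := A) (Enum.list : List κ) (fun i => (Enum.list : List (J (e i))))
    (fun p : Σ k, J (e k) => leaf ⟨e p.1, p.2⟩)
  have h3 := IsStr.tensSplit (A := A) (Enum.list : List ι) (fun i => (Enum.list : List (J i)))
    (fun p : Σ i, J i => leaf p)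
  have h4 := IsStr.pull (A := A) e fun i => big (Enum.list : List (J i)) (fun j => leaf ⟨i, j⟩)
  exact IsStr.unique (s := big Enum.list leaf) (by simpa using Enum.nodup) (h1.comp h2) (h3.comp h4)

lemma bigPull_bigZip (e : κ ≃ ι) (A B : ι → V) :
    (bigPull e A ⊗ₘ bigPull e B) ≫ bigZip _ _ = bigZip A B ≫ bigPull e _ := by
  let C : ι ⊕ ι → V := Sum.elim A B
  have h1 := (IsStr.pull (A := C) e (fun i => leaf (.inl i))).node
    (IsStr.pull (A := C) e (fun i => leaf (.inr i)))
  have h2 := IsStr.tensZip (A := C) (Enum.list : List κ) (fun i => leaf (.inl (e i)))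
    (fun i => leaf (.inr (e i)))
  have h3 := IsStr.tensZip (A := C) (Enum.list : List ι) (fun i => leaf (.inl i))
    (fun i => leaf (.inr i))
  have h4 := IsStr.pull (A := C) e (fun i => node (leaf (.inl i)) (leaf (.inr i)))
  refine IsStr.unique (A := C) (s := node (big Enum.list fun i => leaf (.inl i))
    (big Enum.list fun i => leaf (.inr i))) ?_ (h1.comp_str h2) (h3.comp h4)
  have : ∀ (f : ι → ι ⊕ ι) (l : List ι) r, l.foldr (fun k r => f k :: r) r = l.map f ++ r := by
    intro f l r; induction l <;> simp_all
  simp only [flat, this, List.append_nil]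
  exact (Enum.nodup.map Sum.inl_injective).append (Enum.nodup.map Sum.inr_injective) (by
    intro x h1 h2
    obtain ⟨_, _, rfl⟩ := List.mem_map.1 h1
    simp at h2)

lemma bigPull_bigSplit_coherence' {J : ι → Type} [∀ i, Enum (J i)] (e : κ ≃ ι)
    (e' : μ ≃ ν) (a : (Σ i, J i) ≃ ν) (b : (Σ k, J (e k)) ≃ μ)
    (h : b.trans e' = (Equiv.sigmaCongrLeft e).trans a) (F : ν → V) (G : μ → V)
    (H : (Σ k, J (e k)) → V) (K : (Σ i, J i) → V)
    (h1 : ∀ k, F (e' k) = G k) (h2 : ∀ p, G (b p) = H p) (h3 : ∀ k j, H ⟨k, j⟩ = K ⟨e k, j⟩)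
    (h4 : ∀ p, F (a p) = K p) :
    (bigPull e' F ≫ bigMap fun k => eqToHom (h1 k)) ≫
      (bigPull b G ≫ bigMap (fun p => eqToHom (h2 p)) ≫ bigSplit H) ≫
      bigMap (fun k => bigMap fun j => eqToHom (h3 k j)) =
    (bigPull a F ≫ bigMap (fun p => eqToHom (h4 p)) ≫ bigSplit K) ≫
      bigPull e (fun i => bigT fun j => K ⟨i, j⟩) := by
  obtain rfl : G = fun k => F (e' k) := funext fun k => (h1 k).symm
  obtain rfl : H = fun p => F (e' (b p)) := funext fun k => (h2 k).symm
  obtain rfl : K = fun p => F (a p) := funext fun k => (h4 k).symm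
  simp only [eqToHom_refl, bigMap_id, Category.comp_id, Category.id_comp, Category.assoc]
  have q1 : bigPull e' F ≫ bigPull b (fun k => F (e' k)) =
      bigPull a F ≫ bigPull (Equiv.sigmaCongrLeft e) (fun p => F (a p)) ≫
        bigMap fun p : Σ k, J (e k) => (eqToHom (h3 p.1 p.2).symm : _ ⟶ F (e' (b p))) := by
    rw [bigPull_trans, bigPull_congr h]
    have := bigPull_trans a (Equiv.sigmaCongrLeft e) F
    exact (congrArg (· ≫ _) this.symm).trans (Category.assoc _ _ _)
  have q2 := bigSplit_natural (A := fun p => F (e' (b p)))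
    (B := fun p : Σ k, J (e k) => F (a ⟨e p.1, p.2⟩)) (fun p => eqToHom (h3 p.1 p.2))
  have q3 := bigPull_bigSplit' e (fun p => F (a p))
  rw [← q3, reassoc_of% q1]
  have q4 : bigMap (fun p : Σ k, J (e k) => eqToHom (h3 p.1 p.2).symm) ≫
      bigMap (fun p : Σ k, J (e k) => eqToHom (h3 p.1 p.2)) = 𝟙 _ := by
    rw [bigMap_comp]
    simp only [eqToHom_trans, eqToHom_refl]
    exact bigMap_id _
  have q5 : bigMap (fun p : Σ k, J (e k) => eqToHom (h3 p.1 p.2).symm) ≫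
      bigSplit (fun p => F (e' (b p))) ≫ bigMap (fun k => bigMap fun j => eqToHom (h3 k j)) =
      bigSplit (fun p : Σ k, J (e k) => F (a ⟨e p.1, p.2⟩)) := by
    rw [← Category.id_comp (bigSplit (fun p : Σ k, J (e k) => F (a ⟨e p.1, p.2⟩))), ← q4,
      Category.assoc]
    exact congrArg (fun t => _ ≫ t) q2.symm
  exact congrArg (fun t => bigPull a F ≫ bigPull (Equiv.sigmaCongrLeft e) (fun p => F (a p)) ≫ t) q5
end

namespace ColorSeq
variable {X : Type w}

lemma concatPush_idx {m n : ℕ} (e : Fin m ≃ Fin n) (y : Fin n → ColorSeq X)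
    (z : Fin (concat y).len → ColorSeq X) (k : Fin m) (l : Fin (y (e k)).len) :
    z (idx y ⟨e k, l⟩) = z ((concatPush e y).equiv (idx (fun k => y (e k)) ⟨k, l⟩)) := by
  rw [concatPush_equiv]

lemma spread_push {m n : ℕ} (e : Fin m ≃ Fin n) {y : Fin n → ColorSeq X}
    (z : Fin (concat y).len → ColorSeq X) {x : ColorSeq X} (σ : x ⟶ concat z) :
    ((σ ≫ rev (concatAssoc y z)) ≫ rev (concatPush e _)) ≫ (concatMap fun k =>
          concatMap fun l => eqToHom (concatPush_idx e y z k l)) =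
    (σ ≫ rev (concatPush (concatPush e y).equiv z)) ≫
      rev (concatAssoc (fun k => y (e k)) fun j => z ((concatPush e y).equiv j)) := by
  have h : concatMap (fun k => concatMap fun l => eqToHom (concatPush_idx e y z k l)) ≫
      concatAssoc (fun k => y (e k)) (fun j => z ((concatPush e y).equiv j)) ≫
        concatPush (concatPush e y).equiv z =
      concatPush e (fun i => concat fun l => z (idx y ⟨i, l⟩)) ≫ concatAssoc y z := by
    refine concat_concat_hom_ext fun i l a => ?_
    simp only [comp_equiv, Equiv.trans_apply, concatMap_equiv, concatAssoc_equiv, concatPush_equiv]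
    exact idx_eqToHom z (concatPush_equiv e y i l).symm _ a
  have h2 := square_rev h.symm
  rw [rev_comp] at h2
  rw [Category.assoc, Category.assoc, ← h2]
  simp only [Category.assoc, rev_hom_assoc]

end ColorSeq

namespace ColoredCollection
open ColorSeq
variable {X : Type w} {V : Type u} [Category.{v} V] (P : ColoredCollection X V)
variable [MonoidalCategory V] [SymmetricCategory V]

lemma arrPull_push_arrSplit {m n : ℕ} (e : Fin m ≃ Fin n) {y : Fin n → ColorSeq X}
    (z : Fin (concat y).len → ColorSeq X) :
    P.arrPull (concatPush e y) z ≫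
      P.arrSplit (fun k => y (e k)) (fun j => z ((concatPush e y).equiv j)) ≫
      bigMap (fun k => P.arrMap (y (e k)) fun l => eqToHom (concatPush_idx e y z k l)) =
    P.arrSplit y z ≫ bigPull e fun i => P.arr (y i) fun l => z (idx y ⟨i, l⟩) := by
  have e1 : (idx fun k => y (e k)).trans (concatPush e y).equiv =
      (Equiv.sigmaCongrLeft e).trans (idx y) := by
    ext ⟨i, l⟩; simp [Equiv.sigmaCongrLeft]
  simp only [arrPull, arrSplit, arrMap, cast_app, map_eqToHom]
  exact bigPull_bigSplit_coherence' (V := V) (J := fun i => Fin (y i).len) e (concatPush e y).equiv (idx y)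
    (idx fun k => y (e k)) e1 (fun j => (P ((concat y).col j)).obj (op (z j)))
    (fun j => (P ((concat fun k => y (e k)).col j)).obj (op (z ((concatPush e y).equiv j))))
    (fun p => (P ((y (e p.1)).col p.2)).obj (op (z ((concatPush e y).equiv (idx (fun k => y (e k)) p)))))
    (fun p => (P ((y p.1).col p.2)).obj (op (z (idx y p)))) _ _ _ _

end ColoredCollection

namespace ColoredOperad
open ColorSeq ColoredCollection
variable {X : Type v} {V : Type u} [Category.{v} V] [MonoidalCategory V] [SymmetricCategory V]
  [MonoidalClosed V] [HasColimits V] (P : ColoredOperad X V)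
variable {n : ℕ} (y : Fin n → ColorSeq X) {A : Fin n → V} (B : Fin n → (ColorSeq X)ᵒᵖ ⥤ V)
  (Q : (ColorSeq X)ᵒᵖ ⥤ V) (a : ∀ i x, A i ⊗ P.propObj x (y i) ⟶ (B i).obj (op x))
  (q : ∀ w : Fin n → ColorSeq X, bigT (fun i => (B i).obj (op (w i))) ⟶ Q.obj (op (concat w)))

lemma spreadAux_push (ha : ∀ i {x x' : ColorSeq X} (f : x ⟶ x'),
      (A i ◁ P.propPre f (y i)) ≫ a i x = a i x' ≫ (B i).map f.op) {m : ℕ} (e : Fin m ≃ Fin n)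
    (z : Fin (concat y).len → ColorSeq X) :
    (bigPull e A ⊗ₘ P.obj.arrPull (concatPush e y) z) ≫
        P.spreadAux (fun k => y (e k)) (fun k => B (e k)) (fun k => a (e k))
          (fun j => z ((concatPush e y).equiv j)) ≫
        bigMap (fun k => (B (e k)).map (concatMap fun l => eqToHom (concatPush_idx e y z k l)).op) =
      P.spreadAux y B a z ≫ bigPull e _ := by
  simp only [spreadAux, Category.assoc]
  have e2 : ∀ k, ((A (e k) ◁ P.ι (fun l => z ((concatPush e y).equiv (idx (fun k => y (e k)) ⟨k, l⟩))) (𝟙 _)) ≫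
        a (e k) _) ≫
      (B (e k)).map (concatMap fun l => eqToHom (concatPush_idx e y z k l)).op =
      (𝟙 _ ⊗ₘ P.obj.arrMap (y (e k)) fun l => eqToHom (concatPush_idx e y z k l)) ≫
       (A (e k) ◁ P.ι (fun l => z (idx y ⟨e k, l⟩)) (𝟙 _)) ≫ a (e k) _ := by
    intro i
    rw [Category.assoc, ← ha, id_tensorHom, ← MonoidalCategory.whiskerLeft_comp_assoc, ι_propPre,
      ← MonoidalCategory.whiskerLeft_comp_assoc, P.ι_map, Category.comp_id, Category.id_comp]
  rw [bigMap_comp]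
  simp only [e2]
  rw [bigPull_natural, ← reassoc_of% bigPull_bigZip, ← bigMap_comp, ← reassoc_of% bigZip_natural,
    bigMap_id]
  have := P.obj.arrPull_push_arrSplit e z
  simp only [← id_tensorHom, ← Category.assoc, tensorHom_comp_tensorHom, Category.id_comp, Category.comp_id]
  simp only [← Category.assoc] at this
  rw [this]

lemma spread_push (ha : ∀ i {x x' : ColorSeq X} (f : x ⟶ x'),
      (A i ◁ P.propPre f (y i)) ≫ a i x = a i x' ≫ (B i).map f.op)
    (hq : ∀ {w w' : Fin n → ColorSeq X} (τ : ∀ i, w i ⟶ w' i),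
      (bigMap fun i => (B i).map (τ i).op) ≫ q w = q w' ≫ Q.map (concatMap τ).op)
    {m : ℕ} (e : Fin m ≃ Fin n)
    (q' : ∀ w : Fin m → ColorSeq X, bigT (fun k => (B (e k)).obj (op (w k))) ⟶ Q.obj (op (concat w)))
    (hq' : ∀ {w w' : Fin m → ColorSeq X} (τ : ∀ i, w i ⟶ w' i),
      (bigMap fun k => (B (e k)).map (τ k).op) ≫ q' w = q' w' ≫ Q.map (concatMap τ).op)
    (h : ∀ w : Fin n → ColorSeq X, bigPull e _ ≫ q' (fun k => w (e k)) =
      q w ≫ Q.map (concatPush e w).op) (x : ColorSeq X) :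
    (bigPull e A ⊗ₘ P.propPost x (concatPush e y)) ≫ P.spread (fun k => y (e k)) (fun k => B (e k)) Q
      (fun k => a (e k)) q' (fun k => ha (e k)) hq' x = P.spread y B Q a q ha hq x := by
  apply P.prop_ext_left
  intro z σ
  rw [ι_spread, ← id_tensorHom, tensorHom_comp_tensorHom_assoc, ι_propPost, Category.id_comp]
  have e1 : (bigPull e A ⊗ₘ (P.obj.arrPull (concatPush e y) z ≫ P.ι (fun j => z ((concatPush e y).equiv j))
      (σ ≫ rev (concatPush (concatPush e y).equiv z)))) =
      (bigPull e A ⊗ₘ P.obj.arrPull (concatPush e y) z) ≫ (_ ◁ P.ι (fun j => z ((concatPush e y).equiv j))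
      (σ ≫ rev (concatPush (concatPush e y).equiv z))) := by
    rw [← id_tensorHom, tensorHom_comp_tensorHom, Category.comp_id]
  rw [e1, Category.assoc, ι_spread]
  have e2 : q (fun i => concat fun l => z (idx y ⟨i, l⟩)) =
      bigPull e _ ≫ q' (fun k => concat fun l => z (idx y ⟨e k, l⟩)) ≫
        Q.map (rev (concatPush e _)).op := by
    have := h (fun i => concat fun l => z (idx y ⟨i, l⟩))
    rw [reassoc_of% this, ← Functor.map_comp, ← op_comp, rev_hom, op_id, CategoryTheory.Functor.map_id, Category.comp_id]
  rw [e2]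
  simp only [Category.assoc]
  rw [← Functor.map_comp, ← op_comp,
    ← reassoc_of% (P.spreadAux_push y B a ha e z), reassoc_of% hq', ← Functor.map_comp, ← op_comp,
    ColorSeq.spread_push, Category.assoc]

end ColoredOperad

section
variable {V : Type u} [Category.{v} V] [MonoidalCategory V] [SymmetricCategory V]
variable {ι κ : Type} [Enum ι] [Enum κ]

lemma IsInsertion.tensOne {ι : Type} {A : ι → V} (f : ∀ i, 𝟙_ V ⟶ A i) {a : ι} {l m : List ι}
    {h : A a ⊗ tens A l ⟶ tens A m} (hh : IsInsertion A a l m h) :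
    (λ_ _).inv ≫ (f a ⊗ₘ tensOne f l) ≫ h = tensOne f m := by
  induction hh with
  | here l => simp [_root_.tensOne]
  | @there b l m h hh ih =>
    simp only [_root_.tensOne]
    rw [← ih]
    have n := swapHead_natural (f a) (f b) (_root_.tensOne f l)
    have e1 : f a ⊗ₘ (λ_ (𝟙_ V)).inv ≫ (f b ⊗ₘ _root_.tensOne f l) =
      (𝟙_ V ◁ (λ_ (𝟙_ V)).inv) ≫ (f a ⊗ₘ (f b ⊗ₘ _root_.tensOne f l)) := by
      rw [← id_tensorHom, tensorHom_comp_tensorHom, Category.id_comp]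
    rw [e1, Category.assoc, reassoc_of% n, ← id_tensorHom (A b) h, tensorHom_comp_tensorHom, Category.comp_id]
    have e2 : (λ_ (𝟙_ V)).inv ≫ 𝟙_ V ◁ (λ_ (𝟙_ V)).inv ≫ swapHead (𝟙_ V) (𝟙_ V) (𝟙_ V) =
      (λ_ (𝟙_ V)).inv ≫ 𝟙_ V ◁ (λ_ (𝟙_ V)).inv := by
      have : (β_ (𝟙_ V) (𝟙_ V)).hom = 𝟙 _ := by
        rw [braiding_tensorUnit_left, unitors_equal, Iso.hom_inv_id]
      simp [swapHead, this]
    rw [reassoc_of% e2, ← id_tensorHom, tensorHom_comp_tensorHom, Category.id_comp]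

lemma IsReindexing.tensOne {ι κ : Type} {A : ι → V} {B : κ → V} (f : ∀ i, 𝟙_ V ⟶ A i)
    (g : ∀ k, 𝟙_ V ⟶ B k) {e : ι → κ} {φ : ∀ i, A i ⟶ B (e i)} (h : ∀ i, f i ≫ φ i = g (e i))
    {l : List ι} {m : List κ} {r : tens A l ⟶ tens B m} (hr : IsReindexing e φ l m r) :
    _root_.tensOne f l ≫ r = _root_.tensOne g m := by
  induction hr with
  | nil => simp [_root_.tensOne]
  | cons a hg hh ih =>
    rw [← IsInsertion.tensOne g hh, ← ih, ← h]
    simp [_root_.tensOne]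

lemma bigOne_pull (e : κ ≃ ι) {A : ι → V} (f : ∀ i, 𝟙_ V ⟶ A i) :
    bigOne f ≫ bigPull e A = bigOne fun k => f (e k) := by
  refine (isReindexing_bigPull e A).tensOne f (fun k => f (e k)) fun i => ?_
  have : ∀ j (h : i = j), f i ≫ eqToHom (congrArg A h) = f j := by rintro _ rfl; simp
  exact this _ (e.apply_symm_apply i).symm
end

namespace ColoredOperad
open ColorSeq ColoredCollection
variable {X : Type v} {V : Type u} [Category.{v} V] [MonoidalCategory V] [SymmetricCategory V]
  [MonoidalClosed V] [HasColimits V] (P : ColoredOperad X V)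

section
variable {n : ℕ} (y : Fin n → ColorSeq X) {A : Fin n → V} (B : Fin n → (ColorSeq X)ᵒᵖ ⥤ V)
  (Q : (ColorSeq X)ᵒᵖ ⥤ V) (a : ∀ i x, A i ⊗ P.propObj x (y i) ⟶ (B i).obj (op x))
  (q : ∀ w : Fin n → ColorSeq X, bigT (fun i => (B i).obj (op (w i))) ⟶ Q.obj (op (concat w)))
  (ha : ∀ i {x x' : ColorSeq X} (f : x ⟶ x'),
    (A i ◁ P.propPre f (y i)) ≫ a i x = a i x' ≫ (B i).map f.op)
  (hq : ∀ {w w' : Fin n → ColorSeq X} (τ : ∀ i, w i ⟶ w' i),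
    (bigMap fun i => (B i).map (τ i).op) ≫ q w = q w' ≫ Q.map (concatMap τ).op)

lemma spread_post {Q' : (ColorSeq X)ᵒᵖ ⥤ V} (g : Q ⟶ Q') (x : ColorSeq X) :
    P.spread y B Q a q ha hq x ≫ g.app (op x) = P.spread y B Q' a (fun w => q w ≫ g.app _) ha
      (fun τ => by rw [← Category.assoc, hq, Category.assoc, g.naturality, Category.assoc]) x := by
  apply P.prop_ext_left
  intro z σ
  rw [ι_spread, ← Category.assoc, ι_spread]
  simp

lemma spread_map {A' : Fin n → V} {B' : Fin n → (ColorSeq X)ᵒᵖ ⥤ V}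
    (a' : ∀ i x, A' i ⊗ P.propObj x (y i) ⟶ (B' i).obj (op x))
    (q' : ∀ w : Fin n → ColorSeq X, bigT (fun i => (B' i).obj (op (w i))) ⟶ Q.obj (op (concat w)))
    (ha' : ∀ i {x x' : ColorSeq X} (f : x ⟶ x'),
      (A' i ◁ P.propPre f (y i)) ≫ a' i x = a' i x' ≫ (B' i).map f.op)
    (hq' : ∀ {w w' : Fin n → ColorSeq X} (τ : ∀ i, w i ⟶ w' i),
      (bigMap fun i => (B' i).map (τ i).op) ≫ q' w = q' w' ≫ Q.map (concatMap τ).op)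
    (m : ∀ i, A i ⟶ A' i) (b : ∀ i, B i ⟶ B' i)
    (h : ∀ i x, (m i ▷ _) ≫ a' i x = a i x ≫ (b i).app _)
    (hqq : ∀ w, q w = (bigMap fun i => (b i).app _) ≫ q' w) (x : ColorSeq X) :
    (bigMap m ▷ _) ≫ P.spread y B' Q a' q' ha' hq' x = P.spread y B Q a q ha hq x := by
  apply P.prop_ext_left
  intro z σ
  rw [whisker_exchange_assoc, ι_spread, ι_spread, hqq]
  simp only [spreadAux, Category.assoc]
  rw [← whisker_exchange_assoc, ← tensorHom_id (bigMap m), ← bigMap_id,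
    ← Category.assoc (_ ⊗ₘ _), bigZip_natural, Category.assoc]
  congr 2
  rw [reassoc_of% bigMap_comp, reassoc_of% bigMap_comp]
  congr 2
  funext i
  rw [tensorHom_id, ← whisker_exchange_assoc, h, Category.assoc]
end

/-- The generators of `ℙ(-; z)`. -/
noncomputable def gen (z : ColorSeq X) (w : Fin z.len → ColorSeq X) :
    bigT (fun i => (P.obj (z.col i)).obj (op (w i))) ⟶ (P.propPresheaf z).obj (op (concat w)) :=
  P.ι w (𝟙 _)

lemma gen_natural (z : ColorSeq X) {w w' : Fin z.len → ColorSeq X} (τ : ∀ i, w i ⟶ w' i) :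
    (bigMap fun i => (P.obj (z.col i)).map (τ i).op) ≫ P.gen z w =
      P.gen z w' ≫ (P.propPresheaf z).map (concatMap τ).op := by
  refine (P.ι_map τ (𝟙 _)).trans (Eq.trans ?_ (P.ι_propPre (concatMap τ) z w' (𝟙 _)).symm)
  rw [Category.id_comp, Category.comp_id]

/-- The composition `(⨂ k, P (u k; z k)) ⊗ ℙ(x; u 1 ⋯ u n) ⟶ ℙ(x; z)`. -/
noncomputable def compSpread (z : ColorSeq X) (u : Fin z.len → ColorSeq X) (x : ColorSeq X) :
    P.obj.arr z u ⊗ P.propObj x (concat u) ⟶ P.propObj x z :=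
  P.spread u (fun k => P.obj (z.col k)) (P.propPresheaf z) (fun k => P.act (u k) (z.col k))
    (P.gen z) (fun i {_ _} f => P.act_natural _ _ f) (P.gen_natural z) x

lemma compSpread_dinatural (z : ColorSeq X) {u u' : Fin z.len → ColorSeq X} (v : ∀ i, u i ⟶ u' i)
    (x : ColorSeq X) :
    (P.obj.arrMap z v ▷ _) ≫ P.compSpread z u x =
      (_ ◁ P.propPost x (rev (concatMap v))) ≫ P.compSpread z u' x := by
  rw [rev_concatMap]
  refine P.spread_dinatural _ _ _ _ _ _ _ _ (fun i => rev (v i))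
    (fun i => (P.obj (z.col i)).map (v i).op) _ (fun i x => ?_) x
  rw [← P.act_dinatural (v i), ← whisker_exchange_assoc, ← MonoidalCategory.whiskerLeft_comp_assoc,
    propPost_comp, hom_rev, propPost_id, MonoidalCategory.whiskerLeft_id, Category.id_comp]

/-- Composition in the PROP. -/
noncomputable def propComp (x y z : ColorSeq X) : P.propObj y z ⊗ P.propObj x y ⟶ P.propObj x z :=
  P.propDescRight (fun u τ => (_ ◁ P.propPost x (rev τ)) ≫ P.compSpread z u x)
    fun u u' v τ => by
      rw [← whisker_exchange_assoc, P.compSpread_dinatural, ← MonoidalCategory.whiskerLeft_comp_assoc,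
        P.propPost_comp, rev_comp]

@[simp] lemma ι_propComp (x y z : ColorSeq X) (u : Fin z.len → ColorSeq X) (τ : y ⟶ concat u) :
    (P.ι u τ ▷ _) ≫ P.propComp x y z = (_ ◁ P.propPost x (rev τ)) ≫ P.compSpread z u x :=
  P.ι_propDescRight _ _ _ _

lemma compSpread_natural (z : ColorSeq X) (u : Fin z.len → ColorSeq X) {x x' : ColorSeq X} (f : x ⟶ x') :
    (_ ◁ P.propPre f _) ≫ P.compSpread z u x = P.compSpread z u x' ≫ P.propPre f _ :=
  P.spread_natural _ _ _ _ _ _ _ f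

lemma propComp_propPre {x x' : ColorSeq X} (f : x ⟶ x') (y z : ColorSeq X) :
    (_ ◁ P.propPre f y) ≫ P.propComp x y z = P.propComp x' y z ≫ P.propPre f z := by
  apply P.prop_ext_right
  intro u τ
  rw [← whisker_exchange_assoc, ι_propComp, ← Category.assoc (_ ▷ _), ι_propComp, Category.assoc,
    ← compSpread_natural, ← MonoidalCategory.whiskerLeft_comp_assoc,
    ← MonoidalCategory.whiskerLeft_comp_assoc, propPre_propPost]

lemma propPre_propComp (x : ColorSeq X) {y y' : ColorSeq X} (f : y ⟶ y') (z : ColorSeq X) :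
    (P.propPre f z ▷ _) ≫ P.propComp x y z = (_ ◁ P.propPost x (rev f)) ≫ P.propComp x y' z := by
  apply P.prop_ext_right
  intro u τ
  rw [← whisker_exchange_assoc, ← comp_whiskerRight_assoc, ι_propPre, ι_propComp, ι_propComp,
    ← MonoidalCategory.whiskerLeft_comp_assoc, propPost_comp, rev_comp]

lemma cast_act {c c' : X} (h : c = c') (u x : ColorSeq X) :
    ((P.obj.cast h).app (op u) ▷ _) ≫ P.act u c' x = P.act u c x ≫ (P.obj.cast h).app (op x) := by
  subst h
  simp [cast_refl]

lemma compSpread_propPost {z z' : ColorSeq X} (s : z' ⟶ z) (u : Fin z.len → ColorSeq X) (x : ColorSeq X) :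
    (P.obj.arrPull s u ⊗ₘ P.propPost x (concatPush s.equiv u)) ≫ P.compSpread z' _ x =
      P.compSpread z u x ≫ P.propPost x s := by
  let g : P.propPresheaf z ⟶ P.propPresheaf z' :=
    { app x := P.propPost x.unop s
      naturality x x' f := P.propPre_propPost _ _ }
  have h1 := P.spread_post u (fun k => P.obj (z.col k)) (P.propPresheaf z)
    (fun k => P.act (u k) (z.col k)) (P.gen z)
    (fun i {_ _} f => P.act_natural _ _ f) (P.gen_natural z) g x
  refine Eq.trans ?_ h1.symm
  let c (w : Fin z'.len → ColorSeq X) :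
      bigT (fun k => (P.obj (z.col (s.equiv k))).obj (op (w k))) ⟶
        bigT (fun k => (P.obj (z'.col k)).obj (op (w k))) :=
    bigMap fun k => (P.obj.cast (s.col_eq k).symm).app _
  have hn : ∀ {w w' : Fin z'.len → ColorSeq X} (τ : ∀ i, w i ⟶ w' i),
      (bigMap fun k => (P.obj (z.col (s.equiv k))).map (τ k).op) ≫ c w ≫ P.gen z' w =
      (c w' ≫ P.gen z' w') ≫ (P.propPresheaf z').map (concatMap τ).op := by
    intro w w' τ
    have := P.gen_natural z' τ
    rw [Category.assoc, ← this, ← Category.assoc, ← Category.assoc]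
    congr 1
    simp only [c, bigMap_comp, cast_map]
  have h2 := P.spread_push u (fun k => P.obj (z.col k)) (P.propPresheaf z')
    (fun k => P.act (u k) (z.col k)) (fun w => P.gen z w ≫ g.app _)
    (fun i {_ _} f => P.act_natural _ _ f) (fun τ => by
      rw [← Category.assoc, P.gen_natural, Category.assoc, g.naturality, Category.assoc])
    s.equiv (fun w => c w ≫ P.gen z' w) hn (fun w => by
      have e1 : P.gen z w ≫ g.app _ = P.obj.arrPull s w ≫
          (P.ι _ (rev (concatPush s.equiv w)) : _ ⟶ (P.propPresheaf z').obj (op (concat w))) := by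
        have := P.ι_propPost _ s w (𝟙 _)
        rw [Category.id_comp] at this
        exact this
      refine Eq.trans ?_ (congrArg (· ≫ (P.propPresheaf z').map (concatPush s.equiv w).op) e1.symm)
      have e2 := P.ι_propPre (concatPush s.equiv w) z' _ (rev (concatPush s.equiv w))
      rw [hom_rev] at e2
      have e3 : P.ι (fun i => w (s.equiv i)) (rev (concatPush s.equiv w)) ≫
        (P.propPresheaf z').map (concatPush s.equiv w).op = P.gen z' _ := e2
      refine Eq.trans ?_ (Category.assoc _ _ _).symm
      refine Eq.trans ?_ (congrArg (fun t => P.obj.arrPull s w ≫ t) e3.symm)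
      exact (Category.assoc _ _ _).symm) x
  rw [← h2]
  have h3 := P.spread_map (fun k => u (s.equiv k)) (fun k => P.obj (z.col (s.equiv k)))
    (P.propPresheaf z') (fun k => P.act (u (s.equiv k)) (z.col (s.equiv k)))
    (fun w => c w ≫ P.gen z' w) (fun i {_ _} f => P.act_natural _ _ f) hn
    (fun k => P.act (u (s.equiv k)) (z'.col k)) (P.gen z') (fun i {_ _} f => P.act_natural _ _ f)
    (P.gen_natural z') (fun k => (P.obj.cast (s.col_eq k).symm).app _)
    (fun k => P.obj.cast (s.col_eq k).symm) (fun k x => P.cast_act _ _ _) (fun w => rfl) x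
  rw [← h3, ← tensorHom_id, tensorHom_comp_tensorHom_assoc, Category.comp_id]
  rfl

lemma propPost_propComp (x y : ColorSeq X) {z z' : ColorSeq X} (s : z' ⟶ z) :
    (P.propPost y s ▷ _) ≫ P.propComp x y z' = P.propComp x y z ≫ P.propPost x s := by
  apply P.prop_ext_right
  intro u τ
  have k : ∀ {D : V} (c : _ ⊗ P.propObj x (concat fun i => u (s.equiv i)) ⟶ D),
      (P.obj.arrPull s u ▷ _) ≫ (_ ◁ P.propPost x (rev (τ ≫ rev (concatPush s.equiv u)))) ≫ c =
      (_ ◁ P.propPost x (rev τ)) ≫ (P.obj.arrPull s u ⊗ₘ P.propPost x (concatPush s.equiv u)) ≫ c := by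
    intro D c
    rw [MonoidalCategory.tensorHom_def', Category.assoc, ← MonoidalCategory.whiskerLeft_comp_assoc,
      propPost_comp, rev_comp, rev_rev, whisker_exchange_assoc]
  rw [← comp_whiskerRight_assoc, ι_propPost, comp_whiskerRight_assoc, ι_propComp,
    ← Category.assoc (P.ι u τ ▷ _), ι_propComp, Category.assoc, ← compSpread_propPost]
  exact k _

/-- Identities in the PROP. -/
noncomputable def propId (x : ColorSeq X) : 𝟙_ V ⟶ P.propObj x x :=
  (bigOne fun i => P.one (x.col i)) ≫ P.ι (fun i => single (x.col i)) (rev (concatSingles x))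

lemma one_cast {c c' : X} (h : c = c') (h' : single c = single c') :
    P.one c ≫ (P.obj.cast h).app _ = P.one c' ≫ (P.obj c').map (eqToHom h').op := by
  subst h
  simp [cast_refl]

lemma propId_dinatural {x x' : ColorSeq X} (f : x ⟶ x') :
    P.propId x' ≫ P.propPre f x' = P.propId x ≫ P.propPost x (rev f) := by
  have h : ∀ i, x.col ((rev f).equiv i) = x'.col i := fun i => ((rev f).col_eq i).symm
  have e : f ≫ rev (concatSingles x') = (rev (concatSingles x) ≫ rev (concatPush (rev f).equiv _)) ≫
      concatMap fun i => eqToHom (congrArg single (h i)) := by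
    refine square_rev (f := concatPush (rev f).equiv (fun i => single (x.col i)) ≫ concatSingles x)
      (concat_hom_ext fun i a => ?_)
    refine Eq.trans ?_ ((congrArg (concatSingles x').equiv (concatMap_equiv
      (fun i => eqToHom (congrArg single (h i)) : ∀ i, single (x.col ((rev f).equiv i)) ⟶ single (x'.col i)) i a)).trans
      (concatSingles_equiv x' i _)).symm
    refine (congrArg (fun j => f.equiv ((concatSingles x).equiv j)) (concatPush_equiv _ _ i a)).trans ?_
    refine (congrArg f.equiv (concatSingles_equiv x _ a)).trans ?_
    exact f.equiv.apply_symm_apply i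
  rw [propId, propId, Category.assoc, Category.assoc, ι_propPre, ι_propPost, e, ← ι_map, ← Category.assoc,
    ← Category.assoc]
  congr 1
  rw [arrPull, ← Category.assoc, bigOne_pull, bigOne_map, arrMap, bigOne_map]
  congr 1
  funext i
  exact (P.one_cast (h i) _).symm

end ColoredOperad

namespace ColoredOperad
open ColorSeq ColoredCollection
variable {X : Type v} {V : Type u} [Category.{v} V] [MonoidalCategory V] [SymmetricCategory V]
  [MonoidalClosed V] [HasLimits V] [HasColimits V] (P : ColoredOperad X V)

/-- `(x', x) ↦ [ℙ(x'; y), N x]` -/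
noncomputable def hatDiagram (N : (ColorSeq X)ᵒᵖ ⥤ V) (y : ColorSeq X) :
    ((ColorSeq X)ᵒᵖ)ᵒᵖ ⥤ (ColorSeq X)ᵒᵖ ⥤ V :=
  (P.prop.obj y).op ⋙ MonoidalClosed.internalHom ⋙ (Functor.whiskeringLeft _ _ _).obj N

/-- The end over `x` of `[ℙ(x; y), N x]`. -/
noncomputable def hatObj (N : (ColorSeq X)ᵒᵖ ⥤ V) (y : ColorSeq X) : V := end_ (P.hatDiagram N y)

section
variable (N : (ColorSeq X)ᵒᵖ ⥤ V) (y : ColorSeq X)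

noncomputable def hatProj (x : ColorSeq X) : P.hatObj N y ⟶ (ihom (P.propObj x y)).obj (N.obj (op x)) :=
  end_.π (P.hatDiagram N y) (op x)

/-- The evaluation maps. -/
noncomputable def hatEv (x : ColorSeq X) : P.propObj x y ⊗ P.hatObj N y ⟶ N.obj (op x) :=
  MonoidalClosed.uncurry (P.hatProj N y x)

lemma hatEv_natural {x x' : ColorSeq X} (f : x ⟶ x') :
    (P.propPre f y ▷ _) ≫ P.hatEv N y x = P.hatEv N y x' ≫ N.map f.op := by
  have h : P.hatProj N y x' ≫ (ihom (P.propObj x' y)).map (N.map f.op) =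
      P.hatProj N y x ≫ (MonoidalClosed.pre (P.propPre f y)).app (N.obj (op x)) :=
    end_.condition (P.hatDiagram N y) f.op
  apply MonoidalClosed.curry_injective
  rw [MonoidalClosed.curry_natural_right (P.hatEv N y x'), ← MonoidalClosed.curry_pre_app, hatEv, hatEv,
    MonoidalClosed.curry_uncurry, MonoidalClosed.curry_uncurry, h]

noncomputable def hatLift {A : V} (t : ∀ x, P.propObj x y ⊗ A ⟶ N.obj (op x))
    (ht : ∀ (x x' : ColorSeq X) (f : x ⟶ x'), (P.propPre f y ▷ _) ≫ t x = t x' ≫ N.map f.op) :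
    A ⟶ P.hatObj N y :=
  end_.lift (F := P.hatDiagram N y) (fun x => MonoidalClosed.curry (t x.unop)) (by
    intro x x' f
    have := ht _ _ f.unop
    have h : MonoidalClosed.curry (t x.unop) ≫ (ihom (P.propObj x.unop y)).map (N.map f) =
        MonoidalClosed.curry (t x'.unop) ≫ (MonoidalClosed.pre (P.propPre f.unop y)).app (N.obj x') := by
      rw [← MonoidalClosed.curry_natural_right, MonoidalClosed.curry_pre_app]
      exact congrArg _ this.symm
    exact h)

@[simp] lemma hatLift_hatEv {A : V} (t : ∀ x, P.propObj x y ⊗ A ⟶ N.obj (op x))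
    (ht : ∀ (x x' : ColorSeq X) (f : x ⟶ x'), (P.propPre f y ▷ _) ≫ t x = t x' ≫ N.map f.op)
    (x : ColorSeq X) : (_ ◁ P.hatLift N y t ht) ≫ P.hatEv N y x = t x := by
  have : P.hatLift N y t ht ≫ P.hatProj N y x = MonoidalClosed.curry (t x) :=
    end_.lift_π (F := P.hatDiagram N y) _ _ _
  rw [hatEv, ← MonoidalClosed.uncurry_natural_left, this, MonoidalClosed.uncurry_curry]

lemma hat_ext {N : (ColorSeq X)ᵒᵖ ⥤ V} {y : ColorSeq X} {A : V} {f g : A ⟶ P.hatObj N y}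
    (h : ∀ x, (_ ◁ f) ≫ P.hatEv N y x = (_ ◁ g) ≫ P.hatEv N y x) : f = g := by
  refine end_.hom_ext fun x => ?_
  have := h x.unop
  rw [hatEv, ← MonoidalClosed.uncurry_natural_left, ← MonoidalClosed.uncurry_natural_left] at this
  exact MonoidalClosed.uncurry_injective this

end

noncomputable def hatMapObj (N : (ColorSeq X)ᵒᵖ ⥤ V) {y y' : ColorSeq X} (s : y ⟶ y') :
    P.hatObj N y' ⟶ P.hatObj N y :=
  P.hatLift N y (fun x => (P.propPost x (rev s) ▷ _) ≫ P.hatEv N y' x) fun _ _ f => by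
    rw [← comp_whiskerRight_assoc, propPre_propPost, comp_whiskerRight_assoc, hatEv_natural, Category.assoc]

@[simp] lemma hatMapObj_hatEv (N : (ColorSeq X)ᵒᵖ ⥤ V) {y y' : ColorSeq X} (s : y ⟶ y') (x : ColorSeq X) :
    (_ ◁ P.hatMapObj N s) ≫ P.hatEv N y x = (P.propPost x (rev s) ▷ _) ≫ P.hatEv N y' x := by
  rw [hatMapObj, hatLift_hatEv]

noncomputable def hatMap {N N' : (ColorSeq X)ᵒᵖ ⥤ V} (g : N ⟶ N') (y : ColorSeq X) :
    P.hatObj N y ⟶ P.hatObj N' y :=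
  P.hatLift N' y (fun x => P.hatEv N y x ≫ g.app _) fun _ _ f => by
    rw [← Category.assoc, hatEv_natural, Category.assoc, g.naturality, Category.assoc]

@[simp] lemma hatMap_hatEv {N N' : (ColorSeq X)ᵒᵖ ⥤ V} (g : N ⟶ N') (y x : ColorSeq X) :
    (_ ◁ P.hatMap g y) ≫ P.hatEv N' y x = P.hatEv N y x ≫ g.app _ := by
  rw [hatMap, hatLift_hatEv]

/-- The functor `N ↦ (y ↦ end over x of [ℙ(x; y), N x])`. -/
noncomputable def hat : ((ColorSeq X)ᵒᵖ ⥤ V) ⥤ ((ColorSeq X)ᵒᵖ ⥤ V) where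
  obj N :=
    { obj y := P.hatObj N y.unop
      map s := P.hatMapObj N s.unop
      map_id y := P.hat_ext fun x => by
        rw [hatMapObj_hatEv]; simp [propPost_id]
      map_comp s t := P.hat_ext fun x => by
        rw [hatMapObj_hatEv, MonoidalCategory.whiskerLeft_comp_assoc, hatMapObj_hatEv,
          whisker_exchange_assoc, hatMapObj_hatEv, ← comp_whiskerRight_assoc, propPost_comp,
          unop_comp, rev_comp] }
  map g :=
    { app y := P.hatMap g y.unop
      naturality y y' s := P.hat_ext fun x => by
        simp only [MonoidalCategory.whiskerLeft_comp, Category.assoc, hatMap_hatEv]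
        rw [← Category.assoc, hatMapObj_hatEv, hatMapObj_hatEv, Category.assoc, whisker_exchange_assoc,
          hatMap_hatEv] }
  map_id N := NatTrans.ext (funext fun y => P.hat_ext fun x => by
    rw [hatMap_hatEv]; simp)
  map_comp f g := NatTrans.ext (funext fun y => P.hat_ext fun x => by
    change _ = _ ◁ (P.hatMap f y.unop ≫ P.hatMap g y.unop) ≫ _
    rw [hatMap_hatEv, MonoidalCategory.whiskerLeft_comp_assoc, hatMap_hatEv, ← Category.assoc (_ ◁ _),
      hatMap_hatEv, Category.assoc]
    rfl)

noncomputable def hatComulInner (N : (ColorSeq X)ᵒᵖ ⥤ V) (y x : ColorSeq X) :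
    P.propObj x y ⊗ P.hatObj N y ⟶ P.hatObj N x :=
  P.hatLift N x (fun x' => (α_ _ _ _).inv ≫ ((β_ _ _).hom ≫ P.propComp x' x y) ▷ _ ≫ P.hatEv N y x')
    fun a b f => by
      rw [associator_inv_naturality_left_assoc, ← comp_whiskerRight_assoc, Category.assoc, Category.assoc,
        ← hatEv_natural, ← comp_whiskerRight_assoc, Category.assoc, ← propComp_propPre,
        BraidedCategory.braiding_naturality_left_assoc]

@[simp] lemma hatComulInner_hatEv (N : (ColorSeq X)ᵒᵖ ⥤ V) (y x x' : ColorSeq X) :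
    (_ ◁ P.hatComulInner N y x) ≫ P.hatEv N x x' =
      (α_ _ _ _).inv ≫ ((β_ _ _).hom ≫ P.propComp x' x y) ▷ _ ≫ P.hatEv N y x' := by
  rw [hatComulInner, hatLift_hatEv]

noncomputable def hatEv₂ (N : (ColorSeq X)ᵒᵖ ⥤ V) (y x : ColorSeq X) :
    P.propObj x y ⊗ P.hatObj (P.hat.obj N) y ⟶ P.hatObj N x := P.hatEv (P.hat.obj N) y x

lemma hatMapObj_hatEv₂ (N : (ColorSeq X)ᵒᵖ ⥤ V) {y y' : ColorSeq X} (s : y ⟶ y') (x : ColorSeq X) :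
    (_ ◁ P.hatMapObj (P.hat.obj N) s) ≫ P.hatEv₂ N y x = (P.propPost x (rev s) ▷ _) ≫ P.hatEv₂ N y' x :=
  P.hatMapObj_hatEv (P.hat.obj N) s x

lemma hatMap_hatEv₂ {N N' : (ColorSeq X)ᵒᵖ ⥤ V} (g : N ⟶ N') (y x : ColorSeq X) :
    (_ ◁ P.hatMap (P.hat.map g) y) ≫ P.hatEv₂ N' y x = P.hatEv₂ N y x ≫ P.hatMap g x :=
  P.hatMap_hatEv (P.hat.map g) y x

lemma hat_ext₂ {N : (ColorSeq X)ᵒᵖ ⥤ V} {y : ColorSeq X} {A : V} {f g : A ⟶ P.hatObj (P.hat.obj N) y}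
    (h : ∀ x, (_ ◁ f) ≫ P.hatEv₂ N y x = (_ ◁ g) ≫ P.hatEv₂ N y x) : f = g := P.hat_ext h

lemma hatComulInner_natural (N : (ColorSeq X)ᵒᵖ ⥤ V) (y : ColorSeq X) {a b : ColorSeq X} (f : a ⟶ b) :
    (P.propPre f y ▷ _) ≫ P.hatComulInner N y a = P.hatComulInner N y b ≫ P.hatMapObj N f :=
  P.hat_ext fun x => by
    rw [MonoidalCategory.whiskerLeft_comp_assoc, MonoidalCategory.whiskerLeft_comp_assoc,
      hatMapObj_hatEv, hatComulInner_hatEv, whisker_exchange_assoc, hatComulInner_hatEv,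
      associator_inv_naturality_middle_assoc, associator_inv_naturality_left_assoc,
      ← comp_whiskerRight_assoc, ← comp_whiskerRight_assoc,
      BraidedCategory.braiding_naturality_left_assoc, BraidedCategory.braiding_naturality_right_assoc,
      propPre_propComp]

noncomputable def hatComulApp (N : (ColorSeq X)ᵒᵖ ⥤ V) (y : ColorSeq X) :
    P.hatObj N y ⟶ P.hatObj (P.hat.obj N) y :=
  P.hatLift (P.hat.obj N) y (fun x => P.hatComulInner N y x) fun _ _ f => P.hatComulInner_natural N y f

lemma hatComulApp_hatEv (N : (ColorSeq X)ᵒᵖ ⥤ V) (y x : ColorSeq X) :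
    (_ ◁ P.hatComulApp N y) ≫ P.hatEv₂ N y x = P.hatComulInner N y x := by
  apply P.hatLift_hatEv (P.hat.obj N)

lemma hatComulInner_propPost (N : (ColorSeq X)ᵒᵖ ⥤ V) {y y' : ColorSeq X} (s : y ⟶ y') (x : ColorSeq X) :
    (_ ◁ P.hatMapObj N s) ≫ P.hatComulInner N y x = (P.propPost x (rev s) ▷ _) ≫ P.hatComulInner N y' x :=
  P.hat_ext fun x' => by
    rw [MonoidalCategory.whiskerLeft_comp_assoc, MonoidalCategory.whiskerLeft_comp_assoc,
      hatComulInner_hatEv, hatComulInner_hatEv, associator_inv_naturality_right_assoc,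
      whisker_exchange_assoc, hatMapObj_hatEv, associator_inv_naturality_middle_assoc,
      ← comp_whiskerRight_assoc, ← comp_whiskerRight_assoc,
      BraidedCategory.braiding_naturality_right_assoc, propPost_propComp, Category.assoc]

lemma hatComulInner_hatMap {N N' : (ColorSeq X)ᵒᵖ ⥤ V} (g : N ⟶ N') (y x : ColorSeq X) :
    (_ ◁ P.hatMap g y) ≫ P.hatComulInner N' y x = P.hatComulInner N y x ≫ P.hatMap g x :=
  P.hat_ext fun x' => by
    rw [MonoidalCategory.whiskerLeft_comp_assoc, MonoidalCategory.whiskerLeft_comp_assoc, hatMap_hatEv,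
      hatComulInner_hatEv, ← Category.assoc _ _ (g.app _), hatComulInner_hatEv,
      associator_inv_naturality_right_assoc, whisker_exchange_assoc, hatMap_hatEv]
    simp only [Category.assoc]

/-- The comultiplication, from composition in the PROP. -/
noncomputable def hatComul : P.hat ⟶ P.hat ⋙ P.hat where
  app N :=
    { app y := P.hatComulApp N y.unop
      naturality y y' s := P.hat_ext₂ fun x => by
        change _ ◁ (P.hatMapObj N s.unop ≫ P.hatComulApp N y'.unop) ≫ _ =
          _ ◁ (P.hatComulApp N y.unop ≫ P.hatMapObj (P.hat.obj N) s.unop) ≫ _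
        rw [MonoidalCategory.whiskerLeft_comp_assoc, MonoidalCategory.whiskerLeft_comp_assoc,
          hatComulApp_hatEv, hatComulInner_propPost, hatMapObj_hatEv₂, whisker_exchange_assoc,
          hatComulApp_hatEv] }
  naturality N N' g := NatTrans.ext (funext fun y => P.hat_ext₂ fun x => by
    change _ ◁ (P.hatMap g y.unop ≫ P.hatComulApp N' y.unop) ≫ _ =
      _ ◁ (P.hatComulApp N y.unop ≫ P.hatMap (P.hat.map g) y.unop) ≫ _
    rw [MonoidalCategory.whiskerLeft_comp_assoc, MonoidalCategory.whiskerLeft_comp_assoc,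
      hatComulApp_hatEv, hatComulInner_hatMap, hatMap_hatEv₂, ← Category.assoc, hatComulApp_hatEv])

/-- The counit, from the identities in the PROP. -/
noncomputable def hatCounit : P.hat ⟶ 𝟭 _ where
  app N :=
    { app y := (λ_ _).inv ≫ P.propId y.unop ▷ _ ≫ P.hatEv N y.unop y.unop
      naturality y y' s := by
        change P.hatMapObj N s.unop ≫ (λ_ _).inv ≫ P.propId y'.unop ▷ _ ≫ P.hatEv N y'.unop y'.unop =
          ((λ_ _).inv ≫ P.propId y.unop ▷ _ ≫ P.hatEv N y.unop y.unop) ≫ N.map s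
        have := P.hatEv_natural N y.unop s.unop
        simp only [Category.assoc]
        rw [leftUnitor_inv_naturality_assoc, whisker_exchange_assoc, hatMapObj_hatEv,
          ← comp_whiskerRight_assoc, ← propId_dinatural, comp_whiskerRight_assoc, hatEv_natural]
        rfl }
  naturality N N' g := NatTrans.ext (funext fun y => by
    change P.hatMap g y.unop ≫ (λ_ _).inv ≫ P.propId y.unop ▷ _ ≫ P.hatEv N' y.unop y.unop =
      ((λ_ _).inv ≫ P.propId y.unop ▷ _ ≫ P.hatEv N y.unop y.unop) ≫ g.app y
    rw [leftUnitor_inv_naturality_assoc, whisker_exchange_assoc, hatMap_hatEv]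
    simp only [Category.assoc])

end ColoredOperad

section
variable {V : Type u} [Category.{v} V] [MonoidalCategory V]
variable {ι κ : Type} [Enum ι] [Enum κ]

lemma isIso_tensMap {ι : Type} {A B : ι → V} (f : ∀ i, A i ⟶ B i) (hf : ∀ i, IsIso (f i)) (l : List ι) :
    IsIso (tensMap f l) := by
  induction l with
  | nil => exact inferInstanceAs (IsIso (𝟙 _))
  | cons a l ih => exact inferInstanceAs (IsIso (f a ⊗ₘ tensMap f l))

lemma isIso_bigMap {A B : ι → V} (f : ∀ i, A i ⟶ B i) (hf : ∀ i, IsIso (f i)) : IsIso (bigMap f) :=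
  isIso_tensMap f hf _

lemma isIso_tensSplitAppend {ι : Type} (A : ι → V) (m l : List ι) : IsIso (tensSplitAppend A m l) := by
  induction l with
  | nil => exact inferInstanceAs (IsIso (λ_ _).inv)
  | cons a l ih => exact inferInstanceAs (IsIso ((_ ◁ tensSplitAppend A m l) ≫ (α_ _ _ _).inv))

lemma isIso_tensUnmap {ι κ : Type} (e : ι → κ) (A : κ → V) (l : List ι) : IsIso (tensUnmap e A l) := by
  induction l with
  | nil => exact inferInstanceAs (IsIso (𝟙 _))
  | cons a l ih => exact inferInstanceAs (IsIso (_ ◁ tensUnmap e A l))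

lemma isIso_bigSplit {J : ι → Type} [∀ i, Enum (J i)] (A : (Σ i, J i) → V) : IsIso (bigSplit A) := by
  have : ∀ l : List ι, IsIso (tensSplit A (fun _ => Enum.list) l) := by
    intro l
    induction l with
    | nil => exact inferInstanceAs (IsIso (𝟙 _))
    | cons a l ih =>
      have := isIso_tensSplitAppend A (l.sigma fun _ => Enum.list) ((Enum.list : List (J a)).map (Sigma.mk a))
      have := isIso_tensUnmap (Sigma.mk a) A (Enum.list : List (J a))
      exact IsIso.comp_isIso' ‹_› (MonoidalCategory.tensor_isIso _ _)
  exact this _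

lemma bigPull_of_eq_refl [SymmetricCategory V] {e : ι ≃ ι} (h : e = Equiv.refl ι) (A : ι → V)
    (h' : ∀ i, A (e i) = A i) : bigPull e A ≫ bigMap (fun i => eqToHom (h' i)) = 𝟙 _ := by
  subst h
  refine (congrArg (· ≫ _) (bigPull_refl A)).trans ((Category.id_comp _).trans (bigMap_id A))

lemma isIso_bigPull [SymmetricCategory V] (e : κ ≃ ι) (A : ι → V) : IsIso (bigPull e A) := by
  refine ⟨bigPull e.symm (fun k => A (e k)) ≫ bigMap fun i => eqToHom (by simp), ?_, ?_⟩
  · rw [← Category.assoc, bigPull_trans]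
    exact bigPull_of_eq_refl e.symm_trans_self A _
  · rw [Category.assoc, bigPull_natural, ← Category.assoc, bigPull_trans (A := fun k => A (e k))]
    exact bigPull_of_eq_refl e.self_trans_symm (fun k => A (e k)) _

end

namespace ColorSeq
variable {X : Type w} {V : Type u} [Category.{v} V] [MonoidalCategory V] [SymmetricCategory V]

/-- The tensor power `C (x 1) ⊗ ⋯ ⊗ C (x n)`. -/
@[reducible] def pow (C : X → V) (x : ColorSeq X) : V := bigT fun i => C (x.col i)

def powMap {C D : X → V} (g : ∀ c, C c ⟶ D c) (x : ColorSeq X) : pow C x ⟶ pow D x :=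
  bigMap fun i => g (x.col i)

/-- The symmetry permuting the tensor factors along `s`. -/
noncomputable def powPull (C : X → V) {x x' : ColorSeq X} (s : x ⟶ x') : pow C x' ⟶ pow C x :=
  bigPull s.equiv (fun i => C (x'.col i)) ≫ bigMap fun i => eqToHom (congrArg C (s.col_eq i).symm)

lemma map_eqToHom' {C D : X → V} (g : ∀ c, C c ⟶ D c) {c c' : X} (h : c = c') :
    g c ≫ eqToHom (congrArg D h) = eqToHom (congrArg C h) ≫ g c' := by
  subst h; simp

lemma powPull_natural {C D : X → V} (g : ∀ c, C c ⟶ D c) {x x' : ColorSeq X} (s : x ⟶ x') :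
    powMap g x' ≫ powPull D s = powPull C s ≫ powMap g x := by
  simp only [powMap, powPull, Category.assoc]
  rw [← Category.assoc, bigPull_natural, Category.assoc, bigMap_comp, bigMap_comp]
  congr 2
  funext i
  exact map_eqToHom' g (s.col_eq i).symm

lemma powPull_id (C : X → V) (x : ColorSeq X) : powPull C (𝟙 x) = 𝟙 _ := by
  simp only [powPull, id_equiv]
  erw [bigPull_refl, Category.id_comp, bigMap_id]
  rfl

lemma powPull_comp (C : X → V) {x x' x'' : ColorSeq X} (s : x ⟶ x') (s' : x' ⟶ x'') :
    powPull C (s ≫ s') = powPull C s' ≫ powPull C s := by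
  simp only [powPull, Category.assoc]
  rw [← Category.assoc (bigMap _) (bigPull _ _), bigPull_natural, Category.assoc, bigMap_comp,
    ← Category.assoc (bigPull _ _) (bigPull _ _), bigPull_trans]
  simp only [eqToHom_trans]
  rfl

/-- The functor `C ↦ (x ↦ C (x 1) ⊗ ⋯ ⊗ C (x n))`. -/
noncomputable def eps (X : Type w) (V : Type u) [Category.{v} V] [MonoidalCategory V] [SymmetricCategory V] :
    (X → V) ⥤ ((ColorSeq X)ᵒᵖ ⥤ V) where
  obj C :=
    { obj x := pow C x.unop
      map f := powPull C f.unop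
      map_id x := powPull_id C x.unop
      map_comp f g := powPull_comp C g.unop f.unop }
  map g :=
    { app x := powMap g x.unop
      naturality x x' f := (powPull_natural g f.unop).symm }
  map_id C := NatTrans.ext (funext fun x => bigMap_id _)
  map_comp f g := NatTrans.ext (funext fun x => (bigMap_comp _ _).symm)

/-- The functor `N ↦ (c ↦ N (c))`. -/
def ev₁ (X : Type w) (V : Type u) [Category.{v} V] : ((ColorSeq X)ᵒᵖ ⥤ V) ⥤ (X → V) where
  obj N c := N.obj (op (single c))
  map g c := g.app _

noncomputable def powSplit (C : X → V) {n : ℕ} (z : Fin n → ColorSeq X) :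
    pow C (concat z) ⟶ bigT fun i => pow C (z i) :=
  bigPull (idx z) (fun j => C ((concat z).col j)) ≫
    bigMap (fun p => eqToHom (congrArg C (col_idx z p))) ≫
    bigSplit fun p : (Σ i, Fin (z i).len) => C ((z p.1).col p.2)

instance (C : X → V) {n : ℕ} (z : Fin n → ColorSeq X) : IsIso (powSplit C z) := by
  have := isIso_bigPull (idx z) (fun j => C ((concat z).col j))
  have := isIso_bigMap (fun p => eqToHom (congrArg C (col_idx z p))) inferInstance
  have := isIso_bigSplit fun p : (Σ i, Fin (z i).len) => C ((z p.1).col p.2)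
  unfold powSplit
  infer_instance

/-- The identification `⨂ i, pow C (z i) ⟶ pow C (z 1 ⋯ z n)`. -/
noncomputable def powJoin (C : X → V) {n : ℕ} (z : Fin n → ColorSeq X) :
    (bigT fun i => pow C (z i)) ⟶ pow C (concat z) := inv (powSplit C z)

lemma powMap_powSplit {C D : X → V} (g : ∀ c, C c ⟶ D c) {n : ℕ} (z : Fin n → ColorSeq X) :
    powMap g (concat z) ≫ powSplit D z = powSplit C z ≫ bigMap fun i => powMap g (z i) := by
  simp only [powMap, powSplit, Category.assoc]
  rw [← Category.assoc (bigMap _) (bigPull _ _), bigPull_natural, Category.assoc,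
    ← Category.assoc (bigMap _) (bigMap _), bigMap_comp]
  simp only [map_eqToHom' g (col_idx z _)]
  rw [← bigMap_comp, Category.assoc, bigSplit_natural]

lemma powJoin_powMap {C D : X → V} (g : ∀ c, C c ⟶ D c) {n : ℕ} (z : Fin n → ColorSeq X) :
    powJoin C z ≫ powMap g (concat z) = (bigMap fun i => powMap g (z i)) ≫ powJoin D z := by
  rw [powJoin, powJoin, IsIso.eq_comp_inv, Category.assoc, powMap_powSplit, IsIso.inv_hom_id_assoc]

lemma powPull_powSplit (C : X → V) {n : ℕ} {z z' : Fin n → ColorSeq X} (s : ∀ i, z i ⟶ z' i) :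
    powPull C (concatMap s) ≫ powSplit C z = powSplit C z' ≫ bigMap fun i => powPull C (s i) := by
  have e1 : (idx z).trans (concatMap s).equiv =
      (Equiv.sigmaCongrRight fun i => (s i).equiv).trans (idx z') := by
    ext ⟨i, l⟩; simp
  have := bigPull_bigSplit_coherence (V := V) _ _ _ _ e1 (fun j => C ((concat z').col j))
    (fun j => C ((concat z).col j)) (fun p => C ((z p.1).col p.2)) (fun p => C ((z' p.1).col p.2))
    (fun i l => C ((z i).col l)) (fun k => congrArg C ((concatMap s).col_eq k).symm)
    (fun p => congrArg C (col_idx z p)) (fun i l => rfl) (fun p => congrArg C (col_idx z' p))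
    (fun i l => congrArg C ((s i).col_eq l).symm)
  simp only [eqToHom_refl, bigMap_id, Category.comp_id] at this
  exact this

lemma powPull_push_powSplit (C : X → V) {m n : ℕ} (e : Fin m ≃ Fin n) (z : Fin n → ColorSeq X) :
    powPull C (concatPush e z) ≫ powSplit C (fun k => z (e k)) =
      powSplit C z ≫ bigPull e fun i => pow C (z i) := by
  have e1 : (idx fun k => z (e k)).trans (concatPush e z).equiv =
      (Equiv.sigmaCongrLeft e).trans (idx z) := by
    ext ⟨i, l⟩; simp [Equiv.sigmaCongrLeft]
  have := bigPull_bigSplit_coherence' (V := V) (J := fun i => Fin (z i).len) e (concatPush e z).equiv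
    (idx z) (idx fun k => z (e k)) e1 (fun j => C ((concat z).col j))
    (fun j => C ((concat fun k => z (e k)).col j)) (fun p => C ((z (e p.1)).col p.2))
    (fun p => C ((z p.1).col p.2)) (fun k => congrArg C ((concatPush e z).col_eq k).symm)
    (fun p => congrArg C (col_idx _ p)) (fun i l => rfl) (fun p => congrArg C (col_idx z p))
  simp only [eqToHom_refl, bigMap_id, Category.comp_id] at this
  exact this

end ColorSeq

open ColorSeq in
/-- Natural maps `⨂ i, N (z i) ⟶ N (z 1 ⋯ z n)`. -/
structure Mult {X : Type w} {V : Type u} [Category.{v} V] [MonoidalCategory V] [SymmetricCategory V]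
    (N : (ColorSeq X)ᵒᵖ ⥤ V) where
  mu {n : ℕ} (z : Fin n → ColorSeq X) : bigT (fun i => N.obj (op (z i))) ⟶ N.obj (op (concat z))
  natural {n : ℕ} {z z' : Fin n → ColorSeq X} (τ : ∀ i, z i ⟶ z' i) :
    (bigMap fun i => N.map (τ i).op) ≫ mu z = mu z' ≫ N.map (concatMap τ).op
  push {m n : ℕ} (e : Fin m ≃ Fin n) (z : Fin n → ColorSeq X) :
    bigPull e (fun i => N.obj (op (z i))) ≫ mu (fun k => z (e k)) = mu z ≫ N.map (concatPush e z).op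

namespace Mult
open ColorSeq
section
variable {X : Type w} {V : Type u} [Category.{v} V] [MonoidalCategory V] [SymmetricCategory V]

/-- For tensor powers, this is the identification given by the symmetric monoidal structure. -/
noncomputable def ofPow (C : X → V) : Mult ((eps X V).obj C) where
  mu z := powJoin C z
  natural {n z z'} τ := by
    change (bigMap fun i => powPull C (τ i)) ≫ powJoin C z = powJoin C z' ≫ powPull C (concatMap τ)
    rw [powJoin, powJoin, IsIso.comp_inv_eq, Category.assoc, powPull_powSplit, IsIso.inv_hom_id_assoc]
  push e z := by
    change bigPull e (fun i => pow C (z i)) ≫ powJoin C (fun k => z (e k)) =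
      powJoin C z ≫ powPull C (concatPush e z)
    rw [powJoin, powJoin, IsIso.comp_inv_eq, Category.assoc, powPull_push_powSplit,
      IsIso.inv_hom_id_assoc]

end
variable {X : Type v} {V : Type u} [Category.{v} V] [MonoidalCategory V] [SymmetricCategory V]
  [MonoidalClosed V] [HasLimits V] [HasColimits V] (P : ColoredOperad X V)

variable {N : (ColorSeq X)ᵒᵖ ⥤ V} (M : Mult N)

noncomputable def ev (N : (ColorSeq X)ᵒᵖ ⥤ V) (y x : ColorSeq X) :
    P.hatObj N y ⊗ P.propObj x y ⟶ N.obj (op x) := (β_ _ _).hom ≫ P.hatEv N y x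

lemma ev_natural (N : (ColorSeq X)ᵒᵖ ⥤ V) (y : ColorSeq X) {x x' : ColorSeq X} (f : x ⟶ x') :
    (_ ◁ P.propPre f y) ≫ ev P N y x = ev P N y x' ≫ N.map f.op := by
  rw [ev, ev, BraidedCategory.braiding_naturality_right_assoc, P.hatEv_natural, Category.assoc]

lemma ev_dinatural (N : (ColorSeq X)ᵒᵖ ⥤ V) {y y' : ColorSeq X} (s : y ⟶ y') (x : ColorSeq X) :
    (P.hatMapObj N s ▷ _) ≫ ev P N y x = (_ ◁ P.propPost x (rev s)) ≫ ev P N y' x := by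
  rw [ev, ev, BraidedCategory.braiding_naturality_right_assoc,
    BraidedCategory.braiding_naturality_left_assoc, P.hatMapObj_hatEv]

lemma hatMap_ev {N N' : (ColorSeq X)ᵒᵖ ⥤ V} (g : N ⟶ N') (y x : ColorSeq X) :
    (P.hatMap g y ▷ _) ≫ ev P N' y x = ev P N y x ≫ g.app _ := by
  rw [ev, ev, BraidedCategory.braiding_naturality_left_assoc, P.hatMap_hatEv, Category.assoc]

/-- The map
`⨂ i, [ℙ(x i; z i), N (x i)] ⟶ [⨂ i, ℙ(x i; z i), ⨂ i, N (x i)] ⟶ [⨂ i, ℙ(x i; z i), N (x 1 ⋯ x n)]`,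
in terms of the evaluation maps. -/
noncomputable def hatSpread {n : ℕ} (z : Fin n → ColorSeq X) (x : ColorSeq X) :
    bigT (fun i => P.hatObj N (z i)) ⊗ P.propObj x (concat z) ⟶ N.obj (op x) :=
  P.spread (A := fun i => P.hatObj N (z i)) z (fun _ => N) N (fun i x => ev P N (z i) x) M.mu
    (fun i {_ _} f => ev_natural P N (z i) f) M.natural x

lemma hatSpread_natural {n : ℕ} (z : Fin n → ColorSeq X) {x x' : ColorSeq X} (f : x ⟶ x') :
    (_ ◁ P.propPre f _) ≫ M.hatSpread P z x = M.hatSpread P z x' ≫ N.map f.op :=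
  P.spread_natural _ _ _ _ _ _ _ f

lemma hatSpread_map {n : ℕ} {z z' : Fin n → ColorSeq X} (τ : ∀ i, z i ⟶ z' i) (x : ColorSeq X) :
    ((bigMap fun i => P.hatMapObj N (τ i)) ▷ _) ≫ M.hatSpread P z x =
      (_ ◁ P.propPost x (rev (concatMap τ))) ≫ M.hatSpread P z' x := by
  rw [rev_concatMap]
  exact P.spread_dinatural (A := fun i => P.hatObj N (z i)) (A' := fun i => P.hatObj N (z' i))
    z (fun _ => N) N (fun i x => ev P N (z i) x) M.mu (fun i {_ _} f => ev_natural P N (z i) f) M.natural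
    (fun i x => ev P N (z' i) x)
    (fun i => rev (τ i)) (fun i => P.hatMapObj N (τ i))
    (fun i {_ _} f => ev_natural P N (z' i) f) (fun i x => ev_dinatural P N (τ i) x) x

lemma hatSpread_push {m n : ℕ} (e : Fin m ≃ Fin n) (z : Fin n → ColorSeq X) (x : ColorSeq X) :
    (bigPull e (fun i => P.hatObj N (z i)) ⊗ₘ P.propPost x (concatPush e z)) ≫
      M.hatSpread P (fun k => z (e k)) x = M.hatSpread P z x :=
  P.spread_push (A := fun i => P.hatObj N (z i)) z (fun _ => N) N (fun i x => ev P N (z i) x) M.mu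
    (fun i {_ _} f => ev_natural P N (z i) f) M.natural e M.mu M.natural (fun w => M.push e w) x

lemma hatSpread_hatMap {N' : (ColorSeq X)ᵒᵖ ⥤ V} (M' : Mult N') (g : N ⟶ N')
    (h : ∀ {n : ℕ} (z : Fin n → ColorSeq X), M.mu z ≫ g.app _ = (bigMap fun i => g.app _) ≫ M'.mu z)
    {n : ℕ} (z : Fin n → ColorSeq X) (x : ColorSeq X) :
    ((bigMap fun i => P.hatMap g (z i)) ▷ _) ≫ M'.hatSpread P z x = M.hatSpread P z x ≫ g.app _ := by
  have h1 := P.spread_post z (A := fun i => P.hatObj N (z i)) (fun _ => N) N (fun i x => ev P N (z i) x) M.mu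
    (fun i {_ _} f => ev_natural P N (z i) f) M.natural g x
  have h2 := P.spread_map z (A := fun i => P.hatObj N (z i)) (A' := fun i => P.hatObj N' (z i)) (fun _ => N)
    (B' := fun _ => N') N' (fun i x => ev P N (z i) x) (fun w => M.mu w ≫ g.app _)
    (fun i {_ _} f => ev_natural P N (z i) f)
    (fun τ => by rw [← Category.assoc, M.natural, Category.assoc, g.naturality, Category.assoc])
    (fun i x => ev P N' (z i) x) M'.mu (fun i {_ _} f => ev_natural P N' (z i) f) M'.natural
    (fun i => P.hatMap g (z i)) (fun i => g) (fun i x => hatMap_ev P g _ _) (fun w => h w) x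
  exact h2.trans h1.symm

/-- The maps `⨂ i, (hat N) (z i) ⟶ (hat N) (z 1 ⋯ z n)`. -/
noncomputable def hatMu {n : ℕ} (z : Fin n → ColorSeq X) :
    bigT (fun i => P.hatObj N (z i)) ⟶ P.hatObj N (concat z) :=
  P.hatLift N (concat z) (fun x => (β_ _ _).hom ≫ M.hatSpread P z x) fun a b f => by
    rw [BraidedCategory.braiding_naturality_left_assoc, hatSpread_natural, Category.assoc]

lemma hatMu_hatEv {n : ℕ} (z : Fin n → ColorSeq X) (x : ColorSeq X) :
    (_ ◁ M.hatMu P z) ≫ P.hatEv N (concat z) x = (β_ _ _).hom ≫ M.hatSpread P z x := by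
  rw [hatMu, P.hatLift_hatEv]

noncomputable def hat : Mult (P.hat.obj N) where
  mu z := M.hatMu P z
  natural {n z z'} τ := by
    change (bigMap fun i => P.hatMapObj N (τ i)) ≫ M.hatMu P z = M.hatMu P z' ≫ P.hatMapObj N (concatMap τ)
    refine P.hat_ext fun x => ?_
    rw [MonoidalCategory.whiskerLeft_comp_assoc, MonoidalCategory.whiskerLeft_comp_assoc, hatMu_hatEv,
      P.hatMapObj_hatEv, whisker_exchange_assoc, hatMu_hatEv,
      BraidedCategory.braiding_naturality_right_assoc, BraidedCategory.braiding_naturality_left_assoc,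
      hatSpread_map]
  push e z := by
    change bigPull e (fun i => P.hatObj N (z i)) ≫ M.hatMu P (fun k => z (e k)) =
      M.hatMu P z ≫ P.hatMapObj N (concatPush e z)
    refine P.hat_ext fun x => ?_
    rw [MonoidalCategory.whiskerLeft_comp_assoc, MonoidalCategory.whiskerLeft_comp_assoc, hatMu_hatEv,
      P.hatMapObj_hatEv, whisker_exchange_assoc, hatMu_hatEv,
      BraidedCategory.braiding_naturality_right_assoc, BraidedCategory.braiding_naturality_left_assoc,
      ← M.hatSpread_push P e z, MonoidalCategory.tensorHom_def', Category.assoc,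
      ← MonoidalCategory.whiskerLeft_comp_assoc, P.propPost_comp, hom_rev, P.propPost_id,
      MonoidalCategory.whiskerLeft_id, Category.id_comp]

lemma hatMu_hatMap {N' : (ColorSeq X)ᵒᵖ ⥤ V} (M' : Mult N') (g : N ⟶ N')
    (h : ∀ {n : ℕ} (z : Fin n → ColorSeq X), M.mu z ≫ g.app _ = (bigMap fun i => g.app _) ≫ M'.mu z)
    {n : ℕ} (z : Fin n → ColorSeq X) :
    M.hatMu P z ≫ P.hatMap g _ = (bigMap fun i => P.hatMap g (z i)) ≫ M'.hatMu P z := by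
  refine P.hat_ext fun x => ?_
  rw [MonoidalCategory.whiskerLeft_comp_assoc, MonoidalCategory.whiskerLeft_comp_assoc, P.hatMap_hatEv,
    ← Category.assoc, hatMu_hatEv, hatMu_hatEv, BraidedCategory.braiding_naturality_right_assoc,
    M.hatSpread_hatMap P M' g h, Category.assoc]

end Mult

attribute [local instance] endofunctorMonoidalCategory

/-- The number of elements of a finite ordinal. -/
def AugmentedSimplexCategory.size : AugmentedSimplexCategory → ℕ
  | .star => 0
  | .of n => n.len + 1

lemma AugmentedSimplexCategory.size_tensor (x y : AugmentedSimplexCategory) :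
    (x ⊗ y).size = x.size + y.size := by
  match x, y with
  | .of m, .of n =>
    change m.len + n.len + 1 + 1 = (m.len + 1) + (n.len + 1)
    omega
  | .star, .of n => exact (Nat.zero_add _).symm
  | .star, .star => rfl
  | .of m, .star => rfl

namespace Mult
open ColorSeq
variable {X : Type w} {V : Type u} [Category.{v} V] [MonoidalCategory V] [SymmetricCategory V]
  {N : (ColorSeq X)ᵒᵖ ⥤ V} (M : Mult N)

/-- The maps `N (x 1) ⊗ ⋯ ⊗ N (x n) ⟶ N x`. -/
noncomputable def ofSinglesApp (x : ColorSeq X) :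
    bigT (fun i => N.obj (op (single (x.col i)))) ⟶ N.obj (op x) :=
  M.mu (fun i => single (x.col i)) ≫ N.map (rev (concatSingles x)).op

lemma ofSinglesApp_natural {x x' : ColorSeq X} (s : x ⟶ x') :
    powPull ((ev₁ X V).obj N) s ≫ M.ofSinglesApp x = M.ofSinglesApp x' ≫ N.map s.op := by
  let τ (i : Fin x.len) : single (x.col i) ⟶ single (x'.col (s.equiv i)) :=
    eqToHom (congrArg single (s.col_eq i))
  have h1 : powPull ((ev₁ X V).obj N) s = bigPull s.equiv (fun i => N.obj (op (single (x'.col i)))) ≫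
      bigMap fun i => N.map (τ i).op := by
    have h : ∀ {y y' : ColorSeq X} (h : y = y'), N.map (eqToHom h).op = eqToHom (by rw [h]) := by
      intro y y' h; subst h; exact N.map_id _
    simp only [τ, h]
    rfl
  have h2 : rev (concatSingles x) ≫ concatMap τ ≫ concatPush s.equiv (fun i => single (x'.col i)) =
      s ≫ rev (concatSingles x') := by
    refine (square_rev (f := concatSingles x) (k := concatSingles x') (concat_hom_ext fun i a => ?_)).symm
    refine (congrArg s.equiv (concatSingles_equiv x i a)).trans (Eq.symm ?_)
    refine (congrArg (fun j => (concatSingles x').equiv ((concatPush s.equiv _).equiv j))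
      (concatMap_equiv τ i a)).trans ?_
    refine (congrArg (concatSingles x').equiv (concatPush_equiv s.equiv _ i _)).trans ?_
    exact concatSingles_equiv x' _ _
  have h3 := M.push s.equiv (fun i => single (x'.col i))
  have h4 := M.natural τ
  have h5 : (bigPull s.equiv (fun i => N.obj (op (single (x'.col i)))) ≫
      bigMap fun i => N.map (τ i).op) ≫ M.ofSinglesApp x = M.ofSinglesApp x' ≫ N.map s.op := by
    rw [ofSinglesApp, ofSinglesApp, Category.assoc, reassoc_of% h4, reassoc_of% h3, ← N.map_comp,
      ← N.map_comp, Category.assoc, ← N.map_comp, ← op_comp, ← op_comp, ← op_comp, ← h2, Category.assoc]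
  exact (congrArg (· ≫ M.ofSinglesApp x) h1).trans h5

lemma ofSinglesApp_map {N' : (ColorSeq X)ᵒᵖ ⥤ V} (M' : Mult N') (g : N ⟶ N')
    (h : ∀ {n : ℕ} (z : Fin n → ColorSeq X), M.mu z ≫ g.app _ = (bigMap fun i => g.app _) ≫ M'.mu z)
    (x : ColorSeq X) :
    (bigMap fun i => g.app (op (single (x.col i)))) ≫ M'.ofSinglesApp x = M.ofSinglesApp x ≫ g.app _ := by
  have := h fun i => single (x.col i)
  rw [ofSinglesApp, ofSinglesApp, ← reassoc_of% this, Category.assoc, g.naturality]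

/-- The map `ε π N ⟶ N`, where `ε` and `π` stand for `eps` and `ev₁`. -/
noncomputable def ofSingles : (eps X V).obj ((ev₁ X V).obj N) ⟶ N where
  app x := M.ofSinglesApp x.unop
  naturality x x' f := M.ofSinglesApp_natural f.unop

end Mult

namespace ColoredOperad
open ColorSeq ColoredCollection AugmentedSimplexCategory
variable {X : Type v} {V : Type u} [Category.{v} V] [MonoidalCategory V] [SymmetricCategory V]
  [MonoidalClosed V] [HasLimits V] [HasColimits V] (P : ColoredOperad X V)

/-- The iterates of `hat`. -/
noncomputable def iter : ℕ → (((ColorSeq X)ᵒᵖ ⥤ V) ⥤ ((ColorSeq X)ᵒᵖ ⥤ V))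
  | 0 => 𝟭 _
  | n + 1 => iter n ⋙ P.hat

lemma iter_add (n m : ℕ) : P.iter m ⋙ P.iter n = P.iter (n + m) := by
  induction n with
  | zero => rw [Nat.zero_add]; rfl
  | succ n ih =>
    rw [Nat.succ_add]
    exact congrArg (· ⋙ P.hat) ih

/-- The counit applied to the `i`-th factor, where the outermost factor comes first. -/
noncomputable def face : ∀ (n : ℕ) (i : Fin (n + 1)), P.iter (n + 1) ⟶ P.iter n
  | n, ⟨0, _⟩ => Functor.whiskerLeft (P.iter n) P.hatCounit
  | n + 1, ⟨i + 1, h⟩ => Functor.whiskerRight (face n ⟨i, Nat.lt_of_succ_lt_succ h⟩) P.hat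

/-- The comultiplication applied to the `i`-th factor. -/
noncomputable def degen : ∀ (n : ℕ) (i : Fin (n + 1)), P.iter (n + 1) ⟶ P.iter (n + 2)
  | n, ⟨0, _⟩ => Functor.whiskerLeft (P.iter n) P.hatComul
  | n + 1, ⟨i + 1, h⟩ => Functor.whiskerRight (degen n ⟨i, Nat.lt_of_succ_lt_succ h⟩) P.hat

/-- The structure on the iterates of `hat` applied to tensor powers. -/
noncomputable def iterMult (C : X → V) : ∀ n, Mult ((P.iter n).obj ((eps X V).obj C))
  | 0 => Mult.ofPow C
  | n + 1 => (iterMult C n).hat P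

lemma iterMult_natural {C D : X → V} (g : C ⟶ D) (n : ℕ) {k : ℕ} (z : Fin k → ColorSeq X) :
    (P.iterMult C n).mu z ≫ ((P.iter n).map ((eps X V).map g)).app _ =
      (bigMap fun i => ((P.iter n).map ((eps X V).map g)).app _) ≫ (P.iterMult D n).mu z := by
  induction n generalizing k with
  | zero => exact powJoin_powMap g z
  | succ n ih => exact (P.iterMult C n).hatMu_hatMap P (P.iterMult D n) _ (fun z => ih z) z

/-- `P^∧_n`, the composite of `eps`, the `n`-th iterate of `hat`, and `ev₁`. -/
noncomputable def laxTerm (n : ℕ) : (X → V) ⥤ (X → V) := eps X V ⋙ P.iter n ⋙ ev₁ X V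

/-- The map `ε π ℙ^m ε ⟶ ℙ^m ε`, where `ℙ`, `ε`, `π` stand for `hat`, `eps`, `ev₁`. -/
noncomputable def beta (m : ℕ) : P.laxTerm m ⋙ eps X V ⟶ eps X V ⋙ P.iter m where
  app C := (P.iterMult C m).ofSingles
  naturality C D g := NatTrans.ext (funext fun x => by
    exact (P.iterMult C m).ofSinglesApp_map (P.iterMult D m) ((P.iter m).map ((eps X V).map g))
      (fun z => P.iterMult_natural g m z) x.unop)

/-- The map `π ℙ^n ε π ℙ^m ε ⟶ π ℙ^n ℙ^m ε`, where `ℙ`, `ε`, `π` stand for `hat`, `eps`, `ev₁`. -/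
noncomputable def alpha (n m : ℕ) : P.laxTerm m ⋙ P.laxTerm n ⟶ P.laxTerm (n + m) :=
  Functor.whiskerRight (P.beta m) (P.iter n ⋙ ev₁ X V) ≫
    Functor.whiskerLeft (eps X V) (Functor.whiskerRight (eqToHom (P.iter_add n m)) (ev₁ X V))

/-- The isomorphism `C c ⟶ C c ⊗ 𝟙`. -/
noncomputable def unit : 𝟭 (X → V) ⟶ P.laxTerm 0 where
  app C c := (ρ_ (C c)).inv
  naturality C D g := funext fun c => by
    change g c ≫ (ρ_ (D c)).inv = (ρ_ (C c)).inv ≫ (g c ⊗ₘ 𝟙 _)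
    exact (rightUnitor_inv_naturality (g c)).trans (congrArg _ (tensorHom_id (g c) (𝟙_ V)).symm)

/-- The functors from the opposite of the category of finite ordinals to endofunctors given by the
iterates of `hat` on objects, by the counit on faces and by the comultiplication on degeneracies. -/
structure IterateFunctor where
  map {x y : AugmentedSimplexCategory} (f : x ⟶ y) : P.iter y.size ⟶ P.iter x.size
  map_id (x : AugmentedSimplexCategory) : map (𝟙 x) = 𝟙 _
  map_comp {x y z : AugmentedSimplexCategory} (f : x ⟶ y) (g : y ⟶ z) : map (f ≫ g) = map g ≫ map f
  map_counit : map (WithInitial.homTo (SimplexCategory.mk 0)) = P.face 0 0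
  map_face (n : ℕ) (i : Fin (n + 2)) : map (inclusion.map (SimplexCategory.δ i)) = P.face (n + 1) i
  map_degen (n : ℕ) (i : Fin (n + 1)) : map (inclusion.map (SimplexCategory.σ i)) = P.degen n i

variable {P}
/-- The functor `n ↦ π ℙ^n ε`. The tensor product of endofunctors here is `F ⊗ G = F ∘ G`. -/
noncomputable def IterateFunctor.lax (A : P.IterateFunctor) :
    AugmentedSimplexCategoryᵒᵖ ⥤ ((X → V) ⥤ (X → V))ᴹᵒᵖ where
  obj x := .mop (P.laxTerm x.unop.size)
  map f := (Functor.whiskerLeft (eps X V) (Functor.whiskerRight (A.map f.unop) (ev₁ X V))).mop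
  map_id x := by
    rw [unop_id, A.map_id, Functor.whiskerRight_id']
    rfl
  map_comp f g := by
    rw [unop_comp, A.map_comp, Functor.whiskerRight_comp, Functor.whiskerLeft_comp, mop_comp]
    rfl

/-- The maps `alpha n m`. -/
noncomputable def IterateFunctor.mu (A : P.IterateFunctor) (x y : AugmentedSimplexCategoryᵒᵖ) :
    A.lax.obj x ⊗ A.lax.obj y ⟶ A.lax.obj (x ⊗ y) :=
  (P.alpha x.unop.size y.unop.size ≫
    eqToHom (congrArg P.laxTerm (size_tensor x.unop y.unop).symm)).mop

/-- The unit isomorphism. -/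
noncomputable def IterateFunctor.one (A : P.IterateFunctor) :
    𝟙_ (((X → V) ⥤ (X → V))ᴹᵒᵖ) ⟶ A.lax.obj (𝟙_ AugmentedSimplexCategoryᵒᵖ) := P.unit.mop
end ColoredOperad

section
variable {V : Type u} [Category.{v} V] [MonoidalCategory V] [SymmetricCategory V]
variable {ι κ μ ν : Type} [Enum ι] [Enum κ] [Enum μ] [Enum ν]
open TensTree

/-- Reindexing a tensor product along `e`, with identifications of the factors. -/
noncomputable def gpull (e : κ ≃ ι) (F : ι → V) (G : κ → V) (h : ∀ k, F (e k) = G k) :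
    bigT F ⟶ bigT G :=
  bigPull e F ≫ bigMap fun k => eqToHom (h k)

/-- Bracketing a tensor product along `e`, with identifications of the factors. -/
noncomputable def gsplit {J : ι → Type} [∀ i, Enum (J i)] (e : (Σ i, J i) ≃ κ) (F : κ → V)
    (G : ∀ i, J i → V) (h : ∀ i j, F (e ⟨i, j⟩) = G i j) : bigT F ⟶ bigT fun i => bigT (G i) :=
  bigPull e F ≫ bigMap (B := fun p : Σ i, J i => G p.1 p.2) (fun p => eqToHom (h p.1 p.2)) ≫
    bigSplit fun p : Σ i, J i => G p.1 p.2

lemma gsplit_natural {J : ι → Type} [∀ i, Enum (J i)] (e : (Σ i, J i) ≃ κ) {F F' : κ → V}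
    {G G' : ∀ i, J i → V} (h : ∀ i j, F (e ⟨i, j⟩) = G i j) (h' : ∀ i j, F' (e ⟨i, j⟩) = G' i j)
    (f : ∀ k, F k ⟶ F' k) (g : ∀ i j, G i j ⟶ G' i j)
    (hfg : ∀ i j, f (e ⟨i, j⟩) ≫ eqToHom (h' i j) = eqToHom (h i j) ≫ g i j) :
    bigMap f ≫ gsplit e F' G' h' = gsplit e F G h ≫ bigMap fun i => bigMap (g i) := by
  simp only [gsplit, Category.assoc]
  rw [reassoc_of% bigPull_natural, reassoc_of% bigMap_comp]
  have q := bigSplit_natural (A := fun p : Σ i, J i => G p.1 p.2)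
    (B := fun p : Σ i, J i => G' p.1 p.2) (fun p => g p.1 p.2)
  have e1 : ∀ p : Σ i, J i, f (e p) ≫ eqToHom (h' p.1 p.2) = eqToHom (h p.1 p.2) ≫ g p.1 p.2 :=
    fun p => hfg p.1 p.2
  simp only [e1]
  rw [← bigMap_comp, Category.assoc]
  exact congrArg (fun t => _ ≫ _ ≫ t) q

lemma gsplit_map_eqToHom {J : ι → Type} [∀ i, Enum (J i)] (e : (Σ i, J i) ≃ κ) (F : κ → V)
    {G G' : ∀ i, J i → V} (h : ∀ i j, F (e ⟨i, j⟩) = G i j) (h' : ∀ i j, G i j = G' i j) :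
    gsplit e F G h ≫ bigMap (fun i => bigMap fun j => eqToHom (h' i j)) =
      gsplit e F G' fun i j => (h i j).trans (h' i j) := by
  obtain rfl : G = G' := funext₂ h'
  simp only [eqToHom_refl, bigMap_id, Category.comp_id]

namespace TensTree
variable {A : μ → V}

omit [Enum μ] in
lemma IsStr.gpull (e : κ ≃ ι) (t : ι → TensTree μ) (t' : κ → TensTree μ)
    (h : ∀ k, t (e k) = t' k) :
    IsStr (A := A) (big Enum.list t) (big Enum.list t')
      (gpull e (fun k => ev A (t k)) (fun k => ev A (t' k)) fun k => congrArg (ev A) (h k)) :=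
  (IsStr.pull (A := A) e t).comp (IsCan.big Enum.list fun k => IsStr.eqToHom (h k))

omit [Enum μ] in
lemma IsStr.gsplit {J : ι → Type} [∀ i, Enum (J i)] (e : (Σ i, J i) ≃ κ) (t : κ → TensTree μ)
    (t' : ∀ i, J i → TensTree μ) (h : ∀ i j, t (e ⟨i, j⟩) = t' i j) :
    IsStr (A := A) (big Enum.list t) (big Enum.list fun i => big Enum.list (t' i))
      (gsplit e (fun k => ev A (t k)) (fun i j => ev A (t' i j))
        fun i j => congrArg (ev A) (h i j)) :=
  (IsStr.pull (A := A) e t).comp ((IsCan.big (t' := fun p : Σ i, J i => t' p.1 p.2) Enum.list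
    fun p : Σ i, J i => IsStr.eqToHom (h p.1 p.2)).comp_str
    (IsStr.tensSplit _ _ fun p : Σ i, J i => t' p.1 p.2))

end TensTree

lemma flat_foldr_cons {ι κ : Type} (f : ι → κ) (l : List ι) (r : List κ) :
    l.foldr (fun k r => f k :: r) r = l.map f ++ r := by
  induction l <;> simp_all

/-- Two ways of bracketing a family twice agree. -/
lemma gsplit_gsplit {J : ι → Type} [∀ i, Enum (J i)] {L : κ → Type} [∀ k, Enum (L k)]
    {M : ι → Type} [∀ i, Enum (M i)]
    (e₁ : (Σ i, J i) ≃ κ) (e₂ : (Σ k, L k) ≃ μ) (e₃ : ν ≃ μ) (e₄ : (Σ i, M i) ≃ ν)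
    (e₅ : ∀ i, (Σ j, L (e₁ ⟨i, j⟩)) ≃ M i)
    (he : ∀ i j l, e₃ (e₄ ⟨i, e₅ i ⟨j, l⟩⟩) = e₂ ⟨e₁ ⟨i, j⟩, l⟩) (F : μ → V) (F₂ : ∀ k, L k → V)
    (F₃ : ν → V) (F₄ : ∀ i, M i → V) (F₅ : ∀ i j, L (e₁ ⟨i, j⟩) → V)
    (h₂ : ∀ k l, F (e₂ ⟨k, l⟩) = F₂ k l) (h₃ : ∀ n, F (e₃ n) = F₃ n)
    (h₄ : ∀ i m, F₃ (e₄ ⟨i, m⟩) = F₄ i m) (h₅ : ∀ i j l, F₄ i (e₅ i ⟨j, l⟩) = F₅ i j l)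
    (h₆ : ∀ i j l, F₂ (e₁ ⟨i, j⟩) l = F₅ i j l) :
    gsplit e₂ F F₂ h₂ ≫ gsplit e₁ (fun k => bigT (F₂ k)) (fun i j => bigT (F₅ i j))
        (fun i j => congrArg bigT (funext (h₆ i j))) =
      gpull e₃ F F₃ h₃ ≫ gsplit e₄ F₃ F₄ h₄ ≫
        bigMap fun i => gsplit (e₅ i) (F₄ i) (F₅ i) (h₅ i) := by
  obtain rfl : F₂ = fun k l => F (e₂ ⟨k, l⟩) := funext₂ fun k l => (h₂ k l).symm
  obtain rfl : F₃ = fun n => F (e₃ n) := funext fun n => (h₃ n).symm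
  obtain rfl : F₄ = fun i m => F (e₃ (e₄ ⟨i, m⟩)) := funext₂ fun i m => (h₄ i m).symm
  obtain rfl : F₅ = fun i j l => F (e₂ ⟨e₁ ⟨i, j⟩, l⟩) :=
    funext₂ fun i j => funext fun l => (h₆ i j l).symm
  have s1 := IsStr.gsplit (A := F) e₂ leaf (fun k l => leaf (e₂ ⟨k, l⟩)) fun _ _ => rfl
  have s2 := IsStr.gsplit (A := F) e₁ (fun k => big Enum.list fun l => leaf (e₂ ⟨k, l⟩))
    (fun i j => big Enum.list fun l => leaf (e₂ ⟨e₁ ⟨i, j⟩, l⟩)) fun _ _ => rfl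
  have s3 := IsStr.gpull (A := F) e₃ leaf (fun n => leaf (e₃ n)) fun _ => rfl
  have s4 := IsStr.gsplit (A := F) e₄ (fun n => leaf (e₃ n)) (fun i m => leaf (e₃ (e₄ ⟨i, m⟩)))
    fun _ _ => rfl
  have s5 := IsCan.big (Enum.list : List ι) fun i => IsStr.gsplit (A := F) (e₅ i)
    (fun m => leaf (e₃ (e₄ ⟨i, m⟩))) (fun j l => leaf (e₂ ⟨e₁ ⟨i, j⟩, l⟩))
    fun j l => congrArg leaf (he i j l)
  exact IsStr.unique (s := big Enum.list leaf) (by simpa using Enum.nodup) (s1.comp s2)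
    (s3.comp (s4.comp s5))

lemma bigZip_bigSplit {J : ι → Type} [∀ i, Enum (J i)] (A B : (Σ i, J i) → V) :
    (bigSplit A ⊗ₘ bigSplit B) ≫ bigZip _ _ ≫ bigMap (fun i => bigZip _ _) =
      bigZip A B ≫ bigSplit _ := by
  let C : (Σ i, J i) ⊕ (Σ i, J i) → V := Sum.elim A B
  have h1 := (IsStr.tensSplit (A := C) (Enum.list : List ι) (fun i => (Enum.list : List (J i)))
    (fun p : Σ i, J i => leaf (.inl p))).node
    (IsStr.tensSplit (A := C) (Enum.list : List ι) (fun i => (Enum.list : List (J i)))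
    (fun p : Σ i, J i => leaf (.inr p)))
  have h2 := IsStr.tensZip (A := C) (Enum.list : List ι)
    (fun i => big (Enum.list : List (J i)) fun j => leaf (.inl ⟨i, j⟩))
    (fun i => big (Enum.list : List (J i)) fun j => leaf (.inr ⟨i, j⟩))
  have h3 := IsCan.big (Enum.list : List ι) fun i => IsStr.tensZip (A := C)
    (Enum.list : List (J i)) (fun j => leaf (.inl ⟨i, j⟩)) (fun j => leaf (.inr ⟨i, j⟩))
  have h4 := IsStr.tensZip (A := C) (Enum.list : List (Σ i, J i)) (fun p => leaf (.inl p))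
    (fun p => leaf (.inr p))
  have h5 := IsStr.tensSplit (A := C) (Enum.list : List ι) (fun i => (Enum.list : List (J i)))
    (fun p : Σ i, J i => node (leaf (.inl p)) (leaf (.inr p)))
  refine IsStr.unique (A := C) (s := node (big Enum.list fun i => leaf (.inl i))
    (big Enum.list fun i => leaf (.inr i))) ?_ (h1.comp_str (h2.comp h3)) (h4.comp h5)
  simp only [flat, flat_foldr_cons, List.append_nil]
  exact (Enum.nodup.map Sum.inl_injective).append (Enum.nodup.map Sum.inr_injective) (by
    intro x h1 h2
    obtain ⟨_, _, rfl⟩ := List.mem_map.1 h1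
    simp at h2)

lemma bigZip_gsplit {J : ι → Type} [∀ i, Enum (J i)] (e : (Σ i, J i) ≃ κ) (F F' : κ → V)
    (G G' : ∀ i, J i → V) (h : ∀ i j, F (e ⟨i, j⟩) = G i j) (h' : ∀ i j, F' (e ⟨i, j⟩) = G' i j) :
    (gsplit e F G h ⊗ₘ gsplit e F' G' h') ≫ bigZip _ _ ≫ bigMap (fun i => bigZip (G i) (G' i)) =
      bigZip F F' ≫ gsplit e (fun k => F k ⊗ F' k) (fun i j => G i j ⊗ G' i j)
        fun i j => by rw [h, h'] := by
  obtain rfl : G = fun i j => F (e ⟨i, j⟩) := funext₂ fun i j => (h i j).symm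
  obtain rfl : G' = fun i j => F' (e ⟨i, j⟩) := funext₂ fun i j => (h' i j).symm
  simp only [gsplit, eqToHom_refl, bigMap_id, Category.id_comp]
  rw [← tensorHom_comp_tensorHom, Category.assoc]
  have := bigZip_bigSplit (fun p => F (e p)) (fun p => F' (e p))
  refine (congrArg (fun t => _ ≫ t) this).trans ?_
  rw [← Category.assoc, bigPull_bigZip, Category.assoc]

/-- Zipping three families. -/
lemma bigZip_assoc (A B C : ι → V) :
    (bigZip A B ▷ bigT C) ≫ bigZip (fun i => A i ⊗ B i) C ≫ bigMap (fun i => (α_ (A i) (B i) (C i)).hom) =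
      (α_ _ _ _).hom ≫ (bigT A ◁ bigZip B C) ≫ bigZip A (fun i => B i ⊗ C i) := by
  let D : ι ⊕ ι ⊕ ι → V := Sum.elim A (Sum.elim B C)
  have h1 := (IsStr.tensZip (A := D) (Enum.list : List ι) (fun i => leaf (.inl i))
    (fun i => leaf (.inr (.inl i)))).whiskerRight (big Enum.list fun i => leaf (.inr (.inr i)))
  have h2 := IsStr.tensZip (A := D) (Enum.list : List ι)
    (fun i => node (leaf (.inl i)) (leaf (.inr (.inl i)))) (fun i => leaf (.inr (.inr i)))
  have h3 := IsCan.big (Enum.list : List ι) fun i => IsStr.assoc (A := D) (leaf (.inl i))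
    (leaf (.inr (.inl i))) (leaf (.inr (.inr i)))
  have h4 := IsStr.assoc (A := D) (big (Enum.list : List ι) fun i => leaf (.inl i))
    (big (Enum.list : List ι) fun i => leaf (.inr (.inl i)))
    (big (Enum.list : List ι) fun i => leaf (.inr (.inr i)))
  have h5 := (IsStr.tensZip (A := D) (Enum.list : List ι) (fun i => leaf (.inr (.inl i)))
    (fun i => leaf (.inr (.inr i)))).whiskerLeft (big Enum.list fun i => leaf (.inl i))
  have h6 := IsStr.tensZip (A := D) (Enum.list : List ι) (fun i => leaf (.inl i))
    (fun i => node (leaf (.inr (.inl i))) (leaf (.inr (.inr i))))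
  refine IsStr.unique (A := D) (s := node (node (big Enum.list fun i => leaf (.inl i))
    (big Enum.list fun i => leaf (.inr (.inl i)))) (big Enum.list fun i => leaf (.inr (.inr i)))) ?_
    (h1.comp (h2.comp h3)) (h4.comp (h5.comp h6))
  simp only [flat, flat_foldr_cons, List.append_nil]
  refine (Enum.nodup.map Sum.inl_injective).append ((Enum.nodup.map
    (Sum.inr_injective.comp Sum.inl_injective)).append (Enum.nodup.map
    (Sum.inr_injective.comp Sum.inr_injective)) ?_) ?_
  · intro x h1 h2
    obtain ⟨_, _, rfl⟩ := List.mem_map.1 h1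
    simp at h2
  · intro x h1 h2
    obtain ⟨_, _, rfl⟩ := List.mem_map.1 h1
    simp at h2

lemma tensZip_tensOne {ι : Type} (A : ι → V) {B : ι → V} (f : ∀ i, 𝟙_ V ⟶ B i) (l : List ι) :
    (tens A l ◁ tensOne f l) ≫ tensZip A B l =
      (ρ_ _).hom ≫ tensMap (fun i => (ρ_ _).inv ≫ A i ◁ f i) l := by
  induction l with
  | nil => simp [tensOne, tensZip, tensMap, unitors_equal]
  | cons a l ih =>
    simp only [tensOne, tensZip, tensMap]
    rw [MonoidalCategory.whiskerLeft_comp_assoc, ← id_tensorHom, ← id_tensorHom, ← id_tensorHom,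
      ← id_tensorHom_id, tensorμ_natural_assoc, tensorHom_comp_tensorHom, Category.comp_id,
      id_tensorHom (tens A l), ih, id_tensorHom_id]
    have : (𝟙 (A a ⊗ tens A l) ⊗ₘ (λ_ (𝟙_ V)).inv) ≫ tensorμ (A a) (tens A l) (𝟙_ V) (𝟙_ V) =
        (ρ_ _).hom ≫ ((ρ_ _).inv ⊗ₘ (ρ_ _).inv) := by
      rw [← cancel_epi (ρ_ _).inv, Iso.inv_hom_id_assoc]
      simp [tensorμ, MonoidalCategory.tensorHom_def]
      monoidal
    rw [reassoc_of% this, tensorHom_comp_tensorHom]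
    simp

lemma bigZip_bigOne (A : ι → V) {B : ι → V} (f : ∀ i, 𝟙_ V ⟶ B i) :
    (bigT A ◁ bigOne f) ≫ bigZip A B = (ρ_ _).hom ≫ bigMap (fun i => (ρ_ _).inv ≫ A i ◁ f i) :=
  tensZip_tensOne A f _

lemma bigZip_action {A B D E F G : ι → V} {S T : V} (s : S ⟶ bigT B) (t : T ⟶ bigT D)
    (f : ∀ i, A i ⊗ B i ⟶ E i) (g : ∀ i, E i ⊗ D i ⟶ G i) (m : ∀ i, B i ⊗ D i ⟶ F i)
    (k : ∀ i, A i ⊗ F i ⟶ G i)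
    (h : ∀ i, (f i ▷ D i) ≫ g i = (α_ _ _ _).hom ≫ (A i ◁ m i) ≫ k i) :
    (((bigT A ◁ s) ≫ bigZip A B ≫ bigMap f) ▷ T) ≫ (_ ◁ t) ≫ bigZip E D ≫ bigMap g =
      (α_ _ _ _).hom ≫ (bigT A ◁ ((s ⊗ₘ t) ≫ bigZip B D ≫ bigMap m)) ≫ bigZip A F ≫ bigMap k := by
  have h1 := bigZip_natural f fun i => 𝟙 (D i)
  have h2 := bigZip_natural (fun i => 𝟙 (A i)) m
  simp only [bigMap_id, id_tensorHom, tensorHom_id] at h1 h2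
  simp only [MonoidalCategory.whiskerLeft_comp, Category.assoc]
  rw [reassoc_of% h2, bigMap_comp, MonoidalCategory.tensorHom_def', MonoidalCategory.whiskerLeft_comp,
    Category.assoc, ← associator_naturality_right_assoc, ← associator_naturality_middle_assoc,
    ← reassoc_of% bigZip_assoc, ← whisker_exchange_assoc, comp_whiskerRight, comp_whiskerRight,
    Category.assoc, Category.assoc, reassoc_of% h1, bigMap_comp, bigMap_comp]
  simp only [h]

lemma tensOne_tensZip {ι : Type} {A : ι → V} (B : ι → V) (f : ∀ i, 𝟙_ V ⟶ A i) (l : List ι) :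
    (tensOne f l ▷ tens B l) ≫ tensZip A B l =
      (λ_ _).hom ≫ tensMap (fun i => (λ_ _).inv ≫ f i ▷ B i) l := by
  induction l with
  | nil => simp [tensOne, tensZip, tensMap]
  | cons a l ih =>
    simp only [tensOne, tensZip, tensMap]
    rw [comp_whiskerRight_assoc, ← tensorHom_id, ← tensorHom_id, ← id_tensorHom,
      ← id_tensorHom_id (B a) (tens B l), tensorμ_natural_assoc, tensorHom_comp_tensorHom, Category.comp_id,
      tensorHom_id (tensOne f l), ih]
    have : ((λ_ (𝟙_ V)).inv ⊗ₘ 𝟙 (B a ⊗ tens B l)) ≫ tensorμ (𝟙_ V) (𝟙_ V) (B a) (tens B l) =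
        (λ_ _).hom ≫ ((λ_ _).inv ⊗ₘ (λ_ _).inv) := by
      rw [← cancel_epi (λ_ _).inv, Iso.inv_hom_id_assoc]
      simp [tensorμ, MonoidalCategory.tensorHom_def]
    rw [id_tensorHom_id, reassoc_of% this, tensorHom_comp_tensorHom]
    simp

lemma bigOne_bigZip {A : ι → V} (B : ι → V) (f : ∀ i, 𝟙_ V ⟶ A i) :
    (bigOne f ▷ bigT B) ≫ bigZip A B = (λ_ _).hom ≫ bigMap (fun i => (λ_ _).inv ≫ f i ▷ B i) :=
  tensOne_tensZip B f _

lemma tensOne_tensSplitAppend {ι : Type} {A : ι → V} (f : ∀ i, 𝟙_ V ⟶ A i) (m l : List ι) :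
    tensOne f (l ++ m) ≫ tensSplitAppend A m l = (λ_ _).inv ≫ (tensOne f l ⊗ₘ tensOne f m) := by
  induction l with
  | nil => simp [tensOne, tensSplitAppend]
  | cons a l ih =>
    simp only [tensOne, tensSplitAppend, List.cons_append, Category.assoc]
    rw [← id_tensorHom, tensorHom_comp_tensorHom_assoc, ih, Category.comp_id]
    have h : f a ⊗ₘ (λ_ (𝟙_ V)).inv ≫ (tensOne f l ⊗ₘ tensOne f m) =
        (𝟙_ V ◁ (λ_ (𝟙_ V)).inv) ≫ (f a ⊗ₘ (tensOne f l ⊗ₘ tensOne f m)) := by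
      rw [← id_tensorHom, tensorHom_comp_tensorHom, Category.id_comp]
    have h' : (λ_ (𝟙_ V)).inv ≫ (f a ⊗ₘ tensOne f l) ⊗ₘ tensOne f m =
        ((λ_ (𝟙_ V)).inv ▷ 𝟙_ V) ≫ ((f a ⊗ₘ tensOne f l) ⊗ₘ tensOne f m) := by
      rw [← tensorHom_id, tensorHom_comp_tensorHom, Category.id_comp]
    rw [h, h', Category.assoc, associator_inv_naturality, unitors_inv_equal]
    simp

lemma tensOne_tensUnmap {ι κ : Type} (e : ι → κ) {A : κ → V} (f : ∀ i, 𝟙_ V ⟶ A i) (l : List ι) :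
    tensOne f (l.map e) ≫ tensUnmap e A l = tensOne (fun i => f (e i)) l := by
  induction l with
  | nil => exact Category.comp_id _
  | cons a l ih =>
    change ((λ_ _).inv ≫ (f (e a) ⊗ₘ tensOne f (l.map e))) ≫ (_ ◁ tensUnmap e A l) = _
    rw [Category.assoc, ← id_tensorHom, tensorHom_comp_tensorHom, ih, Category.comp_id]
    rfl

lemma bigOne_bigSplit {J : ι → Type} [∀ i, Enum (J i)] {A : (Σ i, J i) → V}
    (f : ∀ p, 𝟙_ V ⟶ A p) :
    bigOne f ≫ bigSplit A = bigOne fun i => bigOne fun j => f ⟨i, j⟩ := by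
  have : ∀ l : List ι, tensOne f (l.sigma fun _ => Enum.list) ≫ tensSplit A (fun _ => Enum.list) l =
      tensOne (fun i => (bigOne (fun j => f ⟨i, j⟩) : _ ⟶ bigT _)) l := by
    intro l
    induction l with
    | nil => simp [tensOne, tensSplit]
    | cons a l ih =>
      have h1 := tensOne_tensSplitAppend f (l.sigma fun _ => Enum.list)
        ((Enum.list : List (J a)).map (Sigma.mk a))
      have h2 := tensOne_tensUnmap (Sigma.mk a) f (Enum.list : List (J a))
      simp only [tensOne, tensSplit, List.sigma_cons, reassoc_of% h1, tensorHom_comp_tensorHom, h2, ih]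
      rfl
  exact this _

lemma bigOne_gsplit {J : ι → Type} [∀ i, Enum (J i)] (e : (Σ i, J i) ≃ κ) {F : κ → V}
    {G : ∀ i, J i → V} (h : ∀ i j, F (e ⟨i, j⟩) = G i j) (f : ∀ k, 𝟙_ V ⟶ F k) :
    bigOne f ≫ gsplit e F G h = bigOne fun i => bigOne fun j => f (e ⟨i, j⟩) ≫ eqToHom (h i j) := by
  rw [gsplit, reassoc_of% bigOne_pull, reassoc_of% bigOne_map, bigOne_bigSplit]

/-- Splitting a family into one-term families. -/
lemma gpull_gsplit_one (e₃ : ν ≃ ι) (e₄ : (Σ _ : ι, Fin 1) ≃ ν) (he : ∀ i j, e₃ (e₄ ⟨i, j⟩) = i)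
    (F : ι → V) (F₃ : ν → V) (F₄ : ι → Fin 1 → V) (h₃ : ∀ n, F (e₃ n) = F₃ n)
    (h₄ : ∀ i j, F₃ (e₄ ⟨i, j⟩) = F₄ i j) :
    gpull e₃ F F₃ h₃ ≫ gsplit e₄ F₃ F₄ h₄ ≫
        bigMap (B := fun i => F₄ i 0) (fun i => (ρ_ (F₄ i 0)).hom) =
      bigMap fun i => eqToHom (by rw [← h₄, ← h₃, he]) := by
  obtain rfl : F₃ = fun n => F (e₃ n) := funext fun n => (h₃ n).symm
  obtain rfl : F₄ = fun i j => F (e₃ (e₄ ⟨i, j⟩)) := funext₂ fun i m => (h₄ i m).symm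
  have s3 := IsStr.gpull (A := F) e₃ leaf (fun n => leaf (e₃ n)) fun _ => rfl
  have s4 := IsStr.gsplit (A := F) e₄ (fun n => leaf (e₃ n)) (fun i j => leaf (e₃ (e₄ ⟨i, j⟩)))
    fun _ _ => rfl
  have s5 := IsCan.big (Enum.list : List ι) fun i => IsStr.rightUnit (A := F) (leaf (e₃ (e₄ ⟨i, 0⟩)))
  have s6 := IsCan.big (Enum.list : List ι) fun i => IsStr.eqToHom (A := F)
    (congrArg leaf (he i 0).symm)
  exact IsStr.unique (s := big Enum.list leaf) (by simpa using Enum.nodup) (s3.comp (s4.comp s5)) s6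

end

namespace ColoredCollection
open ColorSeq
variable {X : Type w} {V : Type u} [Category.{v} V] (P : ColoredCollection X V)
variable [MonoidalCategory V] [SymmetricCategory V]

lemma arrPull_eq {u u' : ColorSeq X} (s : u ⟶ u') (w : Fin u'.len → ColorSeq X) :
    P.arrPull s w = gpull s.equiv (fun i => (P (u'.col i)).obj (op (w i)))
      (fun i => (P (u.col i)).obj (op (w (s.equiv i)))) (fun i => by rw [s.col_eq]) := by
  simp only [arrPull, gpull, cast_app]

lemma arrSplit_eq {n : ℕ} (y : Fin n → ColorSeq X) (z : Fin (concat y).len → ColorSeq X) :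
    P.arrSplit y z = gsplit (idx y) (fun j => (P ((concat y).col j)).obj (op (z j)))
      (fun i l => (P ((y i).col l)).obj (op (z (idx y ⟨i, l⟩)))) (fun i l => by rw [col_idx]) := by
  simp only [arrSplit, gsplit, cast_app]

lemma _root_.ColorSeq.concatAssoc_idx {n : ℕ} (y : Fin n → ColorSeq X) (u : Fin (concat y).len → ColorSeq X)
    {α : Type*} (w : Fin (concat u).len → α) (i : Fin n) (l : Fin (y i).len)
    (a : Fin (u (idx y ⟨i, l⟩)).len) :
    w (idx u ⟨idx y ⟨i, l⟩, a⟩) = w ((concatAssoc y u).equiv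
      (idx (fun i => concat fun l => u (idx y ⟨i, l⟩)) ⟨i, idx (fun l => u (idx y ⟨i, l⟩)) ⟨l, a⟩⟩)) := by
  rw [concatAssoc_equiv]

lemma arrSplit_gsplit {n : ℕ} (y : Fin n → ColorSeq X) (u : Fin (concat y).len → ColorSeq X)
    (w : Fin (concat u).len → ColorSeq X) :
    P.arrSplit u w ≫ gsplit (idx y) (fun j => P.arr (u j) fun a => w (idx u ⟨j, a⟩))
      (fun i l => P.arr (u (idx y ⟨i, l⟩)) fun a => w (idx u ⟨idx y ⟨i, l⟩, a⟩)) (fun _ _ => rfl) =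
    P.arrPull (concatAssoc y u) w ≫ P.arrSplit (fun i => concat fun l => u (idx y ⟨i, l⟩))
        (fun m => w ((concatAssoc y u).equiv m)) ≫
      bigMap fun i => P.arrSplit (fun l => u (idx y ⟨i, l⟩))
          (fun m => w ((concatAssoc y u).equiv (idx _ ⟨i, m⟩))) ≫
        bigMap fun l => P.arrMap (u (idx y ⟨i, l⟩)) fun a => eqToHom (concatAssoc_idx y u w i l a) := by
  have h := gsplit_gsplit (V := V) (idx y) (idx u) (concatAssoc y u).equiv
    (idx fun i => concat fun l => u (idx y ⟨i, l⟩)) (fun i => idx fun l => u (idx y ⟨i, l⟩))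
    (concatAssoc_equiv y u) (fun j => (P ((concat u).col j)).obj (op (w j)))
    (fun k a => (P ((u k).col a)).obj (op (w (idx u ⟨k, a⟩)))) _
    (fun i m => (P ((concat fun l => u (idx y ⟨i, l⟩)).col m)).obj
      (op (w ((concatAssoc y u).equiv (idx _ ⟨i, m⟩)))))
    (fun i l a => (P ((u (idx y ⟨i, l⟩)).col a)).obj (op (w (idx u ⟨idx y ⟨i, l⟩, a⟩))))
    (fun k l => by rw [col_idx]) (fun m => by rw [← (concatAssoc y u).col_eq]) (fun i m => by rw [col_idx])
    (fun i l a => by rw [col_idx, concatAssoc_equiv]) (fun i l a => rfl)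
  simp only [arrSplit_eq, arrPull_eq, arrMap, map_eqToHom]
  refine h.trans ?_
  congr 3
  funext i
  exact (gsplit_map_eqToHom _ _ _ _).symm

end ColoredCollection

namespace ColoredOperad
open ColorSeq ColoredCollection
section
variable {X : Type w} {V : Type u} [Category.{v} V] [MonoidalCategory V] [SymmetricCategory V]
  (P : ColoredOperad X V)

lemma comp_eqToHom {c c' : X} (h : c = c') (u : ColorSeq X) (w : Fin u.len → ColorSeq X)
    (h₁ : (P.obj c).obj (op (concat w)) = (P.obj c').obj (op (concat w)))
    (h₂ : (P.obj c).obj (op u) ⊗ P.obj.arr u w = (P.obj c').obj (op u) ⊗ P.obj.arr u w) :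
    P.comp u w c ≫ eqToHom h₁ = eqToHom h₂ ≫ P.comp u w c' := by
  subst h
  simp

/-- Composition of families of operations. -/
noncomputable def arrComp (z : ColorSeq X) (u : Fin z.len → ColorSeq X)
    (w : Fin (concat u).len → ColorSeq X) :
    P.obj.arr z u ⊗ P.obj.arr (concat u) w ⟶ P.obj.arr z fun k => concat fun a => w (idx u ⟨k, a⟩) :=
  (_ ◁ P.obj.arrSplit u w) ≫ bigZip _ _ ≫
    bigMap fun k => P.comp (u k) (fun a => w (idx u ⟨k, a⟩)) (z.col k)

lemma arrComp_arrSplit {n : ℕ} (y : Fin n → ColorSeq X) (u : Fin (concat y).len → ColorSeq X)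
    (w : Fin (concat u).len → ColorSeq X) :
    P.arrComp (concat y) u w ≫ P.obj.arrSplit y _ =
      (P.obj.arrSplit y u ⊗ₘ P.obj.arrPull (concatAssoc y u) w ≫
        P.obj.arrSplit (fun i => concat fun l => u (idx y ⟨i, l⟩))
          (fun m => w ((concatAssoc y u).equiv m))) ≫ bigZip _ _ ≫
      bigMap fun i => P.arrComp (y i) (fun l => u (idx y ⟨i, l⟩))
          (fun m => w ((concatAssoc y u).equiv (idx _ ⟨i, m⟩))) ≫
        P.obj.arrMap (y i) fun l => concatMap fun a => eqToHom (concatAssoc_idx y u w i l a) := by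
  have e1 : ∀ i, P.arrComp (y i) (fun l => u (idx y ⟨i, l⟩))
        (fun m => w ((concatAssoc y u).equiv (idx _ ⟨i, m⟩))) ≫
      P.obj.arrMap (y i) (fun l => concatMap fun a => eqToHom (concatAssoc_idx y u w i l a)) =
      (_ ◁ (P.obj.arrSplit (fun l => u (idx y ⟨i, l⟩))
          (fun m => w ((concatAssoc y u).equiv (idx _ ⟨i, m⟩))) ≫
        bigMap fun l => P.obj.arrMap (u (idx y ⟨i, l⟩)) fun a =>
          eqToHom (concatAssoc_idx y u w i l a))) ≫ bigZip _ _ ≫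
        bigMap fun l => P.comp (u (idx y ⟨i, l⟩)) (fun a => w (idx u ⟨idx y ⟨i, l⟩, a⟩)) ((y i).col l) := by
    intro i
    have hz := bigZip_natural (fun l => 𝟙 ((P.obj ((y i).col l)).obj (op (u (idx y ⟨i, l⟩)))))
      (fun l => P.obj.arrMap (u (idx y ⟨i, l⟩)) fun a => eqToHom (concatAssoc_idx y u w i l a))
    simp only [bigMap_id, id_tensorHom] at hz
    rw [arrComp, arrMap, Category.assoc, Category.assoc, bigMap_comp, MonoidalCategory.whiskerLeft_comp,
      Category.assoc, reassoc_of% hz, bigMap_comp]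
    congr 3
    funext l
    exact (P.comp_map _ _ _).symm
  simp only [e1]
  have hz := bigZip_natural (fun i => 𝟙 (P.obj.arr (y i) fun l => u (idx y ⟨i, l⟩)))
      (fun i => P.obj.arrSplit (fun l => u (idx y ⟨i, l⟩))
          (fun m => w ((concatAssoc y u).equiv (idx _ ⟨i, m⟩))) ≫
        bigMap fun l => P.obj.arrMap (u (idx y ⟨i, l⟩)) fun a =>
          eqToHom (concatAssoc_idx y u w i l a))
  simp only [bigMap_id, id_tensorHom] at hz
  rw [← bigMap_comp, ← reassoc_of% hz, ← id_tensorHom, tensorHom_comp_tensorHom_assoc, Category.comp_id,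
    Category.assoc, ← arrSplit_gsplit, ← Category.id_comp (P.obj.arrSplit y u), ← tensorHom_comp_tensorHom_assoc,
    id_tensorHom, arrComp, Category.assoc, Category.assoc]
  congr 1
  have hg := gsplit_natural (idx y) (fun i l => by rw [col_idx]) (fun i l => by rw [col_idx])
    (fun k => P.comp (u k) (fun a => w (idx u ⟨k, a⟩)) ((concat y).col k))
    (fun i l => P.comp (u (idx y ⟨i, l⟩)) (fun a => w (idx u ⟨idx y ⟨i, l⟩, a⟩)) ((y i).col l))
    (fun i l => P.comp_eqToHom (col_idx y ⟨i, l⟩) _ _ _ _)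
  rw [arrSplit_eq, arrSplit_eq]
  refine (congrArg (fun t => _ ≫ t) hg).trans ?_
  rw [← reassoc_of% bigZip_gsplit, bigMap_comp]

end
end ColoredOperad

namespace ColorSeq
variable {X : Type w}

/-- The comparison of two bracketings of a double concatenation. -/
def blockHom {n : ℕ} (y : Fin n → ColorSeq X) (u : Fin (concat y).len → ColorSeq X)
    (w : Fin (concat u).len → ColorSeq X) (i : Fin n) :
    concat (fun l : Fin (y i).len => concat fun a => w (idx u ⟨idx y ⟨i, l⟩, a⟩)) ⟶
      concat fun m : Fin (concat fun l => u (idx y ⟨i, l⟩)).len =>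
        w ((concatAssoc y u).equiv (idx (fun i => concat fun l => u (idx y ⟨i, l⟩)) ⟨i, m⟩)) :=
  (concatMap fun l => concatMap fun a => eqToHom (concatAssoc_idx y u w i l a)) ≫
    concatAssoc (fun l => u (idx y ⟨i, l⟩)) fun m : Fin (concat fun l => u (idx y ⟨i, l⟩)).len =>
        w ((concatAssoc y u).equiv (idx (fun i => concat fun l => u (idx y ⟨i, l⟩)) ⟨i, m⟩))

lemma blockHom_concatAssoc {n : ℕ} (y : Fin n → ColorSeq X) (u : Fin (concat y).len → ColorSeq X)
    (w : Fin (concat u).len → ColorSeq X) :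
    concatMap (blockHom y u w) ≫ concatAssoc (fun i => concat fun l => u (idx y ⟨i, l⟩))
        (fun m => w ((concatAssoc y u).equiv m)) ≫ concatPush (concatAssoc y u).equiv w =
      concatAssoc y (fun j => concat fun a => w (idx u ⟨j, a⟩)) ≫ concatAssoc u w := by
  refine concat_concat_hom_ext fun i l b => ?_
  obtain ⟨⟨a, c⟩, rfl⟩ := (idx _).surjective b
  simp only [blockHom, comp_equiv, Equiv.trans_apply, concatMap_equiv, concatAssoc_equiv, concatPush_equiv]
  exact idx_eqToHom w (concatAssoc_equiv y u i l a).symm _ c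

lemma rev_blockHom {n : ℕ} (y : Fin n → ColorSeq X) (u : Fin (concat y).len → ColorSeq X)
    (w : Fin (concat u).len → ColorSeq X) {x : ColorSeq X} (τ : x ⟶ concat w) :
    (τ ≫ rev (concatAssoc u w)) ≫ rev (concatAssoc y fun j => concat fun a => w (idx u ⟨j, a⟩)) ≫
        concatMap (blockHom y u w) =
      (τ ≫ rev (concatPush (concatAssoc y u).equiv w)) ≫
        rev (concatAssoc (fun i => concat fun l => u (idx y ⟨i, l⟩))
          fun m => w ((concatAssoc y u).equiv m)) := by
  have h2 := congrArg rev (blockHom_concatAssoc y u w)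
  simp only [rev_comp, Category.assoc] at h2 ⊢
  have h3 := congrArg (· ≫ concatMap (blockHom y u w)) h2
  simp only [Category.assoc, rev_hom, Category.comp_id] at h3
  rw [h3]

end ColorSeq

namespace ColoredOperad
open ColorSeq ColoredCollection
section
variable {X : Type v} {V : Type u} [Category.{v} V] [MonoidalCategory V] [SymmetricCategory V]
  [MonoidalClosed V] [HasColimits V] (P : ColoredOperad X V)

lemma prop_ext_mid {x y : ColorSeq X} {A B C : V} {f g : (A ⊗ P.propObj x y) ⊗ B ⟶ C}
    (h : ∀ (z : Fin y.len → ColorSeq X) (σ : x ⟶ concat z),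
      ((A ◁ P.ι z σ) ▷ B) ≫ f = ((A ◁ P.ι z σ) ▷ B) ≫ g) : f = g := by
  rw [← cancel_epi (α_ _ _ _).inv]
  apply MonoidalClosed.curry_injective
  apply P.prop_ext_right
  intro z σ
  rw [← MonoidalClosed.curry_natural_left, ← MonoidalClosed.curry_natural_left,
    associator_inv_naturality_middle_assoc, associator_inv_naturality_middle_assoc, h]

lemma ι_compSpread (z : ColorSeq X) (u : Fin z.len → ColorSeq X) (x : ColorSeq X)
    (w : Fin (concat u).len → ColorSeq X) (τ : x ⟶ concat w) :
    (_ ◁ P.ι w τ) ≫ P.compSpread z u x =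
      P.arrComp z u w ≫ P.ι (fun k => concat fun a => w (idx u ⟨k, a⟩)) (τ ≫ rev (concatAssoc u w)) := by
  have h : ∀ k, (_ ◁ P.ι (fun a => w (idx u ⟨k, a⟩)) (𝟙 _)) ≫ P.act (u k) (z.col k) _ =
      P.comp (u k) (fun a => w (idx u ⟨k, a⟩)) (z.col k) := by
    intro k
    rw [ι_act, op_id, CategoryTheory.Functor.map_id, Category.comp_id]
  have h2 := P.ι_propPre (τ ≫ rev (concatAssoc u w)) z (fun k => concat fun a => w (idx u ⟨k, a⟩)) (𝟙 _)
  rw [Category.comp_id] at h2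
  refine (P.ι_spread _ _ _ _ _ _ _ _ _ _).trans ?_
  simp only [spreadAux, h]
  exact congrArg (fun t => P.arrComp z u w ≫ t) h2

lemma ι_ι_propComp (z : ColorSeq X) (u : Fin z.len → ColorSeq X) (x : ColorSeq X)
    (w : Fin (concat u).len → ColorSeq X) (τ : x ⟶ concat w) :
    (_ ◁ P.ι w τ) ≫ (P.ι u (𝟙 (concat u)) ▷ _) ≫ P.propComp x (concat u) z =
      P.arrComp z u w ≫ P.ι (fun k => concat fun a => w (idx u ⟨k, a⟩)) (τ ≫ rev (concatAssoc u w)) := by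
  rw [ι_propComp, rev_id, propPost_id, MonoidalCategory.whiskerLeft_id, Category.id_comp, ι_compSpread]

section
variable {n : ℕ} (y : Fin n → ColorSeq X) {A : Fin n → V} (B C : Fin n → (ColorSeq X)ᵒᵖ ⥤ V)
  (Q R : (ColorSeq X)ᵒᵖ ⥤ V) (a : ∀ i x, A i ⊗ P.propObj x (y i) ⟶ (B i).obj (op x))
  (q : ∀ w : Fin n → ColorSeq X, bigT (fun i => (B i).obj (op (w i))) ⟶ Q.obj (op (concat w)))
  (b : ∀ i x x', (B i).obj (op x) ⊗ P.propObj x' x ⟶ (C i).obj (op x'))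
  (a' : ∀ i x, A i ⊗ P.propObj x (y i) ⟶ (C i).obj (op x))
  (r : ∀ w : Fin n → ColorSeq X, bigT (fun i => (C i).obj (op (w i))) ⟶ R.obj (op (concat w)))
  (c : ∀ x x', Q.obj (op x) ⊗ P.propObj x' x ⟶ R.obj (op x'))
  (ha : ∀ i {x x' : ColorSeq X} (f : x ⟶ x'),
    (A i ◁ P.propPre f (y i)) ≫ a i x = a i x' ≫ (B i).map f.op)
  (hq : ∀ {w w' : Fin n → ColorSeq X} (τ : ∀ i, w i ⟶ w' i),
    (bigMap fun i => (B i).map (τ i).op) ≫ q w = q w' ≫ Q.map (concatMap τ).op)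
  (hb : ∀ i z {x x' : ColorSeq X} (f : x ⟶ x'),
    (_ ◁ P.propPre f z) ≫ b i z x = b i z x' ≫ (C i).map f.op)
  (ha' : ∀ i {x x' : ColorSeq X} (f : x ⟶ x'),
    (A i ◁ P.propPre f (y i)) ≫ a' i x = a' i x' ≫ (C i).map f.op)
  (hr : ∀ {w w' : Fin n → ColorSeq X} (τ : ∀ i, w i ⟶ w' i),
    (bigMap fun i => (C i).map (τ i).op) ≫ r w = r w' ≫ R.map (concatMap τ).op)
  (hc : ∀ {x x' : ColorSeq X} (f : x ⟶ x') (t : ColorSeq X),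
    (Q.map f.op ▷ _) ≫ c x t = (_ ◁ P.propPost t (rev f)) ≫ c x' t)
  (hab : ∀ i x x', (a i x ▷ _) ≫ b i x x' = (α_ _ _ _).hom ≫ (_ ◁ P.propComp x' x (y i)) ≫ a' i x')
  (hqc : ∀ (w : Fin n → ColorSeq X) (x : ColorSeq X),
    (q w ▷ _) ≫ c (concat w) x = P.spread w C R (fun i => b i (w i)) r (fun i => hb i (w i)) hr x)

include ha' hab in
lemma spreadAux_comp_apply (u : Fin (concat y).len → ColorSeq X) (w : Fin (concat u).len → ColorSeq X)
    (i : Fin n) :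
    (((A i ◁ P.ι (fun l => u (idx y ⟨i, l⟩)) (𝟙 _)) ≫ a i _) ▷
        P.obj.arr (concat fun l => u (idx y ⟨i, l⟩))
          (fun m => w ((concatAssoc y u).equiv (idx (fun i => concat fun l => u (idx y ⟨i, l⟩)) ⟨i, m⟩)))) ≫
      (_ ◁ P.ι _ (𝟙 _)) ≫ b i _ _ ≫ (C i).map (blockHom y u w i).op =
    (α_ _ _ _).hom ≫ (_ ◁ (P.arrComp (y i) (fun l => u (idx y ⟨i, l⟩))
          (fun m => w ((concatAssoc y u).equiv (idx _ ⟨i, m⟩))) ≫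
        P.obj.arrMap (y i) fun l => concatMap fun a => eqToHom (concatAssoc_idx y u w i l a))) ≫
      (_ ◁ P.ι _ (𝟙 _)) ≫ a' i _ := by
  have e := P.ι_ι_propComp (y i) (fun l => u (idx y ⟨i, l⟩)) _
    (fun m => w ((concatAssoc y u).equiv (idx (fun i => concat fun l => u (idx y ⟨i, l⟩)) ⟨i, m⟩))) (𝟙 _)
  have e' := congrArg (· ≫ P.propPre (blockHom y u w i) (y i)) e
  simp only [Category.assoc, ι_propPre, Category.id_comp] at e'
  rw [blockHom, Category.assoc, hom_rev, Category.comp_id, ← Category.id_comp (concatMap _), ← P.ι_map] at e'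
  rw [← whisker_exchange_assoc, comp_whiskerRight_assoc, reassoc_of% (hab i), ← ha',
    associator_naturality_middle_assoc, associator_naturality_right_assoc]
  congr 1
  have e2 := congrArg (fun t => (A i ◁ t) ≫ a' i _) e'
  simp only [MonoidalCategory.whiskerLeft_comp, Category.assoc] at e2 ⊢
  exact e2

include ha' hab in
lemma spreadAux_comp (u : Fin (concat y).len → ColorSeq X) (w : Fin (concat u).len → ColorSeq X) :
    (P.spreadAux y B a u ▷ _) ≫ (_ ◁ P.obj.arrPull (concatAssoc y u) w) ≫
        P.spreadAux (fun i => concat fun l => u (idx y ⟨i, l⟩)) C (fun i => b i _)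
          (fun m => w ((concatAssoc y u).equiv m)) ≫
        bigMap (fun i => (C i).map (blockHom y u w i).op) =
      (α_ _ _ _).hom ≫ (_ ◁ P.arrComp (concat y) u w) ≫
        P.spreadAux y C a' fun j => concat fun a => w (idx u ⟨j, a⟩) := by
  have h := bigZip_action (P.obj.arrSplit y u) (P.obj.arrPull (concatAssoc y u) w ≫
      P.obj.arrSplit (fun i => concat fun l => u (idx y ⟨i, l⟩)) (fun m => w ((concatAssoc y u).equiv m)))
    (fun i => (A i ◁ P.ι (fun l => u (idx y ⟨i, l⟩)) (𝟙 _)) ≫ a i _) _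
    (fun i => P.arrComp (y i) (fun l => u (idx y ⟨i, l⟩))
          (fun m => w ((concatAssoc y u).equiv (idx (fun i => concat fun l => u (idx y ⟨i, l⟩)) ⟨i, m⟩))) ≫
        P.obj.arrMap (y i) fun l => concatMap fun a => eqToHom (concatAssoc_idx y u w i l a))
    (fun i => (A i ◁ P.ι _ (𝟙 _)) ≫ a' i _) (P.spreadAux_comp_apply y B C a b a' ha' hab u w)
  rw [← P.arrComp_arrSplit] at h
  simp only [spreadAux, Category.assoc, bigMap_comp, MonoidalCategory.whiskerLeft_comp,
    comp_whiskerRight] at h ⊢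
  exact h

include ha ha' hq hr hc hab hqc in
/-- `spread` is compatible with composition in the PROP. -/
lemma spread_comp (x x' : ColorSeq X) :
    (P.spread y B Q a q ha hq x ▷ P.propObj x' x) ≫ c x x' =
      (α_ _ _ _).hom ≫ (_ ◁ P.propComp x' x (concat y)) ≫ P.spread y C R a' r ha' hr x' := by
  refine P.prop_ext_mid fun u σ => ?_
  have key : (P.spreadAux y B a u ▷ _) ≫ (_ ◁ P.propPost x' (concatAssoc y u)) ≫
      P.spread (fun i => concat fun l => u (idx y ⟨i, l⟩)) C R (fun i => b i _) r
        (fun i => hb i _) hr x' =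
      (α_ _ _ _).hom ≫ (_ ◁ P.compSpread (concat y) u x') ≫ P.spread y C R a' r ha' hr x' := by
    refine P.prop_ext_left fun w τ => ?_
    have h1 := P.spreadAux_comp y B C a b a' ha' hab u w
    rw [whisker_exchange_assoc, ← MonoidalCategory.whiskerLeft_comp_assoc, ι_propPost,
      MonoidalCategory.whiskerLeft_comp_assoc, ι_spread, ← rev_blockHom, associator_naturality_right_assoc,
      ← MonoidalCategory.whiskerLeft_comp_assoc, ι_compSpread, MonoidalCategory.whiskerLeft_comp_assoc,
      ι_spread, ← reassoc_of% h1, reassoc_of% hr, ← Functor.map_comp, ← op_comp]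
    simp only [Category.assoc]
  have hc' := hc (σ ≫ rev (concatAssoc y u)) x'
  rw [← comp_whiskerRight_assoc, ι_spread, comp_whiskerRight_assoc, comp_whiskerRight_assoc, hc',
    ← whisker_exchange_assoc, hqc, rev_comp, rev_rev, ← propPost_comp, MonoidalCategory.whiskerLeft_comp,
    Category.assoc, ← whisker_exchange_assoc, key, associator_naturality_middle_assoc,
    ← MonoidalCategory.whiskerLeft_comp_assoc, ι_propComp, associator_naturality_right_assoc,
    MonoidalCategory.whiskerLeft_comp_assoc]

end
end
end ColoredOperad

namespace ColorSeq
variable {X : Type w} {n : ℕ} (y : Fin n → ColorSeq X)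

lemma col_idx_single (i : Fin n) (l : Fin (y i).len) :
    single ((concat y).col (idx y ⟨i, l⟩)) = single ((y i).col l) := by
  rw [col_idx]

/-- A block of a concatenation as a concatenation of one-term sequences. -/
def blockSingles (i : Fin n) : concat (fun l => single ((concat y).col (idx y ⟨i, l⟩))) ⟶ y i :=
  (concatMap fun l => eqToHom (col_idx_single y i l)) ≫ concatSingles (y i)

lemma concatMap_blockSingles : concatMap (blockSingles y) =
    concatAssoc y (fun j => single ((concat y).col j)) ≫ concatSingles (concat y) := by
  refine concat_concat_hom_ext fun i l b => ?_
  simp only [blockSingles, comp_equiv, Equiv.trans_apply, concatMap_equiv, concatAssoc_equiv]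
  exact (congrArg (fun l => idx y ⟨i, l⟩) (concatSingles_equiv (y i) l _)).trans
    (concatSingles_equiv (concat y) _ b).symm

end ColorSeq

namespace ColoredOperad
open ColorSeq ColoredCollection
variable {X : Type v} {V : Type u} [Category.{v} V] [MonoidalCategory V] [SymmetricCategory V]
  [MonoidalClosed V] [HasColimits V] (P : ColoredOperad X V)

lemma act_dinatural' {u u' : ColorSeq X} (s : u' ⟶ u) (y : X) (x : ColorSeq X) :
    ((P.obj y).map s.op ▷ _) ≫ P.act u' y x = (_ ◁ P.propPost x (rev s)) ≫ P.act u y x := by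
  rw [← P.act_dinatural s, ← whisker_exchange_assoc, ← MonoidalCategory.whiskerLeft_comp_assoc,
    propPost_comp, hom_rev, propPost_id, MonoidalCategory.whiskerLeft_id, Category.id_comp]

lemma comp_act (u : ColorSeq X) (z : Fin u.len → ColorSeq X) (y : X) (x : ColorSeq X) :
    (P.comp u z y ▷ _) ≫ P.act (concat z) y x =
      (α_ _ _ _).hom ≫ (_ ◁ P.compSpread u z x) ≫ P.act u y x := by
  refine P.prop_ext_left fun w τ => ?_
  have h := P.assoc u z w y
  have h' := congrArg (· ≫ (P.obj y).map (τ ≫ rev (concatAssoc z w)).op) h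
  simp only [Category.assoc, ← Functor.map_comp, ← op_comp, rev_hom, Category.comp_id] at h'
  rw [whisker_exchange_assoc, ι_act, h', associator_naturality_right_assoc,
    ← MonoidalCategory.whiskerLeft_comp_assoc, ι_compSpread]
  have h2 := P.ι_act u y x _ (τ ≫ rev (concatAssoc z w))
  refine congrArg (fun t => (α_ _ _ _).hom ≫ t) ?_
  refine Eq.trans ?_ ((MonoidalCategory.whiskerLeft_comp_assoc _ _ _ _).symm)
  exact congrArg (fun t => _ ≫ t) h2.symm

/-- The action of `ℙ` is associative. -/
lemma act_act (u : ColorSeq X) (y : X) (x x' : ColorSeq X) :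
    (P.act u y x ▷ P.propObj x' x) ≫ P.act x y x' =
      (α_ _ _ _).hom ≫ (_ ◁ P.propComp x' x u) ≫ P.act u y x' := by
  refine P.prop_ext_mid fun z σ => ?_
  rw [← comp_whiskerRight_assoc, ι_act, comp_whiskerRight_assoc, act_dinatural',
    ← whisker_exchange_assoc, comp_act, associator_naturality_middle_assoc,
    ← MonoidalCategory.whiskerLeft_comp_assoc, ι_propComp, associator_naturality_right_assoc,
    MonoidalCategory.whiskerLeft_comp_assoc]

lemma compSpread_propComp (t : ColorSeq X) (u : Fin t.len → ColorSeq X) (x x' : ColorSeq X) :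
    (P.compSpread t u x ▷ P.propObj x' x) ≫ P.propComp x' x t =
      (α_ _ _ _).hom ≫ (_ ◁ P.propComp x' x (concat u)) ≫ P.compSpread t u x' :=
  P.spread_comp u (fun k => P.obj (t.col k)) (fun k => P.obj (t.col k)) (P.propPresheaf t)
    (P.propPresheaf t) (fun k => P.act (u k) (t.col k)) (P.gen t)
    (fun k x x' => P.act x (t.col k) x') (fun k => P.act (u k) (t.col k)) (P.gen t)
    (fun x x' => P.propComp x' x t) (fun i {_ _} f => P.act_natural _ _ f) (P.gen_natural t)
    (fun i z {_ _} f => P.act_natural _ _ f) (fun i {_ _} f => P.act_natural _ _ f) (P.gen_natural t)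
    (fun f s => P.propPre_propComp s f t) (fun i x x' => P.act_act _ _ _ _)
    (fun w x => by
      have := P.ι_propComp x _ t w (𝟙 (concat w))
      rw [rev_id, propPost_id, MonoidalCategory.whiskerLeft_id, Category.id_comp] at this
      exact this) x x'

/-- Composition in the PROP is associative. -/
lemma propComp_assoc (x y z t : ColorSeq X) :
    (P.propComp y z t ▷ P.propObj x y) ≫ P.propComp x y t =
      (α_ _ _ _).hom ≫ (_ ◁ P.propComp x y z) ≫ P.propComp x z t := by
  rw [← cancel_epi (α_ _ _ _).inv, Iso.inv_hom_id_assoc]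
  refine P.prop_ext_right fun u τ => ?_
  rw [associator_inv_naturality_left_assoc, ← comp_whiskerRight_assoc, ι_propComp, comp_whiskerRight_assoc,
    compSpread_propComp, associator_naturality_middle_assoc, Iso.inv_hom_id_assoc, ← whisker_exchange_assoc,
    ι_propComp, ← MonoidalCategory.whiskerLeft_comp_assoc, propPost_propComp,
    MonoidalCategory.whiskerLeft_comp_assoc]

section
variable {n : ℕ} (y : Fin n → ColorSeq X) {A : Fin n → V} (B : Fin n → (ColorSeq X)ᵒᵖ ⥤ V)
  (Q : (ColorSeq X)ᵒᵖ ⥤ V) (a : ∀ i x, A i ⊗ P.propObj x (y i) ⟶ (B i).obj (op x))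
  (q : ∀ w : Fin n → ColorSeq X, bigT (fun i => (B i).obj (op (w i))) ⟶ Q.obj (op (concat w)))
  (ha : ∀ i {x x' : ColorSeq X} (f : x ⟶ x'),
    (A i ◁ P.propPre f (y i)) ≫ a i x = a i x' ≫ (B i).map f.op)
  (hq : ∀ {w w' : Fin n → ColorSeq X} (τ : ∀ i, w i ⟶ w' i),
    (bigMap fun i => (B i).map (τ i).op) ≫ q w = q w' ≫ Q.map (concatMap τ).op)

lemma one_eqToHom {c c' : X} (h : c = c')
    (h' : (P.obj c).obj (op (single c)) = (P.obj c').obj (op (single c))) :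
    P.one c ≫ eqToHom h' = P.one c' ≫ (P.obj c').map (eqToHom (congrArg single h)).op := by
  subst h
  simp

lemma bigOne_arrSplit : bigOne (fun j => P.one ((concat y).col j)) ≫
    P.obj.arrSplit y (fun j => single ((concat y).col j)) =
    bigOne fun i => bigOne (fun l => P.one ((y i).col l)) ≫
      P.obj.arrMap (y i) fun l => eqToHom (col_idx_single y i l) := by
  rw [arrSplit_eq, bigOne_gsplit]
  congr 1
  funext i
  rw [arrMap, bigOne_map]
  congr 1
  funext l
  exact P.one_eqToHom (col_idx y ⟨i, l⟩) _

/-- `spread` at the identity of the PROP. -/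
lemma propId_spread :
    (bigT A ◁ P.propId (concat y)) ≫ P.spread y B Q a q ha hq (concat y) =
      (ρ_ _).hom ≫ (bigMap fun i => (ρ_ (A i)).inv ≫ (A i ◁ P.propId (y i)) ≫ a i (y i)) ≫ q y := by
  have h1 : ∀ i, (A i ◁ (bigOne (fun l => P.one ((y i).col l)) ≫
      P.obj.arrMap (y i) fun l => eqToHom (col_idx_single y i l))) ≫ (A i ◁ P.ι _ (𝟙 _)) ≫ a i _ =
      (A i ◁ P.propId (y i)) ≫ a i (y i) ≫ (B i).map (blockSingles y i).op := by
    intro i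
    rw [← ha, propId, ← MonoidalCategory.whiskerLeft_comp_assoc, ← MonoidalCategory.whiskerLeft_comp_assoc,
      Category.assoc, Category.assoc, P.ι_map, ι_propPre, Category.id_comp, blockSingles, Category.assoc, hom_rev,
      Category.comp_id]
  rw [propId, MonoidalCategory.whiskerLeft_comp_assoc, ι_spread, spreadAux, Category.assoc, Category.assoc,
    ← MonoidalCategory.whiskerLeft_comp_assoc, bigOne_arrSplit, reassoc_of% bigZip_bigOne, reassoc_of% bigMap_comp]
  simp only [Category.assoc, h1]
  have h2 : (bigMap fun i => (ρ_ (A i)).inv ≫ (A i ◁ P.propId (y i)) ≫ a i (y i) ≫ (B i).map (blockSingles y i).op) =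
      (bigMap fun i => (ρ_ (A i)).inv ≫ (A i ◁ P.propId (y i)) ≫ a i (y i)) ≫
        bigMap fun i => (B i).map (blockSingles y i).op := by
    simp only [bigMap_comp, Category.assoc]
  have h3 : (rev (concatSingles (concat y)) ≫ rev (concatAssoc y fun j => single ((concat y).col j))) ≫
      concatMap (blockSingles y) = 𝟙 _ := by
    rw [concatMap_blockSingles, Category.assoc, rev_hom_assoc, rev_hom]
  rw [h2, Category.assoc, reassoc_of% hq, ← Functor.map_comp, ← op_comp, h3, op_id,
    CategoryTheory.Functor.map_id, Category.comp_id]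
end

lemma _root_.ColorSeq.concatOne_equiv (z : Fin 1 → ColorSeq X) (a : Fin (z 0).len) :
    (concatOne z).equiv (idx z ⟨0, a⟩) = a :=
  ofIdx_equiv z (Equiv.uniqueSigma (fun i => Fin (z i).len)) _ ⟨0, a⟩

lemma act_propId (u : ColorSeq X) (y : X) :
    (_ ◁ P.propId u) ≫ P.act u y u = (ρ_ _).hom := by
  rw [propId, MonoidalCategory.whiskerLeft_comp_assoc, ι_act]
  have := P.comp_one u y
  rw [reassoc_of% this, ← Functor.map_comp, ← op_comp, rev_hom, op_id, CategoryTheory.Functor.map_id,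
    Category.comp_id]

/-- Identities in the PROP are right units. -/
lemma propComp_propId (x z : ColorSeq X) :
    (_ ◁ P.propId x) ≫ P.propComp x x z = (ρ_ _).hom := by
  refine (cancel_epi (ρ_ _).inv).1 (P.prop_ext fun u τ => ?_)
  have h := P.propId_spread u (fun k => P.obj (z.col k)) (P.propPresheaf z)
    (fun k => P.act (u k) (z.col k)) (P.gen z) (fun i {_ _} f => P.act_natural _ _ f) (P.gen_natural z)
  have h' : (_ ◁ P.propId (concat u)) ≫ P.compSpread z u (concat u) =
      (ρ_ _).hom ≫ P.ι u (𝟙 (concat u)) := by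
    refine h.trans ?_
    simp only [act_propId, Iso.inv_hom_id, bigMap_id]
    exact congrArg (fun t => _ ≫ t) (Category.id_comp _)
  rw [rightUnitor_inv_naturality_assoc, ← whisker_exchange_assoc, ι_propComp, Iso.inv_hom_id,
    Category.comp_id, ← MonoidalCategory.whiskerLeft_comp_assoc, ← propId_dinatural,
    MonoidalCategory.whiskerLeft_comp_assoc, compSpread_natural, reassoc_of% h', Iso.inv_hom_id_assoc,
    ι_propPre, Category.comp_id]

/-- The position in a one-term sequence. -/
def _root_.ColorSeq.head (c : X) : Fin (single c).len := (0 : Fin 1)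

lemma _root_.ColorSeq.eq_head {c : X} (a : Fin (single c).len) : a = head c :=
  Subsingleton.elim (α := Fin 1) a _

/-- The concatenation of a family indexed by a one-term sequence. -/
def _root_.ColorSeq.concatHead {c : X} (w : Fin (single c).len → ColorSeq X) : concat w ⟶ w (head c) :=
  concatOne w

lemma _root_.ColorSeq.concatHead_equiv {c : X} (w : Fin (single c).len → ColorSeq X)
    (a : Fin (w (head c)).len) : (concatHead w).equiv (idx w ⟨head c, a⟩) = a :=
  concatOne_equiv w a

/-- The family indexed by a one-term sequence. -/
noncomputable def arrHead {c : X} (w : Fin (single c).len → ColorSeq X) :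
    P.obj.arr (single c) w ⟶ (P.obj c).obj (op (w (head c))) := (ρ_ ((P.obj c).obj (op (w (head c))))).hom

lemma one_comp_head {c : X} (w : Fin (single c).len → ColorSeq X) :
    ((λ_ (P.obj.arr (single c) w)).inv ≫ P.one c ▷ _) ≫ P.comp (single c) w c =
      P.arrHead w ≫ (P.obj c).map (concatHead w).op := by
  rw [Category.assoc]
  exact (congrArg (fun t => _ ≫ t) (P.one_comp w c)).trans
    (Iso.inv_hom_id_assoc (λ_ ((P.obj c).obj (op (w (head c))) ⊗ 𝟙_ V)) _)

lemma arrPull_arrSplit_singles (z : ColorSeq X) (u : Fin z.len → ColorSeq X) :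
    P.obj.arrPull (concatSingles z) u ≫
      P.obj.arrSplit (fun k => single (z.col k)) (fun m => u ((concatSingles z).equiv m)) ≫
      (bigMap fun k => P.arrHead fun a => u ((concatSingles z).equiv (idx (fun k => single (z.col k)) ⟨k, a⟩))) =
    P.obj.arrMap z fun k => eqToHom (congrArg u (concatSingles_equiv z k (head _))) := by
  rw [arrPull_eq, arrSplit_eq, arrMap]
  simp only [map_eqToHom]
  exact gpull_gsplit_one (concatSingles z).equiv (idx fun k => single (z.col k))
    (fun i j => concatSingles_equiv z i j) _ _
    (fun i j => (P.obj (z.col i)).obj (op (u ((concatSingles z).equiv (idx (fun k => single (z.col k)) ⟨i, j⟩)))))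
    _ _

lemma _root_.ColorSeq.concatHead_concatMap (z : ColorSeq X) (u : Fin z.len → ColorSeq X) :
    (concatMap fun k => (concatHead fun a => u ((concatSingles z).equiv (idx (fun k => single (z.col k)) ⟨k, a⟩))) ≫
      eqToHom (congrArg u (concatSingles_equiv z k (head _)))) =
    concatAssoc (fun k => single (z.col k)) (fun m => u ((concatSingles z).equiv m)) ≫
      concatPush (concatSingles z).equiv u := by
  refine concat_concat_hom_ext fun i l a => ?_
  obtain rfl := eq_head l
  simp only [comp_equiv, Equiv.trans_apply, concatMap_equiv, concatAssoc_equiv, concatPush_equiv,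
    concatHead_equiv]
  exact idx_eqToHom u (concatSingles_equiv z i (head _)) _ a

/-- Identities in the PROP are left units. -/
lemma propId_propComp (x z : ColorSeq X) :
    (P.propId z ▷ _) ≫ P.propComp x z z = (λ_ _).hom := by
  refine P.prop_ext_left fun u τ => ?_
  have h1 := bigOne_bigZip (fun k => P.obj.arr (single (z.col k)) fun a =>
    u ((concatSingles z).equiv (idx (fun k => single (z.col k)) ⟨k, a⟩))) (fun k => P.one (z.col k))
  have h3 : (bigOne (fun k => P.one (z.col k)) ▷ _) ≫ P.arrComp z (fun k => single (z.col k))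
      (fun m => u ((concatSingles z).equiv m)) =
      (λ_ _).hom ≫ P.obj.arrSplit (fun k => single (z.col k)) (fun m => u ((concatSingles z).equiv m)) ≫
        (bigMap fun k => P.arrHead fun a =>
          u ((concatSingles z).equiv (idx (fun k => single (z.col k)) ⟨k, a⟩))) ≫
        P.obj.arrMap z fun k => concatHead fun a =>
          u ((concatSingles z).equiv (idx (fun k => single (z.col k)) ⟨k, a⟩)) := by
    rw [arrComp, ← whisker_exchange_assoc, reassoc_of% h1, bigMap_comp, leftUnitor_naturality_assoc,
      arrMap, bigMap_comp]
    simp only [one_comp_head]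
  have h4 : ((τ ≫ rev (concatPush (concatSingles z).equiv u)) ≫
      rev (concatAssoc (fun k => single (z.col k)) fun m => u ((concatSingles z).equiv m))) ≫
      (concatMap fun k => concatHead fun a =>
          u ((concatSingles z).equiv (idx (fun k => single (z.col k)) ⟨k, a⟩))) ≫
      (concatMap fun k => eqToHom (congrArg u (concatSingles_equiv z k (head _)))) = τ := by
    rw [concatMap_comp, concatHead_concatMap, Category.assoc, rev_hom_assoc, Category.assoc, rev_hom,
      Category.comp_id]
  have h5 := P.arrPull_arrSplit_singles z u
  rw [propId, comp_whiskerRight_assoc, ι_propComp, rev_rev, ← whisker_exchange_assoc,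
    ← MonoidalCategory.whiskerLeft_comp_assoc, ι_propPost, MonoidalCategory.whiskerLeft_comp_assoc,
    whisker_exchange_assoc, ι_compSpread, reassoc_of% h3, leftUnitor_naturality, leftUnitor_naturality_assoc,
    P.ι_map, reassoc_of% h5, P.ι_map, Category.assoc, h4]

end ColoredOperad

lemma braiding_hexagon {V : Type u} [Category.{v} V] [MonoidalCategory V] [SymmetricCategory V] (A B C : V) :
    ((β_ A B).hom ▷ C) ≫ (β_ (B ⊗ A) C).hom ≫ (α_ C B A).inv ≫ ((β_ C B).hom ▷ A) =
      (α_ A B C).hom ≫ (β_ A (B ⊗ C)).hom := by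
  have h1 := BraidedCategory.hexagon_reverse B A C
  have h2 := BraidedCategory.hexagon_forward A B C
  rw [Iso.inv_comp_eq] at h1
  rw [← Category.assoc, ← Iso.eq_comp_inv] at h2
  rw [reassoc_of% h1, h2, ← comp_whiskerRight, SymmetricCategory.symmetry, id_whiskerRight, Category.comp_id]
  simp only [Category.assoc]

namespace ColoredOperad
open ColorSeq ColoredCollection
variable {X : Type v} {V : Type u} [Category.{v} V] [MonoidalCategory V] [SymmetricCategory V]
  [MonoidalClosed V] [HasLimits V] [HasColimits V] (P : ColoredOperad X V)

lemma ev_ext {N : (ColorSeq X)ᵒᵖ ⥤ V} {y : ColorSeq X} {A : V} {f g : A ⟶ P.hatObj N y}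
    (h : ∀ x, (f ▷ _) ≫ Mult.ev P N y x = (g ▷ _) ≫ Mult.ev P N y x) : f = g :=
  P.hat_ext fun x => by
    have := h x
    rw [Mult.ev, BraidedCategory.braiding_naturality_left_assoc,
      BraidedCategory.braiding_naturality_left_assoc, cancel_epi] at this
    exact this

/-- The evaluation maps for a double application of `hat`. -/
noncomputable def evHat (N : (ColorSeq X)ᵒᵖ ⥤ V) (y x : ColorSeq X) :
    P.hatObj (P.hat.obj N) y ⊗ P.propObj x y ⟶ P.hatObj N x := Mult.ev P (P.hat.obj N) y x

lemma evHat_ext {N : (ColorSeq X)ᵒᵖ ⥤ V} {y : ColorSeq X} {A : V} {f g : A ⟶ P.hatObj (P.hat.obj N) y}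
    (h : ∀ x, (f ▷ _) ≫ P.evHat N y x = (g ▷ _) ≫ P.evHat N y x) : f = g := P.ev_ext h

/-- The action of the PROP on `hat`. -/
noncomputable def hatAct (N : (ColorSeq X)ᵒᵖ ⥤ V) (y x : ColorSeq X) :
    P.hatObj N y ⊗ P.propObj x y ⟶ P.hatObj N x := (β_ _ _).hom ≫ P.hatComulInner N y x

lemma hatAct_ev (N : (ColorSeq X)ᵒᵖ ⥤ V) (y x x' : ColorSeq X) :
    (P.hatAct N y x ▷ _) ≫ Mult.ev P N x x' = (α_ _ _ _).hom ≫ (_ ◁ P.propComp x' x y) ≫ Mult.ev P N y x' := by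
  rw [hatAct, Mult.ev, Mult.ev, BraidedCategory.braiding_naturality_left_assoc,
    BraidedCategory.braiding_naturality_right_assoc, MonoidalCategory.whiskerLeft_comp_assoc,
    hatComulInner_hatEv, comp_whiskerRight_assoc]
  have h := braiding_hexagon (P.hatObj N y) (P.propObj x y) (P.propObj x' x)
  rw [← BraidedCategory.braiding_naturality_left_assoc, reassoc_of% h]

lemma hatAct_natural (N : (ColorSeq X)ᵒᵖ ⥤ V) (y : ColorSeq X) {x x' : ColorSeq X} (f : x ⟶ x') :
    (_ ◁ P.propPre f y) ≫ P.hatAct N y x = P.hatAct N y x' ≫ P.hatMapObj N f := by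
  rw [hatAct, hatAct, BraidedCategory.braiding_naturality_right_assoc, hatComulInner_natural,
    Category.assoc]

lemma hatComulApp_ev (N : (ColorSeq X)ᵒᵖ ⥤ V) (y x : ColorSeq X) :
    (P.hatComulApp N y ▷ _) ≫ P.evHat N y x = P.hatAct N y x := by
  change (P.hatComulApp N y ▷ _) ≫ (β_ _ _).hom ≫ P.hatEv₂ N y x = _
  rw [BraidedCategory.braiding_naturality_left_assoc, hatComulApp_hatEv, hatAct]

lemma hatMap_evHat {N : (ColorSeq X)ᵒᵖ ⥤ V} {M : (ColorSeq X)ᵒᵖ ⥤ V} (g : M ⟶ P.hat.obj N) (y x : ColorSeq X) :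
    (P.hatMap g y ▷ _) ≫ P.evHat N y x = Mult.ev P M y x ≫ g.app (op x) := Mult.hatMap_ev P g y x

lemma hatMap_ev_of_hat {N : (ColorSeq X)ᵒᵖ ⥤ V} {M : (ColorSeq X)ᵒᵖ ⥤ V} (g : P.hat.obj N ⟶ M) (y x : ColorSeq X) :
    (P.hatMap g y ▷ _) ≫ Mult.ev P M y x = P.evHat N y x ≫ g.app (op x) := Mult.hatMap_ev P g y x

lemma hatCounit_app_app (N : (ColorSeq X)ᵒᵖ ⥤ V) (y : ColorSeq X) :
    (P.hatCounit.app N).app (op y) = (ρ_ _).inv ≫ (_ ◁ P.propId y) ≫ Mult.ev P N y y := by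
  change (λ_ _).inv ≫ P.propId y ▷ _ ≫ P.hatEv N y y = _
  rw [Mult.ev, BraidedCategory.braiding_naturality_right_assoc]
  simp

lemma hatAct_propId (N : (ColorSeq X)ᵒᵖ ⥤ V) (y : ColorSeq X) :
    (ρ_ _).inv ≫ (_ ◁ P.propId y) ≫ P.hatAct N y y = 𝟙 _ := by
  refine P.ev_ext fun x => ?_
  rw [comp_whiskerRight_assoc, comp_whiskerRight_assoc, hatAct_ev, associator_naturality_middle_assoc,
    ← MonoidalCategory.whiskerLeft_comp_assoc, propId_propComp]
  simp

lemma hatAct_counit (N : (ColorSeq X)ᵒᵖ ⥤ V) (y x : ColorSeq X) :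
    P.hatAct N y x ≫ (ρ_ _).inv ≫ (_ ◁ P.propId x) ≫ Mult.ev P N x x = Mult.ev P N y x := by
  rw [rightUnitor_inv_naturality_assoc, ← whisker_exchange_assoc, hatAct_ev,
    associator_naturality_right_assoc, ← MonoidalCategory.whiskerLeft_comp_assoc, propComp_propId]
  simp

lemma hatAct_hatAct (N : (ColorSeq X)ᵒᵖ ⥤ V) (y x x' : ColorSeq X) :
    (P.hatAct N y x ▷ _) ≫ P.hatAct N x x' = (α_ _ _ _).hom ≫ (_ ◁ P.propComp x' x y) ≫ P.hatAct N y x' := by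
  refine P.ev_ext fun x'' => ?_
  rw [comp_whiskerRight_assoc, hatAct_ev, associator_naturality_left_assoc, ← whisker_exchange_assoc,
    hatAct_ev, comp_whiskerRight_assoc, comp_whiskerRight_assoc, hatAct_ev,
    associator_naturality_middle_assoc, ← MonoidalCategory.whiskerLeft_comp_assoc, propComp_assoc]
  simp

lemma hatComul_counit (N : (ColorSeq X)ᵒᵖ ⥤ V) :
    P.hatComul.app N ≫ P.hatCounit.app (P.hat.obj N) = 𝟙 _ := by
  refine NatTrans.ext (funext fun y => ?_)
  obtain ⟨y⟩ := y
  have h := P.hatCounit_app_app (P.hat.obj N) y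
  refine (congrArg (fun t => P.hatComulApp N y ≫ t) h).trans ?_
  refine Eq.trans ?_ (P.hatAct_propId N y)
  rw [rightUnitor_inv_naturality_assoc, ← whisker_exchange_assoc]
  exact congrArg (fun t => _ ≫ _ ≫ t) (P.hatComulApp_ev N y y)

lemma hatComul_map_counit (N : (ColorSeq X)ᵒᵖ ⥤ V) :
    P.hatComul.app N ≫ P.hat.map (P.hatCounit.app N) = 𝟙 _ := by
  refine NatTrans.ext (funext fun y => ?_)
  obtain ⟨y⟩ := y
  change P.hatComulApp N y ≫ P.hatMap (P.hatCounit.app N) y = 𝟙 _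
  refine P.ev_ext fun x => ?_
  rw [comp_whiskerRight_assoc]
  have h := (P.hatMap_ev_of_hat (P.hatCounit.app N) y x).trans
    (congrArg (fun t => P.evHat N y x ≫ t) (P.hatCounit_app_app N x))
  refine (congrArg (fun t => _ ≫ t) h).trans ?_
  rw [reassoc_of% hatComulApp_ev]
  refine (P.hatAct_counit N y x).trans ?_
  rw [id_whiskerRight]
  exact (Category.id_comp _).symm

lemma hatComul_comul (N : (ColorSeq X)ᵒᵖ ⥤ V) :
    P.hatComul.app N ≫ P.hatComul.app (P.hat.obj N) = P.hatComul.app N ≫ P.hat.map (P.hatComul.app N) := by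
  refine NatTrans.ext (funext fun y => ?_)
  obtain ⟨y⟩ := y
  change P.hatComulApp N y ≫ P.hatComulApp (P.hat.obj N) y = P.hatComulApp N y ≫ P.hatMap (P.hatComul.app N) y
  refine P.evHat_ext fun x => ?_
  rw [comp_whiskerRight_assoc, comp_whiskerRight_assoc, hatComulApp_ev]
  have h := P.hatMap_evHat (P.hatComul.app N) y x
  refine Eq.trans ?_ (congrArg (fun t => _ ≫ t) h).symm
  change _ = _ ≫ P.evHat N y x ≫ P.hatComulApp N x
  rw [reassoc_of% hatComulApp_ev]
  refine P.evHat_ext fun x' => ?_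
  rw [comp_whiskerRight_assoc, comp_whiskerRight_assoc, hatComulApp_ev, hatAct_hatAct]
  have h2 := P.hatAct_ev (P.hat.obj N) y x x'
  refine (congrArg (fun t => _ ≫ t) h2).trans ?_
  rw [associator_naturality_left_assoc, ← whisker_exchange_assoc]
  exact congrArg (fun t => _ ≫ _ ≫ t) (P.hatComulApp_ev N y x')

end ColoredOperad

section
variable {V : Type u} [Category.{v} V] [MonoidalCategory V] [SymmetricCategory V]
variable {κ : Type} [Enum κ]
open TensTree

/-- The tensor product of a one-term family. -/
def oneHom (A : Fin 1 → V) : bigT A ⟶ A 0 := (ρ_ (A 0)).hom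

lemma bigMap_one {A B : Fin 1 → V} (f : ∀ i, A i ⟶ B i) :
    bigMap f ≫ oneHom B = oneHom A ≫ f 0 := by
  change (f 0 ⊗ₘ 𝟙 (𝟙_ V)) ≫ (ρ_ (B 0)).hom = _
  rw [tensorHom_id, rightUnitor_naturality]
  rfl

lemma bigZip_one (A B : Fin 1 → V) :
    bigZip A B ≫ oneHom _ = oneHom A ⊗ₘ oneHom B := by
  let C : Fin 1 ⊕ Fin 1 → V := Sum.elim A B
  have h1 := IsStr.tensZip (A := C) (Enum.list : List (Fin 1)) (fun i => leaf (.inl i))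
    (fun i => leaf (.inr i))
  have h2 := IsStr.rightUnit (A := C) (node (leaf (.inl 0)) (leaf (.inr 0)))
  have h3 := (IsStr.rightUnit (A := C) (leaf (.inl 0))).node (IsStr.rightUnit (A := C) (leaf (.inr 0)))
  refine IsStr.unique (A := C) (s := node (big Enum.list fun i => leaf (.inl i))
    (big Enum.list fun i => leaf (.inr i))) ?_ (h1.comp h2) h3
  simp only [flat, flat_foldr_cons, List.append_nil]
  exact (Enum.nodup.map Sum.inl_injective).append (Enum.nodup.map Sum.inr_injective) (by
    intro x h1 h2
    obtain ⟨_, _, rfl⟩ := List.mem_map.1 h1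
    simp at h2)

lemma gsplit_one {J : Fin 1 → Type} [∀ i, Enum (J i)] (e : (Σ i, J i) ≃ κ) (e' : J 0 ≃ κ)
    (he : ∀ j, e ⟨0, j⟩ = e' j) (F : κ → V) (G : ∀ i, J i → V) (h : ∀ i j, F (e ⟨i, j⟩) = G i j) :
    gsplit e F G h ≫ oneHom (fun i => bigT (G i)) = gpull e' F (G 0) fun j => by rw [← h, he] := by
  obtain rfl : G = fun i j => F (e ⟨i, j⟩) := funext₂ fun i j => (h i j).symm
  have h1 := IsStr.gsplit (A := F) e leaf (fun i j => leaf (e ⟨i, j⟩)) fun _ _ => rfl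
  have h2 := IsStr.rightUnit (A := F) (big Enum.list fun j => leaf (e ⟨0, j⟩))
  have h3 := IsStr.gpull (A := F) e' leaf (fun j => leaf (e ⟨0, j⟩)) fun j => congrArg leaf (he j).symm
  exact IsStr.unique (s := big Enum.list leaf) (by simpa using Enum.nodup) (h1.comp h2) h3

end

namespace Mult
open ColorSeq
section
variable {X : Type w} {V : Type u} [Category.{v} V] [MonoidalCategory V] [SymmetricCategory V]
variable {N N' N'' : (ColorSeq X)ᵒᵖ ⥤ V}

/-- Compatibility with the multiplications. -/
def IsHom (M : Mult N) (M' : Mult N') (g : N ⟶ N') : Prop :=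
  ∀ {n : ℕ} (z : Fin n → ColorSeq X), M.mu z ≫ g.app _ = (bigMap fun i => g.app _) ≫ M'.mu z

lemma IsHom.comp {M : Mult N} {M' : Mult N'} {M'' : Mult N''} {g : N ⟶ N'} {g' : N' ⟶ N''}
    (h : IsHom M M' g) (h' : IsHom M' M'' g') : IsHom M M'' (g ≫ g') := fun {n} z => by
  have e : (bigMap fun i => (g ≫ g').app (op (z i))) =
    (bigMap fun i => g.app (op (z i))) ≫ bigMap fun i => g'.app (op (z i)) := (bigMap_comp _ _).symm
  rw [e, NatTrans.comp_app, reassoc_of% (h z), h' z, Category.assoc]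

lemma IsHom.id (M : Mult N) : IsHom M M (𝟙 N) := fun {n} z => by
  have e : (bigMap fun i => (𝟙 N : N ⟶ N).app (op (z i))) = 𝟙 _ := bigMap_id _
  rw [e, Category.id_comp]
  exact Category.comp_id _

/-- Unitality of the multiplication. -/
def Unital (M : Mult N) : Prop :=
  ∀ z : Fin 1 → ColorSeq X, M.mu z = oneHom (fun i => N.obj (op (z i))) ≫ N.map (concatOne z).op

/-- Associativity of the multiplication. -/
def Assoc (M : Mult N) : Prop :=
  ∀ {n : ℕ} (y : Fin n → ColorSeq X) (z : Fin (concat y).len → ColorSeq X),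
    M.mu z ≫ N.map (concatAssoc y z).op =
      gsplit (idx y) (fun j => N.obj (op (z j))) (fun i l => N.obj (op (z (idx y ⟨i, l⟩)))) (fun _ _ => rfl) ≫
      (bigMap fun i => M.mu fun l => z (idx y ⟨i, l⟩)) ≫ M.mu fun i => concat fun l => z (idx y ⟨i, l⟩)

lemma ofPow_unital (C : X → V) : (ofPow C).Unital := fun z => by
  change powJoin C z = oneHom (fun i => pow C (z i)) ≫ powPull C (concatOne z)
  have h : powSplit C z ≫ oneHom (fun i => pow C (z i)) = powPull C (rev (concatOne z)) :=
    gsplit_one (idx z) (rev (concatOne z)).equiv (fun j => by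
      rw [rev_equiv, Equiv.eq_symm_apply, concatOne_equiv]) (fun i => C ((concat z).col i))
      (fun i l => C ((z i).col l)) (fun i l => congrArg C (col_idx z ⟨i, l⟩))
  rw [← cancel_epi (powSplit C z), powJoin, IsIso.hom_inv_id, reassoc_of% h, ← powPull_comp, hom_rev, powPull_id]

lemma ofPow_assoc (C : X → V) : (ofPow C).Assoc := fun {n} y z => by
  change powJoin C z ≫ powPull C (concatAssoc y z) = gsplit (idx y) (fun j => pow C (z j))
    (fun i l => pow C (z (idx y ⟨i, l⟩))) (fun _ _ => rfl) ≫
      (bigMap fun i => powJoin C fun l => z (idx y ⟨i, l⟩)) ≫ powJoin C fun i => concat fun l => z (idx y ⟨i, l⟩)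
  have h := gsplit_gsplit (V := V) (idx y) (idx z) (concatAssoc y z).equiv
    (idx fun i => concat fun l => z (idx y ⟨i, l⟩)) (fun i => idx fun l => z (idx y ⟨i, l⟩))
    (concatAssoc_equiv y z) (fun j => C ((concat z).col j))
    (fun k a => C ((z k).col a)) (fun m => C ((concat fun i => concat fun l => z (idx y ⟨i, l⟩)).col m))
    (fun i m => C ((concat fun l => z (idx y ⟨i, l⟩)).col m))
    (fun i l a => C ((z (idx y ⟨i, l⟩)).col a))
    (fun k l => by rw [col_idx]) (fun m => by rw [← (concatAssoc y z).col_eq]) (fun i m => by rw [col_idx])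
    (fun i l a => by rw [col_idx]) (fun i l a => rfl)
  have h' : powSplit C z ≫ gsplit (idx y) (fun j => pow C (z j)) (fun i l => pow C (z (idx y ⟨i, l⟩)))
      (fun _ _ => rfl) = powPull C (concatAssoc y z) ≫ powSplit C (fun i => concat fun l => z (idx y ⟨i, l⟩)) ≫
      bigMap fun i => powSplit C fun l => z (idx y ⟨i, l⟩) := h
  have h2 : (bigMap fun i => powSplit C fun l => z (idx y ⟨i, l⟩)) ≫
      (bigMap fun i => powJoin C fun l => z (idx y ⟨i, l⟩)) = 𝟙 _ := by
    rw [bigMap_comp]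
    simp only [powJoin, IsIso.hom_inv_id, bigMap_id]
  rw [powJoin, IsIso.inv_comp_eq, reassoc_of% h', reassoc_of% h2, powJoin, IsIso.hom_inv_id, Category.comp_id]

end
end Mult

namespace Mult
open ColorSeq ColoredOperad
variable {X : Type v} {V : Type u} [Category.{v} V] [MonoidalCategory V] [SymmetricCategory V]
  [MonoidalClosed V] [HasLimits V] [HasColimits V] (P : ColoredOperad X V)
variable {N N' : (ColorSeq X)ᵒᵖ ⥤ V}

lemma IsHom.hatMap {M : Mult N} {M' : Mult N'} {g : N ⟶ N'} (h : IsHom M M' g) :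
    IsHom (M.hat P) (M'.hat P) (P.hat.map g) := fun z => M.hatMu_hatMap P M' g h z

lemma hatMu_ev (M : Mult N) {n : ℕ} (z : Fin n → ColorSeq X) (x : ColorSeq X) :
    (M.hatMu P z ▷ _) ≫ ev P N (concat z) x = M.hatSpread P z x := by
  rw [ev, BraidedCategory.braiding_naturality_left_assoc, hatMu_hatEv, SymmetricCategory.symmetry_assoc]

/-- The counit is multiplicative. -/
lemma isHom_hatCounit (M : Mult N) : IsHom (M.hat P) M (P.hatCounit.app N) := fun {n} z => by
  have h := P.propId_spread (A := fun i => P.hatObj N (z i)) z (fun _ => N) N (fun i x => ev P N (z i) x) M.mu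
    (fun i {_ _} f => ev_natural P N (z i) f) M.natural
  have e : (bigMap fun i => (P.hatCounit.app N).app (op (z i))) =
      bigMap fun i => (ρ_ (P.hatObj N (z i))).inv ≫ (_ ◁ P.propId (z i)) ≫ ev P N (z i) (z i) :=
    congrArg bigMap (funext fun i => P.hatCounit_app_app N (z i))
  rw [e]
  refine (congrArg (fun t => M.hatMu P z ≫ t) (P.hatCounit_app_app N (concat z))).trans ?_
  rw [rightUnitor_inv_naturality_assoc, ← whisker_exchange_assoc, hatMu_ev]
  refine (congrArg (fun t => _ ≫ t) h).trans ?_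
  rw [Iso.inv_hom_id_assoc]
  rfl

/-- The comultiplication is multiplicative. -/
lemma isHom_hatComul (M : Mult N) : IsHom (M.hat P) ((M.hat P).hat P) (P.hatComul.app N) := fun {n} z => by
  change M.hatMu P z ≫ P.hatComulApp N (concat z) =
    (bigMap fun i => P.hatComulApp N (z i)) ≫ (M.hat P).hatMu P z
  refine P.evHat_ext fun x => ?_
  have h1 : ((M.hat P).hatMu P z ▷ _) ≫ P.evHat N (concat z) x = (M.hat P).hatSpread P z x :=
    (M.hat P).hatMu_ev P z x
  have h2 := P.spread_map z (A := fun i => P.hatObj N (z i)) (A' := fun i => P.hatObj (P.hat.obj N) (z i))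
    (fun _ => P.hat.obj N) (P.hat.obj N) (fun i x => P.hatAct N (z i) x) (M.hat P).mu
    (fun i {_ _} f => P.hatAct_natural N (z i) f) (M.hat P).natural
    (B' := fun _ => P.hat.obj N) (fun i x => ev P (P.hat.obj N) (z i) x) (M.hat P).mu
    (fun i {_ _} f => ev_natural P (P.hat.obj N) (z i) f) (M.hat P).natural
    (fun i => P.hatComulApp N (z i)) (fun i => 𝟙 _)
    (fun i x => (P.hatComulApp_ev N (z i) x).trans (Category.comp_id _).symm)
    (fun w => ((congrArg (· ≫ _) (bigMap_id _)).trans (Category.id_comp _)).symm) x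
  rw [comp_whiskerRight_assoc, comp_whiskerRight_assoc, hatComulApp_ev, h1]
  refine Eq.trans ?_ h2.symm
  refine P.ev_ext fun x' => ?_
  have h3 := P.spread_comp z (A := fun i => P.hatObj N (z i)) (fun _ => P.hat.obj N) (fun _ => N)
    (P.hat.obj N) N (fun i x => P.hatAct N (z i) x) (M.hat P).mu (fun i x x' => ev P N x x')
    (fun i x => ev P N (z i) x) M.mu (fun x x' => ev P N x x')
    (fun i {_ _} f => P.hatAct_natural N (z i) f) (M.hat P).natural
    (fun i y {_ _} f => ev_natural P N y f) (fun i {_ _} f => ev_natural P N (z i) f) M.natural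
    (fun f t => ev_dinatural P N f t) (fun i x x' => P.hatAct_ev N (z i) x x')
    (fun w x => M.hatMu_ev P w x) x x'
  refine Eq.trans ?_ h3.symm
  rw [comp_whiskerRight_assoc, hatAct_ev, associator_naturality_left_assoc, ← whisker_exchange_assoc,
    hatMu_ev]
  rfl

end Mult

namespace ColoredOperad
open ColorSeq ColoredCollection
variable {X : Type v} {V : Type u} [Category.{v} V] [MonoidalCategory V] [SymmetricCategory V]
  [MonoidalClosed V] [HasColimits V] (P : ColoredOperad X V)
variable {N : (ColorSeq X)ᵒᵖ ⥤ V} (M : Mult N)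

/-- `spread` for a one-term family. -/
lemma spread_one (hM : M.Unital) (y : Fin 1 → ColorSeq X) {A : Fin 1 → V}
    (a : ∀ i x, A i ⊗ P.propObj x (y i) ⟶ N.obj (op x))
    (ha : ∀ i {x x' : ColorSeq X} (f : x ⟶ x'), (A i ◁ P.propPre f (y i)) ≫ a i x = a i x' ≫ N.map f.op)
    (x : ColorSeq X) :
    P.spread y (fun _ => N) N a M.mu ha M.natural x =
      (oneHom A ⊗ₘ P.propPost x (rev (concatOne y))) ≫ a 0 x := by
  refine P.prop_ext_left fun w σ => ?_
  have e (l : Fin (y 0).len) : idx y ⟨0, l⟩ = (rev (concatOne y)).equiv l := by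
    rw [rev_equiv, Equiv.eq_symm_apply, concatOne_equiv]
  have h1 : P.obj.arrSplit y w ≫ oneHom (fun i => P.obj.arr (y i) fun l => w (idx y ⟨i, l⟩)) =
      P.obj.arrPull (rev (concatOne y)) w ≫ P.obj.arrMap (y 0) fun l => eqToHom (congrArg w (e l)) := by
    rw [arrSplit_eq, arrPull_eq, arrMap]
    simp only [map_eqToHom]
    refine (gsplit_one (idx y) (rev (concatOne y)).equiv e _ _ _).trans ?_
    rw [gpull, gpull, Category.assoc, bigMap_comp]
    simp only [eqToHom_trans]
  have h2 : concatOne (fun i => concat fun l => w (idx y ⟨i, l⟩)) ≫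
      (concatMap fun l => eqToHom (congrArg w (e l))) ≫ concatPush (rev (concatOne y)).equiv w =
      concatAssoc y w := by
    refine concat_concat_hom_ext fun i l b => ?_
    obtain rfl := Subsingleton.elim 0 i
    simp only [comp_equiv, Equiv.trans_apply, concatMap_equiv, concatAssoc_equiv, concatPush_equiv,
      concatOne_equiv]
    exact idx_eqToHom w (e l) _ b
  have h3 : (σ ≫ rev (concatAssoc y w)) ≫ concatOne (fun i => concat fun l => w (idx y ⟨i, l⟩)) ≫
      (concatMap fun l => eqToHom (congrArg w (e l))) = σ ≫ rev (concatPush (rev (concatOne y)).equiv w) := by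
    rw [← h2]
    simp only [rev_comp, Category.assoc]
    simp
  have h4 := bigZip_one A fun i => P.obj.arr (y i) fun l => w (idx y ⟨i, l⟩)
  have h5 := bigMap_one fun i => (A i ◁ P.ι (fun l => w (idx y ⟨i, l⟩)) (𝟙 _)) ≫ a i _
  rw [ι_spread, spreadAux, hM]
  simp only [Category.assoc]
  rw [reassoc_of% h5, reassoc_of% h4, ← Functor.map_comp, ← op_comp, ← ha,
    ← MonoidalCategory.whiskerLeft_comp_assoc, ι_propPre, Category.comp_id, ← id_tensorHom, ← id_tensorHom,
    ← id_tensorHom, tensorHom_comp_tensorHom_assoc, tensorHom_comp_tensorHom_assoc,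
    tensorHom_comp_tensorHom_assoc, Category.id_comp, Category.comp_id, h1, Category.assoc, P.ι_map,
    Category.assoc, h3, ι_propPost]

omit [SymmetricCategory V] [MonoidalClosed V] [HasColimits V] in
lemma tensorHom_comp_whiskerLeft {A A' B B' B'' : V} (f : A ⟶ A') (g : B ⟶ B') (h : B' ⟶ B'') :
    (f ⊗ₘ g) ≫ (A' ◁ h) = f ⊗ₘ (g ≫ h) := by
  rw [← id_tensorHom, tensorHom_comp_tensorHom, Category.comp_id]

/-- Iterated `spread`. -/
lemma spread_gsplit (hM : M.Assoc) {n : ℕ} (y : Fin n → ColorSeq X) (z : Fin (concat y).len → ColorSeq X)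
    {A : Fin (concat y).len → V} (a : ∀ j x, A j ⊗ P.propObj x (z j) ⟶ N.obj (op x))
    (ha : ∀ j {x x' : ColorSeq X} (f : x ⟶ x'), (A j ◁ P.propPre f (z j)) ≫ a j x = a j x' ≫ N.map f.op)
    (x : ColorSeq X) :
    P.spread z (fun _ => N) N a M.mu ha M.natural x =
      (gsplit (idx y) A (fun i l => A (idx y ⟨i, l⟩)) (fun _ _ => rfl) ⊗ₘ P.propPost x (concatAssoc y z)) ≫
        P.spread (A := fun i => bigT fun l => A (idx y ⟨i, l⟩)) (fun i => concat fun l => z (idx y ⟨i, l⟩))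
          (fun _ => N) N
          (fun i x => P.spread (fun l => z (idx y ⟨i, l⟩)) (fun _ => N) N (fun l x => a (idx y ⟨i, l⟩) x) M.mu
            (fun l {_ _} f => ha (idx y ⟨i, l⟩) f) M.natural x)
          M.mu (fun i {_ _} f => P.spread_natural _ _ _ _ _ _ _ f) M.natural x := by
  refine P.prop_ext_left fun w σ => ?_
  have h1 : ∀ i, (_ ◁ P.ι (fun m => w ((concatAssoc y z).equiv
        (idx (fun i => concat fun l => z (idx y ⟨i, l⟩)) ⟨i, m⟩))) (𝟙 _)) ≫
      P.spread (fun l => z (idx y ⟨i, l⟩)) (fun _ => N) N (fun l x => a (idx y ⟨i, l⟩) x) M.mu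
            (fun l {_ _} f => ha (idx y ⟨i, l⟩) f) M.natural _ ≫ N.map (blockHom y z w i).op =
      (_ ◁ (P.obj.arrSplit (fun l => z (idx y ⟨i, l⟩))
          (fun m => w ((concatAssoc y z).equiv (idx _ ⟨i, m⟩))) ≫
        bigMap fun l => P.obj.arrMap (z (idx y ⟨i, l⟩)) fun a => eqToHom (concatAssoc_idx y z w i l a))) ≫
      bigZip _ _ ≫ (bigMap fun l => (_ ◁ P.ι (fun a => w (idx z ⟨idx y ⟨i, l⟩, a⟩)) (𝟙 _)) ≫ a (idx y ⟨i, l⟩) _) ≫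
      M.mu fun l => concat fun a => w (idx z ⟨idx y ⟨i, l⟩, a⟩) := by
    intro i
    have hz := bigZip_natural (fun l => 𝟙 (A (idx y ⟨i, l⟩)))
      (fun l => P.obj.arrMap (z (idx y ⟨i, l⟩)) fun a => eqToHom (concatAssoc_idx y z w i l a))
    simp only [bigMap_id, id_tensorHom] at hz
    have hn := M.natural fun l : Fin (y i).len => concatMap fun a : Fin (z (idx y ⟨i, l⟩)).len =>
      eqToHom (concatAssoc_idx y z w i l a)
    rw [blockHom, op_comp, N.map_comp, MonoidalCategory.whiskerLeft_comp_assoc, reassoc_of% hz,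
      reassoc_of% bigMap_comp]
    have e : ∀ l, (A (idx y ⟨i, l⟩) ◁ P.obj.arrMap (z (idx y ⟨i, l⟩))
          fun a => eqToHom (concatAssoc_idx y z w i l a)) ≫
        (_ ◁ P.ι (fun a => w (idx z ⟨idx y ⟨i, l⟩, a⟩)) (𝟙 _)) ≫ a (idx y ⟨i, l⟩) _ =
        ((_ ◁ P.ι (fun a => w ((concatAssoc y z).equiv (idx (fun i => concat fun l => z (idx y ⟨i, l⟩))
          ⟨i, idx (fun l => z (idx y ⟨i, l⟩)) ⟨l, a⟩⟩))) (𝟙 _)) ≫ a (idx y ⟨i, l⟩) _) ≫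
        N.map (concatMap fun a => eqToHom (concatAssoc_idx y z w i l a)).op := by
      intro l
      rw [Category.assoc, ← ha, ← MonoidalCategory.whiskerLeft_comp_assoc,
        ← MonoidalCategory.whiskerLeft_comp_assoc, P.ι_map, ι_propPre, Category.id_comp, Category.comp_id]
    simp only [e]
    rw [← bigMap_comp, Category.assoc, hn]
    have hs := P.ι_spread (fun l => z (idx y ⟨i, l⟩)) (fun _ => N) N (fun l x => a (idx y ⟨i, l⟩) x) M.mu
      (fun l {_ _} f => ha (idx y ⟨i, l⟩) f) M.natural _
      (fun m => w ((concatAssoc y z).equiv (idx (fun i => concat fun l => z (idx y ⟨i, l⟩)) ⟨i, m⟩))) (𝟙 _)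
    rw [reassoc_of% hs, ← N.map_comp_assoc, ← op_comp, hom_rev, op_id, N.map_id,
      Category.id_comp, spreadAux, Category.assoc, Category.assoc]
  have h2 : M.mu (fun j => concat fun b => w (idx z ⟨j, b⟩)) ≫ N.map (σ ≫ rev (concatAssoc z w)).op =
      gsplit (idx y) (fun j => N.obj (op (concat fun b => w (idx z ⟨j, b⟩))))
        (fun i l => N.obj (op (concat fun b => w (idx z ⟨idx y ⟨i, l⟩, b⟩)))) (fun _ _ => rfl) ≫
      (bigMap fun i => M.mu fun l => concat fun b => w (idx z ⟨idx y ⟨i, l⟩, b⟩)) ≫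
      M.mu (fun i => concat fun l => concat fun b => w (idx z ⟨idx y ⟨i, l⟩, b⟩)) ≫
      N.map ((σ ≫ rev (concatAssoc z w)) ≫ rev (concatAssoc y _)).op := by
    have h := hM y fun j => concat fun b => w (idx z ⟨j, b⟩)
    rw [← reassoc_of% h, ← N.map_comp, ← op_comp, Category.assoc, rev_hom, Category.comp_id]
  have h3 := gsplit_natural (idx y) (fun _ _ => rfl) (fun _ _ => rfl)
    (fun j => (A j ◁ P.ι (fun b => w (idx z ⟨j, b⟩)) (𝟙 _)) ≫ a j _)
    (fun i l => (A (idx y ⟨i, l⟩) ◁ P.ι (fun b => w (idx z ⟨idx y ⟨i, l⟩, b⟩)) (𝟙 _)) ≫ a (idx y ⟨i, l⟩) _)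
    (fun i l => (Category.comp_id _).trans (Category.id_comp _).symm)
  have h4 := bigZip_gsplit (idx y) A (fun j => P.obj.arr (z j) fun b => w (idx z ⟨j, b⟩))
    (fun i l => A (idx y ⟨i, l⟩)) (fun i l => P.obj.arr (z (idx y ⟨i, l⟩)) fun b => w (idx z ⟨idx y ⟨i, l⟩, b⟩))
    (fun _ _ => rfl) (fun _ _ => rfl)
  have hz := bigZip_natural (fun i => 𝟙 (bigT fun l => A (idx y ⟨i, l⟩)))
    (fun i => P.obj.arrSplit (fun l => z (idx y ⟨i, l⟩))
          (fun m => w ((concatAssoc y z).equiv (idx _ ⟨i, m⟩))) ≫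
        bigMap fun l => P.obj.arrMap (z (idx y ⟨i, l⟩)) fun a => eqToHom (concatAssoc_idx y z w i l a))
  simp only [bigMap_id, id_tensorHom] at hz
  have hn := M.natural (blockHom y z w)
  have hr : N.map ((σ ≫ rev (concatPush (concatAssoc y z).equiv w)) ≫
        rev (concatAssoc (fun i => concat fun l => z (idx y ⟨i, l⟩)) fun m => w ((concatAssoc y z).equiv m))).op =
      N.map (concatMap (blockHom y z w)).op ≫
        N.map ((σ ≫ rev (concatAssoc z w)) ≫ rev (concatAssoc y fun j => concat fun b => w (idx z ⟨j, b⟩))).op := by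
    rw [← N.map_comp, ← op_comp, ← rev_blockHom]
    simp only [Category.assoc]
  rw [ι_spread, spreadAux, Category.assoc, Category.assoc, h2, reassoc_of% h3, ← reassoc_of% h4,
    ← id_tensorHom, ← id_tensorHom, tensorHom_comp_tensorHom_assoc, tensorHom_comp_tensorHom_assoc, ι_propPost,
    P.obj.arrSplit_gsplit, Category.id_comp, ← reassoc_of% tensorHom_comp_whiskerLeft,
    ← reassoc_of% tensorHom_comp_whiskerLeft, ι_spread, hr, ← reassoc_of% hn, spreadAux, MonoidalCategory.whiskerLeft_comp_assoc, reassoc_of% hz,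
    reassoc_of% bigMap_comp, reassoc_of% bigMap_comp, reassoc_of% bigMap_comp]
  simp only [Category.assoc]
  rw [reassoc_of% bigMap_comp]
  simp only [Category.assoc, h1]

end ColoredOperad

namespace Mult
open ColorSeq ColoredOperad
section
variable {X : Type v} {V : Type u} [Category.{v} V] [MonoidalCategory V] [SymmetricCategory V]
  [MonoidalClosed V] [HasLimits V] [HasColimits V] (P : ColoredOperad X V)
variable {N : (ColorSeq X)ᵒᵖ ⥤ V} {M : Mult N}

lemma Unital.hat (hM : M.Unital) : (M.hat P).Unital := fun z => by
  change M.hatMu P z = oneHom (fun i => P.hatObj N (z i)) ≫ P.hatMapObj N (concatOne z)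
  refine P.ev_ext fun x => ?_
  rw [hatMu_ev, comp_whiskerRight_assoc, ev_dinatural]
  refine (P.spread_one M hM z (A := fun i => P.hatObj N (z i)) (fun i x => ev P N (z i) x)
    (fun i {_ _} f => ev_natural P N (z i) f) x).trans ?_
  rw [MonoidalCategory.tensorHom_def_assoc]

lemma Assoc.hat (hM : M.Assoc) : (M.hat P).Assoc := fun {n} y z => by
  change M.hatMu P z ≫ P.hatMapObj N (concatAssoc y z) =
    gsplit (idx y) (fun j => P.hatObj N (z j)) (fun i l => P.hatObj N (z (idx y ⟨i, l⟩))) (fun _ _ => rfl) ≫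
      (bigMap fun i => M.hatMu P fun l => z (idx y ⟨i, l⟩)) ≫ M.hatMu P fun i => concat fun l => z (idx y ⟨i, l⟩)
  refine P.ev_ext fun x => ?_
  have h1 := P.spread_gsplit M hM y z (A := fun j => P.hatObj N (z j)) (fun j x => ev P N (z j) x)
    (fun j {_ _} f => ev_natural P N (z j) f) x
  have h2 := P.spread_map (fun i => concat fun l => z (idx y ⟨i, l⟩))
    (A := fun i => bigT fun l => P.hatObj N (z (idx y ⟨i, l⟩)))
    (A' := fun i => P.hatObj N (concat fun l => z (idx y ⟨i, l⟩))) (fun _ => N) N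
    (fun i x => M.hatSpread P (fun l => z (idx y ⟨i, l⟩)) x) M.mu
    (fun i {_ _} f => M.hatSpread_natural P _ f) M.natural (B' := fun _ => N)
    (fun i x => ev P N _ x) M.mu (fun i {_ _} f => ev_natural P N _ f) M.natural
    (fun i => M.hatMu P fun l => z (idx y ⟨i, l⟩)) (fun i => 𝟙 _)
    (fun i x => (M.hatMu_ev P _ x).trans (Category.comp_id _).symm)
    (fun w => ((congrArg (· ≫ _) (bigMap_id _)).trans (Category.id_comp _)).symm) x
  have h3 : ((bigMap fun i => M.hatMu P fun l => z (idx y ⟨i, l⟩)) ▷ _) ≫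
      M.hatSpread P (fun i => concat fun l => z (idx y ⟨i, l⟩)) x = _ := h2
  rw [comp_whiskerRight_assoc, comp_whiskerRight_assoc, comp_whiskerRight_assoc, ev_dinatural,
    ← whisker_exchange_assoc, hatMu_ev, hatMu_ev, h3]
  refine (congrArg (fun t => _ ≫ t) h1).trans ?_
  rw [MonoidalCategory.tensorHom_def'_assoc, ← MonoidalCategory.whiskerLeft_comp_assoc, P.propPost_comp,
    hom_rev, P.propPost_id, MonoidalCategory.whiskerLeft_id, Category.id_comp]
  rfl

end

section
variable {X : Type w} {V : Type u} [Category.{v} V] [MonoidalCategory V] [SymmetricCategory V]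
variable {N N' : (ColorSeq X)ᵒᵖ ⥤ V}

lemma IsHom.ofSingles {M : Mult N} {M' : Mult N'} {g : N ⟶ N'} (h : IsHom M M' g) :
    (eps X V).map ((ev₁ X V).map g) ≫ M'.ofSingles = M.ofSingles ≫ g :=
  NatTrans.ext (funext fun x => M.ofSinglesApp_map M' g (fun z => h z) x.unop)

/-- The morphism of `ofSingles` is multiplicative. -/
lemma isHom_ofSingles {M : Mult N} (hM : M.Assoc) :
    IsHom (ofPow ((ev₁ X V).obj N)) M M.ofSingles := fun {n} z => by
  change powJoin ((ev₁ X V).obj N) z ≫ M.ofSinglesApp (concat z) =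
    (bigMap (A := fun i => pow ((ev₁ X V).obj N) (z i)) fun i => M.ofSinglesApp (z i)) ≫ M.mu z
  have he : ∀ {x x' : ColorSeq X} (h : x = x'), N.map (rev (eqToHom h)).op = eqToHom (by rw [h]) := by
    rintro x _ rfl
    exact N.map_id _
  have h1 : powSplit ((ev₁ X V).obj N) z = gsplit (idx z) (fun j => N.obj (op (single ((concat z).col j))))
        (fun i l => N.obj (op (single ((concat z).col (idx z ⟨i, l⟩))))) (fun _ _ => rfl) ≫
      bigMap fun i => bigMap fun l => N.map (rev (eqToHom (col_idx_single z i l))).op := by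
    simp only [he]
    exact (gsplit_map_eqToHom (J := fun i => Fin (z i).len) (idx z)
      (fun j => N.obj (op (single ((concat z).col j)))) (fun _ _ => rfl)
      fun i l => congrArg (fun s => N.obj (op s)) (col_idx_single z i l)).symm
  have h2 : ∀ i, (bigMap fun l => N.map (rev (eqToHom (col_idx_single z i l))).op) ≫ M.ofSinglesApp (z i) =
      M.mu (fun l => single ((concat z).col (idx z ⟨i, l⟩))) ≫ N.map (rev (blockSingles z i)).op := by
    intro i
    have h := M.natural fun l => rev (eqToHom (col_idx_single z i l))
    rw [ofSinglesApp, reassoc_of% h, ← N.map_comp, ← op_comp, blockSingles, rev_comp, rev_concatMap]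
  have h3 := hM z fun j => single ((concat z).col j)
  have h4 := M.natural fun i => rev (blockSingles z i)
  have h5 : (gsplit (idx z) (fun j => N.obj (op (single ((concat z).col j))))
        (fun i l => N.obj (op (single ((concat z).col (idx z ⟨i, l⟩))))) (fun _ _ => rfl) ≫
      bigMap fun i => bigMap fun l => N.map (rev (eqToHom (col_idx_single z i l))).op) ≫
      (bigMap fun i => M.ofSinglesApp (z i)) ≫ M.mu z = M.ofSinglesApp (concat z) := by
    rw [Category.assoc, reassoc_of% bigMap_comp]
    simp only [h2]
    rw [← bigMap_comp, Category.assoc, h4, ← reassoc_of% h3, ← N.map_comp, ← op_comp, ← rev_concatMap,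
      concatMap_blockSingles, rev_comp, Category.assoc, rev_hom, Category.comp_id, ofSinglesApp]
  exact (IsIso.inv_comp_eq (powSplit ((ev₁ X V).obj N) z)).2 (h5.symm.trans (congrArg (· ≫ _) h1.symm))

end
end Mult

/-- A code for a monotone map from an ordinal with `m` elements to an ordinal with `n` elements: `skip`
says that `0` is not in the image, `hit` that the first element is sent to `0`. -/
inductive MonoCode : ℕ → ℕ → Type
  | nil : MonoCode 0 0
  | skip {m n : ℕ} : MonoCode m n → MonoCode m (n + 1)
  | hit {m n : ℕ} : MonoCode m (n + 1) → MonoCode (m + 1) (n + 1)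

namespace MonoCode

/-- The values of the map with a given code. -/
def val : ∀ {m n : ℕ}, MonoCode m n → ℕ → ℕ
  | _, _, nil, _ => 0
  | _, _, skip c, i => c.val i + 1
  | _, _, hit _, 0 => 0
  | _, _, hit c, i + 1 => c.val i

lemma eq_of_val : ∀ {m n : ℕ} (c d : MonoCode m n), (∀ i < m, c.val i = d.val i) → c = d
  | _, _, nil, nil, _ => rfl
  | _, _, skip c, skip d, h => congrArg skip (eq_of_val c d fun i hi => Nat.succ_injective (h i hi))
  | _, _, hit c, hit d, h => congrArg hit (eq_of_val c d fun i hi => h (i + 1) (Nat.succ_lt_succ hi))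
  | _, _, skip c, hit d, h => absurd (h 0 (Nat.succ_pos _)) (Nat.succ_ne_zero _)
  | _, _, hit c, skip d, h => absurd (h 0 (Nat.succ_pos _)).symm (Nat.succ_ne_zero _)

lemma exists_val : ∀ (m n : ℕ) (f : ℕ → ℕ), (∀ i < m, f i < n) → (∀ i j, i ≤ j → j < m → f i ≤ f j) →
    ∃ c : MonoCode m n, ∀ i < m, c.val i = f i
  | 0, 0, _, _, _ => ⟨nil, fun i hi => absurd hi (Nat.not_lt_zero i)⟩
  | m + 1, 0, _, h, _ => absurd (h 0 (Nat.succ_pos _)) (Nat.not_lt_zero _)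
  | 0, n + 1, f, _, _ => by
    obtain ⟨c, _⟩ := exists_val 0 n f (fun i hi => absurd hi (Nat.not_lt_zero i))
      (fun i j _ hj => absurd hj (Nat.not_lt_zero j))
    exact ⟨skip c, fun i hi => absurd hi (Nat.not_lt_zero i)⟩
  | m + 1, n + 1, f, h, h' => by
    by_cases h0 : f 0 = 0
    · obtain ⟨c, hc⟩ := exists_val m (n + 1) (fun i => f (i + 1)) (fun i hi => h _ (by omega))
        (fun i j hij hj => h' _ _ (by omega) (by omega))
      refine ⟨hit c, fun i hi => ?_⟩
      cases i with
      | zero => exact h0.symm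
      | succ i => exact hc i (by omega)
    · have hpos : ∀ i < m + 1, 0 < f i := fun i hi =>
        lt_of_lt_of_le (Nat.pos_of_ne_zero h0) (h' 0 i (Nat.zero_le _) hi)
      obtain ⟨c, hc⟩ := exists_val (m + 1) n (fun i => f i - 1)
        (fun i hi => by have := h i hi; have := hpos i hi; omega)
        (fun i j hij hj => Nat.sub_le_sub_right (h' i j hij hj) 1)
      refine ⟨skip c, fun i hi => ?_⟩
      change c.val i + 1 = f i
      have := hc i hi
      have := hpos i hi
      omega
termination_by m n => m + n

end MonoCode

namespace ColoredOperad
open ColorSeq ColoredCollection AugmentedSimplexCategory MonoCode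
variable {X : Type v} {V : Type u} [Category.{v} V] [MonoidalCategory V] [SymmetricCategory V]
  [MonoidalClosed V] [HasLimits V] [HasColimits V] (P : ColoredOperad X V)

lemma face_zero (n : ℕ) : P.face n 0 = Functor.whiskerLeft (P.iter n) P.hatCounit := by
  cases n <;> rfl

lemma degen_zero (n : ℕ) : P.degen n 0 = Functor.whiskerLeft (P.iter n) P.hatComul := by
  cases n <;> rfl

/-- The image of a map of iterates of `hat` under `hat`. -/
noncomputable def iterMap {m n : ℕ} (t : P.iter n ⟶ P.iter m) : P.iter (n + 1) ⟶ P.iter (m + 1) :=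
  Functor.whiskerRight t P.hat

/-- The map of iterates of `hat` given by a monotone map. -/
noncomputable def interp : ∀ {m n : ℕ}, MonoCode m n → (P.iter n ⟶ P.iter m)
  | _, _, nil => 𝟙 _
  | _, n + 1, skip c => Functor.whiskerLeft (P.iter n) P.hatCounit ≫ interp c
  | _, n + 1, hit c => Functor.whiskerLeft (P.iter n) P.hatComul ≫ P.iterMap (interp c)

lemma isHom_interp (C : X → V) {m n : ℕ} (c : MonoCode m n) :
    Mult.IsHom (P.iterMult C n) (P.iterMult C m) ((P.interp c).app ((eps X V).obj C)) := by
  induction c with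
  | nil => exact Mult.IsHom.id _
  | skip c ih => exact Mult.IsHom.comp (Mult.isHom_hatCounit P _) ih
  | hit c ih => exact Mult.IsHom.comp (Mult.isHom_hatComul P _) (Mult.IsHom.hatMap P ih)

/-- `t` is the map of iterates of `hat` given by the monotone map with values `f`. -/
def IsInterp {m n : ℕ} (f : ℕ → ℕ) (t : P.iter n ⟶ P.iter m) : Prop :=
  ∃ c : MonoCode m n, P.interp c = t ∧ ∀ i < m, c.val i = f i

variable {P}

lemma IsInterp.isHom {m n : ℕ} {f : ℕ → ℕ} {t : P.iter n ⟶ P.iter m} (h : P.IsInterp f t) (C : X → V) :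
    Mult.IsHom (P.iterMult C n) (P.iterMult C m) (t.app ((eps X V).obj C)) := by
  obtain ⟨c, rfl, _⟩ := h
  exact P.isHom_interp C c

lemma IsInterp.unique {m n : ℕ} {f g : ℕ → ℕ} {t s : P.iter n ⟶ P.iter m} (ht : P.IsInterp f t)
    (hs : P.IsInterp g s) (h : ∀ i < m, f i = g i) : t = s := by
  obtain ⟨c, rfl, hc⟩ := ht
  obtain ⟨d, rfl, hd⟩ := hs
  rw [eq_of_val c d fun i hi => (hc i hi).trans ((h i hi).trans (hd i hi).symm)]

lemma IsInterp.congr {m n : ℕ} {f g : ℕ → ℕ} {t : P.iter n ⟶ P.iter m} (ht : P.IsInterp f t)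
    (h : ∀ i < m, f i = g i) : P.IsInterp g t := by
  obtain ⟨c, hc, hc'⟩ := ht
  exact ⟨c, hc, fun i hi => (hc' i hi).trans (h i hi)⟩

variable (P)

lemma hatComul_map_counit_comp {N N' N'' : (ColorSeq X)ᵒᵖ ⥤ V} (d : P.hat.obj N ⟶ N') (c : N' ⟶ N'') :
    d ≫ c = (P.hatComul.app N ≫ P.hat.map d) ≫ P.hatCounit.app N' ≫ c := by
  have h1 := P.hatCounit.naturality d
  have h2 := P.hatComul_counit N
  have h3 : P.hatComul.app N ≫ P.hat.map d ≫ P.hatCounit.app N' = d :=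
    (congrArg (fun t => _ ≫ t) h1).trans ((Category.assoc _ _ _).symm.trans
      ((congrArg (fun t => t ≫ d) h2).trans (Category.id_comp _)))
  rw [Category.assoc, ← Category.assoc (P.hat.map d), ← Category.assoc, h3]

lemma hatComul_map_comul_comp {N N' N'' : (ColorSeq X)ᵒᵖ ⥤ V} (d : P.hat.obj N ⟶ N')
    (c : P.hat.obj N' ⟶ N'') :
    P.hatComul.app N ≫ P.hat.map ((P.hatComul.app N ≫ P.hat.map d) ≫ c) =
      (P.hatComul.app N ≫ P.hat.map d) ≫ P.hatComul.app N' ≫ P.hat.map c := by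
  have h1 : P.hat.map d ≫ P.hatComul.app N' = P.hatComul.app (P.hat.obj N) ≫ P.hat.map (P.hat.map d) :=
    P.hatComul.naturality d
  have h2 : P.hatComul.app N ≫ P.hat.map (P.hatComul.app N ≫ P.hat.map d) =
      P.hatComul.app N ≫ P.hatComul.app (P.hat.obj N) ≫ P.hat.map (P.hat.map d) := by
    rw [Functor.map_comp]
    exact (Category.assoc _ _ _).symm.trans
      ((congrArg (fun t => t ≫ _) (P.hatComul_comul N).symm).trans (Category.assoc _ _ _))
  rw [Functor.map_comp, ← Category.assoc, h2, Category.assoc, Category.assoc, Category.assoc,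
    ← Category.assoc (P.hat.map d), h1, Category.assoc]

lemma exists_interp_comp : ∀ {l m n : ℕ} (d : MonoCode m n) (c : MonoCode l m),
    ∃ e : MonoCode l n, P.interp e = P.interp d ≫ P.interp c ∧ ∀ i < l, e.val i = d.val (c.val i)
  | _, _, _, nil, c => by
    refine ⟨c, (Category.id_comp _).symm, fun i hi => ?_⟩
    cases c
    exact absurd hi (Nat.not_lt_zero i)
  | _, _, _, skip d, c => by
    obtain ⟨e, he, he'⟩ := exists_interp_comp d c
    refine ⟨skip e, NatTrans.ext (funext fun N => ?_), fun i hi => congrArg Nat.succ (he' i hi)⟩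
    refine (congrArg (fun t => _ ≫ t) (congrArg (fun t => NatTrans.app t N) he)).trans ?_
    exact (Category.assoc _ _ _).symm
  | _, _, _, hit d, skip c => by
    obtain ⟨e, he, he'⟩ := exists_interp_comp d c
    refine ⟨e, NatTrans.ext (funext fun N => ?_), fun i hi => he' i hi⟩
    exact (congrArg (fun t => NatTrans.app t N) he).trans
      (P.hatComul_map_counit_comp ((P.interp d).app N) ((P.interp c).app N))
  | l + 1, m + 1, n + 1, hit d, hit c => by
    obtain ⟨e, he, he'⟩ := exists_interp_comp (hit d) c
    refine ⟨hit e, NatTrans.ext (funext fun N => ?_), fun i hi => ?_⟩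
    · exact (congrArg (fun t => _ ≫ P.hat.map (NatTrans.app t N)) he).trans
        (P.hatComul_map_comul_comp ((P.interp d).app N) ((P.interp c).app N))
    · cases i with
      | zero => rfl
      | succ i => exact he' i (Nat.lt_of_succ_lt_succ hi)
termination_by l m n => l + m + n

variable {P}

lemma IsInterp.comp {l m n : ℕ} {f g : ℕ → ℕ} {t : P.iter n ⟶ P.iter m} {s : P.iter m ⟶ P.iter l}
    (ht : P.IsInterp f t) (hs : P.IsInterp g s) (hg : ∀ i < l, g i < m) :
    P.IsInterp (fun i => f (g i)) (t ≫ s) := by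
  obtain ⟨d, rfl, hd⟩ := ht
  obtain ⟨c, rfl, hc⟩ := hs
  obtain ⟨e, he, he'⟩ := P.exists_interp_comp d c
  exact ⟨e, he, fun i hi => by rw [he' i hi, hc i hi, hd _ (hg i hi)]⟩

lemma IsInterp.nil : P.IsInterp (fun _ => 0) (𝟙 (P.iter 0)) :=
  ⟨MonoCode.nil, rfl, fun i hi => absurd hi (Nat.not_lt_zero i)⟩

lemma IsInterp.skip {m n : ℕ} {f : ℕ → ℕ} {t : P.iter n ⟶ P.iter m} (h : P.IsInterp f t) :
    P.IsInterp (fun i => f i + 1) (P.face n 0 ≫ t) := by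
  obtain ⟨c, rfl, hc⟩ := h
  exact ⟨MonoCode.skip c, by rw [face_zero]; rfl, fun i hi => congrArg Nat.succ (hc i hi)⟩

lemma IsInterp.hit {m n : ℕ} {f : ℕ → ℕ} {t : P.iter (n + 1) ⟶ P.iter m} (h : P.IsInterp f t) :
    P.IsInterp (fun i => Nat.casesOn i 0 f) (P.degen n 0 ≫ P.iterMap t) := by
  obtain ⟨c, rfl, hc⟩ := h
  refine ⟨MonoCode.hit c, by rw [degen_zero]; rfl, fun i hi => ?_⟩
  cases i with
  | zero => rfl
  | succ i => exact hc i (Nat.lt_of_succ_lt_succ hi)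

/-- The map given by the ordinal sum with the one-element ordinal on the left. -/
lemma IsInterp.hit_skip {m n : ℕ} {f : ℕ → ℕ} {t : P.iter n ⟶ P.iter m} (h : P.IsInterp f t) :
    P.IsInterp (fun i => Nat.casesOn i 0 fun j => f j + 1)
      (P.iterMap t) := by
  have h1 : P.degen n 0 ≫ P.iterMap (P.face n 0 ≫ t) = P.iterMap t := by
    rw [degen_zero, face_zero]
    refine NatTrans.ext (funext fun N => ?_)
    change P.hatComul.app ((P.iter n).obj N) ≫ P.hat.map (P.hatCounit.app ((P.iter n).obj N) ≫ t.app N) =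
      P.hat.map (t.app N)
    rw [Functor.map_comp, ← Category.assoc]
    exact (congrArg (fun s => s ≫ P.hat.map (t.app N)) (P.hatComul_map_counit ((P.iter n).obj N))).trans
      (Category.id_comp _)
  exact h1 ▸ h.skip.hit

lemma IsInterp.id (n : ℕ) : P.IsInterp (fun i => i) (𝟙 (P.iter n)) := by
  induction n with
  | zero => exact IsInterp.nil.congr fun i hi => absurd hi (Nat.not_lt_zero i)
  | succ n ih =>
    have := IsInterp.hit_skip ih
    rw [iterMap, Functor.whiskerRight_id'] at this
    refine this.congr fun i _ => ?_
    cases i <;> rfl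

lemma isInterp_eqToHom {m n : ℕ} (h : n = m) (h' : P.iter n = P.iter m) :
    P.IsInterp (fun i => i) (eqToHom h') := by
  subst h
  exact IsInterp.id n

lemma isInterp_face (n : ℕ) (i : Fin (n + 1)) :
    P.IsInterp (fun j => if j < i then j else j + 1) (P.face n i) := by
  induction n with
  | zero =>
    obtain rfl : i = 0 := Fin.fin_one_eq_zero i
    have h := (IsInterp.id (P := P) 0).skip
    rw [Category.comp_id] at h
    exact h.congr fun j hj => absurd hj (Nat.not_lt_zero j)
  | succ n ih =>
    obtain ⟨i, hi⟩ := i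
    cases i with
    | zero =>
      have h := (IsInterp.id (P := P) (n + 1)).skip
      rw [Category.comp_id] at h
      exact h.congr fun j _ => (if_neg (Nat.not_lt_zero j)).symm
    | succ i =>
      refine IsInterp.congr (IsInterp.hit_skip (ih ⟨i, Nat.lt_of_succ_lt_succ hi⟩)) fun j _ => ?_
      cases j with
      | zero => exact (if_pos (Nat.succ_pos i)).symm
      | succ j =>
        change (if j < i then j else j + 1) + 1 = if j + 1 < i + 1 then j + 1 else j + 1 + 1
        split_ifs <;> omega

lemma isInterp_degen (n : ℕ) (i : Fin (n + 1)) :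
    P.IsInterp (fun j => if j ≤ i then j else j - 1) (P.degen n i) := by
  have zero : ∀ n, P.IsInterp (fun j => if j ≤ 0 then j else j - 1) (P.degen n 0) := fun n => by
    have h := (IsInterp.id (P := P) (n + 1)).hit
    rw [iterMap, Functor.whiskerRight_id'] at h
    refine IsInterp.congr (t := P.degen n 0) (by exact (Category.comp_id (P.degen n 0)) ▸ h) fun j _ => ?_
    cases j <;> rfl
  induction n with
  | zero =>
    obtain rfl : i = 0 := Fin.fin_one_eq_zero i
    exact zero 0
  | succ n ih =>
    obtain ⟨i, hi⟩ := i
    cases i with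
    | zero => exact zero (n + 1)
    | succ i =>
      refine IsInterp.congr (IsInterp.hit_skip (ih ⟨i, Nat.lt_of_succ_lt_succ hi⟩)) fun j _ => ?_
      cases j with
      | zero => rfl
      | succ j =>
        change (if j ≤ i then j else j - 1) + 1 = if j + 1 ≤ i + 1 then j + 1 else j + 1 - 1
        split_ifs <;> omega

lemma eqToHom_comp_hat {F G : ((ColorSeq X)ᵒᵖ ⥤ V) ⥤ ((ColorSeq X)ᵒᵖ ⥤ V)} (h : F = G)
    (h' : F ⋙ P.hat = G ⋙ P.hat) (N : (ColorSeq X)ᵒᵖ ⥤ V) :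
    (eqToHom h').app N = P.hat.map ((eqToHom h).app N) := by
  subst h
  exact (P.hat.map_id _).symm

end ColoredOperad

namespace ColoredOperad
open ColorSeq ColoredCollection AugmentedSimplexCategory MonoCode
variable {X : Type v} {V : Type u} [Category.{v} V] [MonoidalCategory V] [SymmetricCategory V]
  [MonoidalClosed V] [HasLimits V] [HasColimits V] (P : ColoredOperad X V)

section
variable {A B F G D E : ((ColorSeq X)ᵒᵖ ⥤ V) ⥤ ((ColorSeq X)ᵒᵖ ⥤ V)}

lemma hatCounit_sum (s : A ⟶ G) (t : B ⟶ D) (h₁ : F = A ⋙ B) (h : F ⋙ P.hat = A ⋙ B ⋙ P.hat)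
    (h' : G ⋙ D = E) :
    Functor.whiskerLeft F P.hatCounit ≫ eqToHom h₁ ≫ Functor.whiskerRight s B ≫
        Functor.whiskerLeft G t ≫ eqToHom h' =
      eqToHom h ≫ Functor.whiskerRight s (B ⋙ P.hat) ≫
        Functor.whiskerLeft G (Functor.whiskerLeft B P.hatCounit ≫ t) ≫ eqToHom h' := by
  subst h₁ h'
  refine NatTrans.ext (funext fun N => ?_)
  simp only [eqToHom_refl, NatTrans.comp_app, NatTrans.id_app, Functor.whiskerLeft_app,
    Functor.whiskerRight_app, Category.comp_id]
  have h1 : P.hat.map (B.map (s.app N)) ≫ P.hatCounit.app (B.obj (G.obj N)) =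
      P.hatCounit.app (B.obj (A.obj N)) ≫ B.map (s.app N) := P.hatCounit.naturality (B.map (s.app N))
  exact (congrArg (fun r => _ ≫ r) (Category.id_comp _)).trans ((Category.assoc _ _ _).symm.trans
    ((congrArg (fun r => r ≫ t.app (G.obj N)) h1.symm).trans ((Category.assoc _ _ _).trans
      (Category.id_comp _).symm)))

lemma hatComul_sum (s : A ⟶ G) (t : B ⋙ P.hat ⟶ D) (h₁ : F = A ⋙ B)
    (h : F ⋙ P.hat = A ⋙ B ⋙ P.hat) (h₂ : G ⋙ D = E) (h' : G ⋙ D ⋙ P.hat = E ⋙ P.hat) :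
    Functor.whiskerLeft F P.hatComul ≫ Functor.whiskerRight (eqToHom h ≫
        Functor.whiskerRight s (B ⋙ P.hat) ≫ Functor.whiskerLeft G t ≫ eqToHom h₂) P.hat =
      eqToHom h ≫ Functor.whiskerRight s (B ⋙ P.hat) ≫
        Functor.whiskerLeft G (Functor.whiskerLeft B P.hatComul ≫ Functor.whiskerRight t P.hat) ≫
          eqToHom h' := by
  subst h₁ h₂
  refine NatTrans.ext (funext fun N => ?_)
  have h1 : P.hat.map (B.map (s.app N)) ≫ P.hatComul.app (B.obj (G.obj N)) =
      P.hatComul.app (B.obj (A.obj N)) ≫ P.hat.map (P.hat.map (B.map (s.app N))) :=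
    P.hatComul.naturality (B.map (s.app N))
  have h2 : P.hatComul.app (B.obj (A.obj N)) ≫
      P.hat.map (𝟙 _ ≫ P.hat.map (B.map (s.app N)) ≫ t.app (G.obj N) ≫ 𝟙 _) =
      𝟙 _ ≫ P.hat.map (B.map (s.app N)) ≫ (P.hatComul.app (B.obj (G.obj N)) ≫
        P.hat.map (t.app (G.obj N))) ≫ 𝟙 _ := by
    rw [Category.id_comp, Category.id_comp, Category.comp_id, Category.comp_id, Functor.map_comp,
      ← Category.assoc, ← Category.assoc, h1]
  exact h2

end

lemma exists_interp_sum {m m' : ℕ} (c : MonoCode m m') {n n' : ℕ} (d : MonoCode n n') :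
    ∀ {k k' : ℕ} (hk : m + n = k) (hk' : m' + n' = k') (h : P.iter k' = P.iter n' ⋙ P.iter m')
      (h' : P.iter n ⋙ P.iter m = P.iter k), ∃ e : MonoCode k k',
      P.interp e = eqToHom h ≫ Functor.whiskerRight (P.interp d) (P.iter m') ≫
        Functor.whiskerLeft (P.iter n) (P.interp c) ≫ eqToHom h' ∧
      ∀ i < k, e.val i = if i < m then c.val i else m' + d.val (i - m) := by
  induction c with
  | nil =>
    intro k k' hk hk' h h'
    obtain rfl : n = k := by omega
    obtain rfl : n' = k' := by omega
    refine ⟨d, ?_, fun i hi => (Nat.zero_add _).symm⟩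
    exact ((Category.id_comp _).trans ((congrArg (fun t => _ ≫ t) (Category.id_comp _)).trans
      (Category.comp_id _))).symm
  | @skip m m' c ih =>
    intro k k' hk hk' h h'
    obtain ⟨l, rfl⟩ : ∃ l, k' = l + 1 := ⟨m' + n', by omega⟩
    have hl : P.iter l = P.iter n' ⋙ P.iter m' := by
      rw [P.iter_add, show m' + n' = l by omega]
    obtain ⟨e, he, he'⟩ := ih hk (by omega) hl h'
    refine ⟨skip e, ?_, fun i hi => ?_⟩
    · refine (congrArg (fun t => Functor.whiskerLeft (P.iter l) P.hatCounit ≫ t) he).trans ?_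
      exact P.hatCounit_sum (P.interp d) (P.interp c) hl h h'
    · change e.val i + 1 = if i < m then c.val i + 1 else m' + 1 + d.val (i - m)
      rw [he' i hi]
      split_ifs <;> omega
  | @hit m m' c ih =>
    intro k k' hk hk' h h'
    obtain ⟨l, rfl⟩ : ∃ l, k' = l + 1 := ⟨m' + n', by omega⟩
    obtain ⟨j, rfl⟩ : ∃ j, k = j + 1 := ⟨m + n, by omega⟩
    have hl : P.iter l = P.iter n' ⋙ P.iter m' := by
      rw [P.iter_add, show m' + n' = l by omega]
    have hj : P.iter n ⋙ P.iter m = P.iter j := by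
      rw [P.iter_add, show m + n = j by omega]
    obtain ⟨e, he, he'⟩ := ih (by omega) hk' h hj
    refine ⟨hit e, ?_, fun i hi => ?_⟩
    · have h1 : P.iterMap (P.interp e) = P.iterMap _ := congrArg P.iterMap he
      have h2 := congrArg (fun t => Functor.whiskerLeft (P.iter l) P.hatComul ≫ t) h1
      have h3 := P.hatComul_sum (P.interp d) (P.interp c) hl h hj h'
      exact h2.trans h3
    · cases i with
      | zero => exact (if_pos (Nat.succ_pos m)).symm
      | succ i =>
        change e.val i = if i + 1 < m + 1 then c.val i else m' + 1 + d.val (i + 1 - (m + 1))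
        rw [he' i (by omega), Nat.add_sub_add_right]
        simp only [Nat.add_lt_add_iff_right]

end ColoredOperad

namespace AugmentedSimplexCategory

/-- The values of a monotone map of finite ordinals. -/
def val : ∀ {x y : AugmentedSimplexCategory}, (x ⟶ y) → ℕ → ℕ
  | .of a, .of b, f, i =>
    if h : i < a.len + 1 then
      ((SimplexCategory.Hom.toOrderHom (WithInitial.down f) ⟨i, h⟩ : Fin (b.len + 1)) : ℕ) else 0
  | .star, _, _, _ => 0
  | .of _, .star, _, _ => 0

lemma val_of {a b : SimplexCategory} (f : a ⟶ b) (i : Fin (a.len + 1)) :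
    val (x := .of a) (y := .of b) f i = (f.toOrderHom i : ℕ) := dif_pos i.2

lemma val_lt {x y : AugmentedSimplexCategory} (f : x ⟶ y) (i : ℕ) (hi : i < x.size) : val f i < y.size := by
  match x, y, f with
  | .of a, .of b, f =>
    have := val_of f ⟨i, hi⟩
    exact this ▸ (f.toOrderHom ⟨i, hi⟩).2
  | .star, _, _ => exact absurd hi (Nat.not_lt_zero i)
  | .of _, .star, f => exact f.elim

lemma val_mono {x y : AugmentedSimplexCategory} (f : x ⟶ y) (i j : ℕ) (hij : i ≤ j) (hj : j < x.size) :
    val f i ≤ val f j := by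
  match x, y, f with
  | .of a, .of b, f =>
    have h1 := val_of f ⟨i, lt_of_le_of_lt hij hj⟩
    have h2 := val_of f ⟨j, hj⟩
    have h3 : f.toOrderHom ⟨i, lt_of_le_of_lt hij hj⟩ ≤ f.toOrderHom ⟨j, hj⟩ := f.toOrderHom.monotone hij
    exact h1.trans_le ((Fin.le_def.1 h3).trans h2.ge)
  | .star, _, _ => exact absurd hj (Nat.not_lt_zero j)
  | .of _, .star, f => exact f.elim

lemma val_id (x : AugmentedSimplexCategory) (i : ℕ) (hi : i < x.size) : val (𝟙 x) i = i := by
  match x with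
  | .of a => exact val_of (𝟙 a) ⟨i, hi⟩
  | .star => exact absurd hi (Nat.not_lt_zero i)

lemma val_eqToHom {x y : AugmentedSimplexCategory} (h : x = y) (i : ℕ) (hi : i < x.size) :
    val (eqToHom h) i = i := by
  subst h
  exact val_id x i hi

lemma val_comp {x y z : AugmentedSimplexCategory} (f : x ⟶ y) (g : y ⟶ z) (i : ℕ) (hi : i < x.size) :
    val (f ≫ g) i = val g (val f i) := by
  match x, y, z, f, g with
  | .of a, .of b, .of c, f, g =>
    have h1 := val_of f ⟨i, hi⟩
    have h2 := val_of g (f.toOrderHom ⟨i, hi⟩)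
    have h3 := val_of (f ≫ g) ⟨i, hi⟩
    exact h3.trans (h2.symm.trans (congrArg _ h1.symm))
  | .star, _, _, _, _ => exact absurd hi (Nat.not_lt_zero i)
  | .of _, .star, _, f, _ => exact f.elim
  | .of _, .of _, .star, _, f => exact f.elim

lemma val_inl (x y : AugmentedSimplexCategory) (i : ℕ) (hi : i < x.size) : val (inl x y) i = i := by
  match x, y with
  | .of a, .of b =>
    exact (val_of (inl' a b) ⟨i, hi⟩).trans (congrArg Fin.val (inl'_eval a b ⟨i, hi⟩))
  | .of a, .star => exact val_id (.of a) i hi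
  | .star, _ => exact absurd hi (Nat.not_lt_zero i)

lemma val_inr (x y : AugmentedSimplexCategory) (i : ℕ) (hi : i < y.size) :
    val (inr x y) i = x.size + i := by
  match x, y with
  | .of a, .of b =>
    exact (val_of (inr' a b) ⟨i, hi⟩).trans (congrArg Fin.val (inr'_eval a b ⟨i, hi⟩))
  | .star, .of b => exact (val_id (.of b) i hi).trans (Nat.zero_add i).symm
  | _, .star => exact absurd hi (Nat.not_lt_zero i)

lemma val_tensorHom {x y x' y' : AugmentedSimplexCategory} (f : x ⟶ x') (g : y ⟶ y') (i : ℕ)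
    (hi : i < (x ⊗ y).size) :
    val (f ⊗ₘ g) i = if i < x.size then val f i else x'.size + val g (i - x.size) := by
  split_ifs with h
  · have h1 := congrArg (fun t => val t i) (inl_comp_tensorHom f g)
    simp only [val_comp _ _ i h, val_inl _ _ i h] at h1
    exact h1.trans (val_inl _ _ _ (val_lt f i h))
  · obtain ⟨j, rfl⟩ := Nat.exists_eq_add_of_le (not_lt.1 h)
    have hj : j < y.size := by rw [size_tensor] at hi; omega
    have h1 := congrArg (fun t => val t j) (inr_comp_tensorHom f g)
    simp only [val_comp _ _ j hj, val_inr _ _ j hj] at h1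
    rw [Nat.add_sub_cancel_left]
    exact h1.trans (val_inr _ _ _ (val_lt g j hj))

lemma val_associator (x y z : AugmentedSimplexCategory) (i : ℕ) (hi : i < ((x ⊗ y) ⊗ z).size) :
    val (α_ x y z).hom i = i := by
  match x, y, z with
  | .of x, .of y, .of z =>
    exact val_eqToHom (congrArg (fun j ↦ WithInitial.of (SimplexCategory.mk j)) (by simp +arith)) i hi
  | .star, .star, .star => exact val_id _ i hi
  | .star, .of _, .star => exact val_id _ i hi
  | .star, .star, .of _ => exact val_id _ i hi
  | .star, .of _, .of _ => exact val_id _ i hi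
  | .of _, .star, .star => exact val_id _ i hi
  | .of _, .star, .of _ => exact val_id _ i hi
  | .of _, .of _, .star => exact val_id _ i hi

lemma val_leftUnitor (x : AugmentedSimplexCategory) (i : ℕ) (hi : i < (𝟙_ _ ⊗ x).size) :
    val (λ_ x).hom i = i := by
  match x with
  | .of _ => exact val_id _ i hi
  | .star => exact val_id _ i hi

lemma val_rightUnitor (x : AugmentedSimplexCategory) (i : ℕ) (hi : i < (x ⊗ 𝟙_ _).size) :
    val (ρ_ x).hom i = i := by
  match x with
  | .of _ => exact val_id _ i hi
  | .star => exact val_id _ i hi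

lemma val_δ (n : ℕ) (i : Fin (n + 2)) (j : ℕ) (hj : j < n + 1) :
    val (inclusion.map (SimplexCategory.δ i)) j = if j < i then j else j + 1 := by
  refine (val_of (SimplexCategory.δ i) ⟨j, hj⟩).trans ?_
  change ((Fin.succAbove i ⟨j, hj⟩ : Fin (n + 2)) : ℕ) = _
  rw [Fin.succAbove]
  simp only [Fin.lt_def]
  split_ifs <;> simp_all

lemma val_σ (n : ℕ) (i : Fin (n + 1)) (j : ℕ) (hj : j < n + 2) :
    val (inclusion.map (SimplexCategory.σ i)) j = if j ≤ i then j else j - 1 := by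
  refine (val_of (SimplexCategory.σ i) ⟨j, hj⟩).trans ?_
  change ((Fin.predAbove i ⟨j, hj⟩ : Fin (n + 1)) : ℕ) = _
  rw [Fin.predAbove]
  simp only [Fin.lt_def, Fin.val_castSucc]
  split_ifs <;> simp <;> omega

end AugmentedSimplexCategory

namespace ColoredOperad
open ColorSeq ColoredCollection AugmentedSimplexCategory MonoCode
variable {X : Type v} {V : Type u} [Category.{v} V] [MonoidalCategory V] [SymmetricCategory V]
  [MonoidalClosed V] [HasLimits V] [HasColimits V] (P : ColoredOperad X V)

variable {P} in
lemma IsInterp.sum {m m' n n' : ℕ} {f g : ℕ → ℕ} {t : P.iter m' ⟶ P.iter m} {s : P.iter n' ⟶ P.iter n}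
    (ht : P.IsInterp f t) (hs : P.IsInterp g s) {k k' : ℕ} (hk : m + n = k) (hk' : m' + n' = k')
    (h : P.iter k' = P.iter n' ⋙ P.iter m') (h' : P.iter n ⋙ P.iter m = P.iter k) :
    P.IsInterp (fun i => if i < m then f i else m' + g (i - m))
      (eqToHom h ≫ Functor.whiskerRight s (P.iter m') ≫ Functor.whiskerLeft (P.iter n) t ≫ eqToHom h') := by
  obtain ⟨c, rfl, hc⟩ := ht
  obtain ⟨d, rfl, hd⟩ := hs
  obtain ⟨e, he, he'⟩ := P.exists_interp_sum c d hk hk' h h'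
  refine ⟨e, he, fun i hi => (he' i hi).trans ?_⟩
  split_ifs with h1
  · exact (hc i h1).trans (if_pos h1).symm
  · exact (congrArg (m' + ·) (hd _ (by omega))).trans (if_neg h1).symm

lemma exists_isInterp_val {x y : AugmentedSimplexCategory} (f : x ⟶ y) :
    ∃ t : P.iter y.size ⟶ P.iter x.size, P.IsInterp (val f) t := by
  obtain ⟨c, hc⟩ := exists_val x.size y.size (val f) (val_lt f) (val_mono f)
  exact ⟨P.interp c, c, rfl, hc⟩

/-- The functor from the opposite of the category of finite ordinals to endofunctors given by the
comonad `hat`. -/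
noncomputable def iterateFunctor : P.IterateFunctor where
  map f := (P.exists_isInterp_val f).choose
  map_id x := (P.exists_isInterp_val (𝟙 x)).choose_spec.unique (IsInterp.id _) (val_id x)
  map_comp f g := (P.exists_isInterp_val (f ≫ g)).choose_spec.unique
    ((P.exists_isInterp_val g).choose_spec.comp (P.exists_isInterp_val f).choose_spec (val_lt f))
    (val_comp f g)
  map_counit := (P.exists_isInterp_val _).choose_spec.unique (isInterp_face 0 0)
    fun i hi => absurd hi (Nat.not_lt_zero i)
  map_face n i := (P.exists_isInterp_val _).choose_spec.unique (isInterp_face (n + 1) i) (val_δ n i)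
  map_degen n i := (P.exists_isInterp_val _).choose_spec.unique (isInterp_degen n i) (val_σ n i)

lemma isInterp_map {x y : AugmentedSimplexCategory} (f : x ⟶ y) :
    P.IsInterp (val f) (P.iterateFunctor.map f) := (P.exists_isInterp_val f).choose_spec

lemma map_tensorHom {x y x' y' : AugmentedSimplexCategory} (f : x ⟶ x') (g : y ⟶ y')
    (h : P.iter (x' ⊗ y').size = P.iter y'.size ⋙ P.iter x'.size)
    (h' : P.iter y.size ⋙ P.iter x.size = P.iter (x ⊗ y).size) :
    P.iterateFunctor.map (f ⊗ₘ g) =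
      eqToHom h ≫ Functor.whiskerRight (P.iterateFunctor.map g) (P.iter x'.size) ≫
        Functor.whiskerLeft (P.iter y.size) (P.iterateFunctor.map f) ≫ eqToHom h' :=
  (P.isInterp_map _).unique ((P.isInterp_map f).sum (P.isInterp_map g) (size_tensor x y).symm
    (size_tensor x' y').symm h h') (val_tensorHom f g)

lemma map_of_val {x y : AugmentedSimplexCategory} (f : x ⟶ y) (hf : ∀ i < x.size, val f i = i)
    (h : y.size = x.size) : P.iterateFunctor.map f = eqToHom (congrArg P.iter h) :=
  (P.isInterp_map f).unique (isInterp_eqToHom h _) hf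

end ColoredOperad

namespace AugmentedSimplexCategory

lemma val_inv {x y : AugmentedSimplexCategory} (e : x ≅ y) (h : ∀ i < x.size, val e.hom i = i)
    (h' : y.size = x.size) (i : ℕ) (hi : i < y.size) : val e.inv i = i := by
  have h1 := val_comp e.hom e.inv i (h' ▸ hi)
  rw [e.hom_inv_id, val_id _ _ (h' ▸ hi), h _ (h' ▸ hi)] at h1
  exact h1.symm

end AugmentedSimplexCategory

namespace Mult
open ColorSeq
variable {X : Type w} {V : Type u} [Category.{v} V] [MonoidalCategory V] [SymmetricCategory V]
  {N : (ColorSeq X)ᵒᵖ ⥤ V}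

lemma Unital.ofSinglesApp_single {M : Mult N} (hM : M.Unital) (c : X) :
    M.ofSinglesApp (single c) = oneHom fun _ : Fin 1 => N.obj (op (single c)) := by
  let z : Fin 1 → ColorSeq X := fun _ => single c
  let s : concat z ⟶ single c := concatSingles (single c)
  have h1 : concatOne z = s := by
    ext j
    exact congrArg Fin.val (Subsingleton.elim (α := Fin 1) _ _)
  have h2 : N.map (concatOne z).op ≫ N.map (rev s).op = 𝟙 (N.obj (op (single c))) := by
    rw [h1, ← N.map_comp, ← op_comp, rev_hom, op_id, N.map_id]
  exact (congrArg (fun t => t ≫ N.map (rev s).op) (hM z)).trans ((Category.assoc _ _ _).trans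
    ((congrArg (fun t => oneHom (fun _ : Fin 1 => N.obj (op (single c))) ≫ t) h2).trans
      (Category.comp_id _)))

lemma hom_ext_singles {C : X → V} {M : Mult N} {g g' : (eps X V).obj C ⟶ N}
    (hg : IsHom (ofPow C) M g) (hg' : IsHom (ofPow C) M g')
    (h : ∀ c, g.app (op (single c)) = g'.app (op (single c))) : g = g' := by
  refine NatTrans.ext (funext fun x => ?_)
  obtain ⟨x⟩ := x
  have h1 := (hg fun i => single (x.col i)).trans
    ((congrArg (fun t => bigMap t ≫ M.mu fun i => single (x.col i))
      (funext fun i => h (x.col i))).trans (hg' fun i => single (x.col i)).symm)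
  have h2 : g.app (op (concat fun i => single (x.col i))) = g'.app _ := by
    have : IsIso (powJoin C fun i => single (x.col i)) := by unfold powJoin; infer_instance
    exact (cancel_epi (powJoin C fun i => single (x.col i))).1 h1
  have h3 : ((eps X V).obj C).map (concatSingles x).op ≫ ((eps X V).obj C).map (rev (concatSingles x)).op =
      𝟙 _ := by
    rw [← Functor.map_comp, ← op_comp, rev_hom, op_id, CategoryTheory.Functor.map_id]
  rw [← Category.id_comp (g.app _), ← Category.id_comp (g'.app _), ← h3, Category.assoc, Category.assoc,
    g.naturality, g'.naturality, h2]

end Mult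

namespace ColoredOperad
open ColorSeq ColoredCollection AugmentedSimplexCategory Mult
variable {X : Type v} {V : Type u} [Category.{v} V] [MonoidalCategory V] [SymmetricCategory V]
  [MonoidalClosed V] [HasLimits V] [HasColimits V] (P : ColoredOperad X V)

lemma iterMult_assoc (C : X → V) (n : ℕ) : (P.iterMult C n).Assoc := by
  induction n with
  | zero => exact ofPow_assoc C
  | succ n ih => exact Assoc.hat P ih

lemma iterMult_unital (C : X → V) (n : ℕ) : (P.iterMult C n).Unital := by
  induction n with
  | zero => exact ofPow_unital C
  | succ n ih => exact Unital.hat P ih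

lemma map_unit_ofSingles (C : X → V) :
    (eps X V).map (P.unit.app C) ≫ (P.iterMult C 0).ofSingles = 𝟙 ((eps X V).obj C) := by
  have h1 : IsHom (ofPow C) (ofPow ((P.laxTerm 0).obj C)) ((eps X V).map (P.unit.app C)) :=
    fun z => powJoin_powMap (P.unit.app C) z
  refine hom_ext_singles (M := P.iterMult C 0)
    (IsHom.comp h1 (isHom_ofSingles (P.iterMult_assoc C 0))) (IsHom.id _) fun c => ?_
  have h2 := (P.iterMult_unital C 0).ofSinglesApp_single c
  refine (congrArg (fun t => ((eps X V).map (P.unit.app C)).app (op (single c)) ≫ t) h2).trans ?_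
  have h3 := bigMap_one (V := V) (A := fun _ : Fin 1 => C c) (B := fun _ : Fin 1 => (P.laxTerm 0).obj C c)
    fun _ => P.unit.app C c
  exact h3.trans (ρ_ (C c)).hom_inv_id

lemma unit_ofSingles (C : X → V) (n : ℕ) :
    P.unit.app ((P.laxTerm n).obj C) ≫ (ev₁ X V).map (P.iterMult C n).ofSingles = 𝟙 _ :=
  funext fun c => by
    have h2 := (P.iterMult_unital C n).ofSinglesApp_single c
    refine (congrArg (fun t => P.unit.app ((P.laxTerm n).obj C) c ≫ t) h2).trans ?_
    exact (ρ_ ((P.laxTerm n).obj C c)).inv_hom_id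

/-- The map `ℙ^n ε π ℙ^m ε ⟶ ℙ^k ε` for `k = n + m`, where `ℙ`, `ε`, `π` stand for `hat`, `eps`, `ev₁`. -/
noncomputable def join {n m k : ℕ} (h : P.iter m ⋙ P.iter n = P.iter k) (C : X → V) :
    (P.iter n).obj ((eps X V).obj ((P.laxTerm m).obj C)) ⟶ (P.iter k).obj ((eps X V).obj C) :=
  (P.iter n).map (P.iterMult C m).ofSingles ≫ (eqToHom h).app ((eps X V).obj C)

lemma isHom_join (C : X → V) {m n k : ℕ} (hk : n + m = k) (h : P.iter m ⋙ P.iter n = P.iter k) :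
    IsHom (P.iterMult ((P.laxTerm m).obj C) n) (P.iterMult C k) (P.join h C) := by
  induction n generalizing k with
  | zero =>
    obtain rfl : m = k := by omega
    have h1 : P.join h C = (P.iterMult C m).ofSingles := Category.comp_id _
    rw [h1]
    exact fun {_} z => isHom_ofSingles (P.iterMult_assoc C m) z
  | succ n ih =>
    obtain ⟨l, rfl⟩ : ∃ l, k = l + 1 := ⟨n + m, by omega⟩
    have hl : P.iter m ⋙ P.iter n = P.iter l := by rw [P.iter_add, show n + m = l by omega]
    have h1 : P.join h C = P.hat.map (P.join hl C) := by
      refine Eq.trans ?_ (P.hat.map_comp _ _).symm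
      exact congrArg (fun t => P.hat.map ((P.iter n).map (P.iterMult C m).ofSingles) ≫ t)
        (eqToHom_comp_hat hl h _)
    rw [h1]
    exact fun {_} z => IsHom.hatMap P (ih (by omega) hl) z

lemma eqToHom_laxTerm_app {n m : ℕ} (h : n = m) (h' : P.laxTerm n = P.laxTerm m)
    (h'' : P.iter n = P.iter m) (C : X → V) :
    (eqToHom h').app C = (ev₁ X V).map ((eqToHom h'').app ((eps X V).obj C)) := by
  subst h
  rfl

lemma iter_tensor (x y : AugmentedSimplexCategory) :
    P.iter y.size ⋙ P.iter x.size = P.iter (x ⊗ y).size := by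
  rw [P.iter_add, size_tensor]

lemma mu_app (A : P.IterateFunctor) (x y : AugmentedSimplexCategoryᵒᵖ) (C : X → V) :
    (A.mu x y).unmop.app C = (ev₁ X V).map (P.join (P.iter_tensor x.unop y.unop) C) := by
  have h1 : P.join (P.iter_tensor x.unop y.unop) C = P.join (P.iter_add x.unop.size y.unop.size) C ≫
      (eqToHom (congrArg P.iter (size_tensor x.unop y.unop).symm)).app ((eps X V).obj C) := by
    rw [join, join, Category.assoc, ← NatTrans.comp_app, eqToHom_trans]
  rw [h1]
  exact congrArg (fun t => (ev₁ X V).map (P.join (P.iter_add x.unop.size y.unop.size) C) ≫ t)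
    (P.eqToHom_laxTerm_app (size_tensor x.unop y.unop).symm _ _ C)

end ColoredOperad

namespace ColoredOperad
open ColorSeq ColoredCollection AugmentedSimplexCategory Mult
variable {X : Type v} {V : Type u} [Category.{v} V] [MonoidalCategory V] [SymmetricCategory V]
  [MonoidalClosed V] [HasLimits V] [HasColimits V] (P : ColoredOperad X V)

lemma map_whiskerRight {x x' : AugmentedSimplexCategory} (f : x ⟶ x') (y : AugmentedSimplexCategory) :
    P.iterateFunctor.map (f ▷ y) =
      eqToHom (P.iter_tensor x' y).symm ≫
        Functor.whiskerLeft (P.iter y.size) (P.iterateFunctor.map f) ≫ eqToHom (P.iter_tensor x y) := by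
  have h := P.map_tensorHom f (𝟙 y) (P.iter_tensor x' y).symm (P.iter_tensor x y)
  rw [P.iterateFunctor.map_id, Functor.whiskerRight_id', Category.id_comp, tensorHom_id] at h
  exact h

lemma map_whiskerLeft (x : AugmentedSimplexCategory) {y y' : AugmentedSimplexCategory} (g : y ⟶ y') :
    P.iterateFunctor.map (x ◁ g) =
      eqToHom (P.iter_tensor x y').symm ≫
        Functor.whiskerRight (P.iterateFunctor.map g) (P.iter x.size) ≫ eqToHom (P.iter_tensor x y) := by
  have h := P.map_tensorHom (𝟙 x) g (P.iter_tensor x y').symm (P.iter_tensor x y)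
  rw [P.iterateFunctor.map_id, Functor.whiskerLeft_id', Category.id_comp, id_tensorHom] at h
  exact h

lemma join_natural_left {x x' : AugmentedSimplexCategory} (f : x ⟶ x') (y : AugmentedSimplexCategory)
    (C : X → V) :
    (P.iterateFunctor.map f).app ((eps X V).obj ((P.laxTerm y.size).obj C)) ≫
        P.join (P.iter_tensor x y) C =
      P.join (P.iter_tensor x' y) C ≫ (P.iterateFunctor.map (f ▷ y)).app ((eps X V).obj C) := by
  rw [map_whiskerRight, join, join, Category.assoc, NatTrans.comp_app, NatTrans.comp_app,
    Functor.whiskerLeft_app]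
  have h1 : (eqToHom (P.iter_tensor x' y)).app ((eps X V).obj C) ≫
      (eqToHom (P.iter_tensor x' y).symm).app ((eps X V).obj C) = 𝟙 _ := by
    rw [← NatTrans.comp_app, eqToHom_trans, eqToHom_refl, NatTrans.id_app]
  have h2 := (P.iterateFunctor.map f).naturality (P.iterMult C y.size).ofSingles
  rw [reassoc_of% h1]
  exact (Category.assoc _ _ _).symm.trans ((congrArg (fun t => t ≫ _) h2.symm).trans (Category.assoc _ _ _))

lemma join_natural_right (x : AugmentedSimplexCategory) {y y' : AugmentedSimplexCategory} (g : y ⟶ y')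
    (C : X → V) :
    (P.iter x.size).map ((eps X V).map ((ev₁ X V).map ((P.iterateFunctor.map g).app ((eps X V).obj C)))) ≫
        P.join (P.iter_tensor x y) C =
      P.join (P.iter_tensor x y') C ≫ (P.iterateFunctor.map (x ◁ g)).app ((eps X V).obj C) := by
  rw [map_whiskerLeft, join, join, Category.assoc, NatTrans.comp_app, NatTrans.comp_app,
    Functor.whiskerRight_app]
  have h1 : (eqToHom (P.iter_tensor x y')).app ((eps X V).obj C) ≫
      (eqToHom (P.iter_tensor x y').symm).app ((eps X V).obj C) = 𝟙 _ := by
    rw [← NatTrans.comp_app, eqToHom_trans, eqToHom_refl, NatTrans.id_app]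
  have h2 := congrArg (P.iter x.size).map (IsHom.ofSingles ((P.isInterp_map g).isHom C))
  rw [Functor.map_comp, Functor.map_comp] at h2
  rw [reassoc_of% h1]
  exact (Category.assoc _ _ _).symm.trans ((congrArg (fun t => t ≫ _) h2).trans (Category.assoc _ _ _))

section
variable {𝒞 : Type*} [Category* 𝒞] {Ix Iy Iz Ixy Iyz I I' : 𝒞 ⥤ 𝒞}

lemma eqToHom_assoc (h₁ : Iy ⋙ Ix = Ixy) (h₂ : Iz ⋙ Ixy = I) (h₃ : Iz ⋙ Iy = Iyz) (h₄ : Iyz ⋙ Ix = I')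
    (h₅ : I = I') {M N : 𝒞} (f : M ⟶ Iz.obj N) :
    (eqToHom h₁).app M ≫ (Ixy.map f ≫ (eqToHom h₂).app N) ≫ (eqToHom h₅).app N =
      Ix.map (Iy.map f ≫ (eqToHom h₃).app N) ≫ (eqToHom h₄).app N := by
  subst h₁ h₂ h₃ h₅
  simp

end

lemma join_assoc (x y z : AugmentedSimplexCategory) (C : X → V)
    (h : P.iter ((x ⊗ y) ⊗ z).size = P.iter (x ⊗ y ⊗ z).size) :
    P.join (P.iter_tensor x y) ((P.laxTerm z.size).obj C) ≫ P.join (P.iter_tensor (x ⊗ y) z) C ≫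
        (eqToHom h).app ((eps X V).obj C) =
      (P.iter x.size).map ((eps X V).map ((ev₁ X V).map (P.join (P.iter_tensor y z) C))) ≫
        P.join (P.iter_tensor x (y ⊗ z)) C := by
  have h1 := congrArg (P.iter x.size).map
    (IsHom.ofSingles (P.isHom_join C (size_tensor y z).symm (P.iter_tensor y z)))
  rw [Functor.map_comp, Functor.map_comp] at h1
  have h2 := eqToHom_assoc (P.iter_tensor x y) (P.iter_tensor (x ⊗ y) z) (P.iter_tensor y z)
    (P.iter_tensor x (y ⊗ z)) h (P.iterMult C z.size).ofSingles
  refine (Category.assoc _ _ _).trans ((congrArg (fun t => _ ≫ t) h2).trans ?_)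
  refine ((Category.assoc _ _ _).symm.trans (congrArg (fun t => t ≫ _) h1.symm)).trans ?_
  exact Category.assoc _ _ _

lemma map_associator_inv (x y z : AugmentedSimplexCategory)
    (h : P.iter ((x ⊗ y) ⊗ z).size = P.iter (x ⊗ y ⊗ z).size) :
    P.iterateFunctor.map (α_ x y z).inv = eqToHom h := by
  have h' : ((x ⊗ y) ⊗ z).size = (x ⊗ y ⊗ z).size := by
    simp only [size_tensor, Nat.add_assoc]
  exact P.map_of_val _ (val_inv (α_ x y z) (val_associator x y z) h'.symm) h'

lemma size_tensorUnit_tensor (x : AugmentedSimplexCategory) : x.size = (𝟙_ _ ⊗ x).size :=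
  (Nat.zero_add _).symm.trans (size_tensor (𝟙_ _) x).symm

lemma size_tensor_tensorUnit (x : AugmentedSimplexCategory) : x.size = (x ⊗ 𝟙_ _).size :=
  (size_tensor x (𝟙_ _)).symm

lemma join_left_unit (x : AugmentedSimplexCategory) (C : X → V) :
    P.join (P.iter_tensor (𝟙_ _) x) C ≫ (P.iterateFunctor.map (λ_ x).inv).app ((eps X V).obj C) =
      (P.iterMult C x.size).ofSingles := by
  rw [P.map_of_val _ (val_inv (λ_ x) (val_leftUnitor x) (size_tensorUnit_tensor x))
    (size_tensorUnit_tensor x).symm, join, Category.assoc, ← NatTrans.comp_app, eqToHom_trans]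
  exact Category.comp_id _

lemma join_right_unit (x : AugmentedSimplexCategory) (C : X → V) :
    P.join (P.iter_tensor x (𝟙_ _)) C ≫ (P.iterateFunctor.map (ρ_ x).inv).app ((eps X V).obj C) =
      (P.iter x.size).map (P.iterMult C 0).ofSingles := by
  rw [P.map_of_val _ (val_inv (ρ_ x) (val_rightUnitor x) (size_tensor_tensorUnit x))
    (size_tensor_tensorUnit x).symm, join, Category.assoc, ← NatTrans.comp_app, eqToHom_trans]
  exact Category.comp_id _

/-- The lax monoidal structure on `n ↦ π ℙ^n ε`. -/
noncomputable abbrev laxMonoidal : P.iterateFunctor.lax.LaxMonoidal where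
  ε := P.iterateFunctor.one
  μ x y := P.iterateFunctor.mu x y
  μ_natural_left {x x'} f y := by
    refine Quiver.Hom.unmop_inj (NatTrans.ext (funext fun C => ?_))
    have h := congrArg (ev₁ X V).map (P.join_natural_left f.unop y.unop C)
    refine (congrArg (fun t => _ ≫ t) (P.mu_app _ x' y C)).trans (Eq.trans ?_
      (congrArg (fun t => t ≫ _) (P.mu_app _ x y C)).symm)
    exact h
  μ_natural_right {y y'} x g := by
    refine Quiver.Hom.unmop_inj (NatTrans.ext (funext fun C => ?_))
    have h := congrArg (ev₁ X V).map (P.join_natural_right x.unop g.unop C)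
    refine (congrArg (fun t => _ ≫ t) (P.mu_app _ x y' C)).trans (Eq.trans ?_
      (congrArg (fun t => t ≫ _) (P.mu_app _ x y C)).symm)
    exact h
  associativity x y z := by
    refine Quiver.Hom.unmop_inj (NatTrans.ext (funext fun C => ?_))
    have hs : P.iter ((x.unop ⊗ y.unop) ⊗ z.unop).size = P.iter (x.unop ⊗ y.unop ⊗ z.unop).size := by
      simp only [size_tensor, Nat.add_assoc]
    have h := P.join_assoc x.unop y.unop z.unop C hs
    rw [← P.map_associator_inv x.unop y.unop z.unop hs] at h
    refine Eq.trans (congrArg₂ (fun s t => s ≫ t) (P.mu_app P.iterateFunctor x y ((P.laxTerm z.unop.size).obj C))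
      (congrArg (fun t => t ≫ _) (P.mu_app P.iterateFunctor (x ⊗ y) z C))) ?_
    refine (congrArg (ev₁ X V).map h).trans (Eq.trans ?_ (Category.id_comp _).symm)
    exact (congrArg₂ (fun s t => (P.laxTerm x.unop.size).map s ≫ t) (P.mu_app P.iterateFunctor y z C)
      (P.mu_app P.iterateFunctor x (y ⊗ z) C)).symm
  left_unitality x := by
    refine Quiver.Hom.unmop_inj (NatTrans.ext (funext fun C => ?_))
    have h := congrArg (ev₁ X V).map (P.join_left_unit x.unop C)
    have h1 := (congrArg (fun t => P.unit.app ((P.laxTerm x.unop.size).obj C) ≫ t) h).trans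
      (P.unit_ofSingles C x.unop.size)
    exact (((congrArg (fun t => P.unit.app ((P.laxTerm x.unop.size).obj C) ≫ t ≫ _)
      (P.mu_app P.iterateFunctor (𝟙_ _) x C))).trans h1).symm
  right_unitality x := by
    refine Quiver.Hom.unmop_inj (NatTrans.ext (funext fun C => ?_))
    have h := congrArg (ev₁ X V).map (P.join_right_unit x.unop C)
    have h1 := congrArg (P.iter x.unop.size ⋙ ev₁ X V).map (P.map_unit_ofSingles C)
    replace h1 := (Functor.map_comp (P.iter x.unop.size ⋙ ev₁ X V) _ _).symm.trans
      (h1.trans (CategoryTheory.Functor.map_id _ _))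
    have h2 := (congrArg (fun t => (P.laxTerm x.unop.size).map (P.unit.app C) ≫ t) h).trans h1
    exact (((congrArg (fun t => (P.laxTerm x.unop.size).map (P.unit.app C) ≫ t ≫ _)
      (P.mu_app P.iterateFunctor x (𝟙_ _) C))).trans h2).symm

end ColoredOperad

theorem mainTheorem8 {X : Type v} {V : Type u} [Category.{v} V] [MonoidalCategory V]
    [SymmetricCategory V] [MonoidalClosed V] [HasLimits V] [HasColimits V]
    (P : ColoredOperad X V) :
    ∃ (A : P.IterateFunctor) (L : A.lax.LaxMonoidal),
      (∀ x y, L.μ x y = A.mu x y) ∧ L.ε = A.one :=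
  ⟨P.iterateFunctor, P.laxMonoidal, fun _ _ => rfl, rfl⟩
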